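/- **Setting.** There are $K\ge 1$ arms. The class $\mathcal P$ consists of the Bernoulli distributions with mean in a set $\Theta\subset[0,1]$, or of the Gaussian distributions with mean in a set $\Theta\subset\mathbb R$ and a known variance $\sigma^2>0$; $\mathcal Q\supset\mathcal P$ is the set of all Bernoulli distributions, respectively of all Gaussian distributions with variance $\sigma^2$. Distributions are identified with their means. For an instance $\boldsymbol P=(P_1,\dots,P_K)\in\mathcal P^K$ let $\mathcal I^*(\boldsymbol P)\subset[K]$ be the set of arms of largest mean. Let $H:\mathcal P^K\to(0,\infty]$ be any function (a complexity measure). Products of values in $[0,\infty]$ use $0\cdot D=0$ for a weight $0$ and a divergence $D$ (also if $D=\infty$), and $H(\boldsymbol P)\cdot x=\infty$ for all $x\in[0,\infty]$ if $H(\boldsymbol P)=\infty$ (an instance of infinite complexity imposes no constraint); an infimum over the empty set is $\infty$. An algorithm $\pi_T$ with budget $T$ chooses in each round $t\le T$ an arm $I(t)$ as a measurable function of the past arms and rewards and possibly of an independent random seed, receives an independent reward distributed according to $P_{I(t)}$, and after round $T$ recommends an arm $J(T)$. The worst-case rate of a sequence $\{\pi_T\}_{T\ge1}$ is $$R(\{\pi_T\})=\inf_{\boldsymbol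 P\in\mathcal P^K}H(\boldsymbol P)\,\liminf_{T\to\infty}\frac1T\log\frac1{\mathbb P_{\boldsymbol P}[J(T)\notin\mathcal I^*(\boldsymbol P)]}.$$ Let $D$ be the Kullback–Leibler divergence and $\Delta_K$ the probability simplex. Put $$R^{\mathrm{go}}=\sup_{\boldsymbol r,J}\ \inf_{\boldsymbol Q\in\mathcal Q^K}\ \inf_{\boldsymbol P\in\mathcal P^K:\,J(\boldsymbol Q)\notin\mathcal I^*(\boldsymbol P)}H(\boldsymbol P)\sum_{i\in[K]}r_i(\boldsymbol Q)D(Q_i\Vert P_i)$$ over all functions $\boldsymbol r:\mathcal Q^K\to\Delta_K$ and $J:\mathcal Q^K\to[K]$, and, for $B\ge1$, $$R^{\mathrm{go}}_B=\sup_{\boldsymbol r_1,\dots,\boldsymbol r_B,J}\ \inf_{(\boldsymbol Q_1,\dots,\boldsymbol Q_B)\in\mathcal Q^{KB}}\ \inf_{\boldsymbol P\in\mathcal P^K:\,J(\boldsymbol Q_1,\dots,\boldsymbol Q_B)\notin\mathcal I^*(\boldsymbol P)}\frac{H(\boldsymbol P)}{B}\sum_{b\in[B],\,i\in[K]}r_{b,i}(\boldsymbol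 Q_1,\dots,\boldsymbol Q_b)\,D(Q_{b,i}\Vert P_i)$$ over all functions $\boldsymbol r_b:\mathcal Q^{Kb}\to\Delta_K$ and $J:\mathcal Q^{KB}\to[K]$. For $\varepsilon>0$, a tuple $(\boldsymbol r^*_1,\dots,\boldsymbol r^*_B,J^*)$ is called an $\varepsilon$-optimal solution if its objective (the double infimum) is at least $R^{\mathrm{go}}_B-\varepsilon$. **DOT** (delayed optimal tracking) with batch number $B$ and tolerance $\varepsilon$ uses an $\varepsilon$-optimal solution. It splits the budget $T$ into $B+K-1$ consecutive batches of $T_B=\lfloor T/(B+K-1)\rfloor$ rounds and ignores the remaining rounds. Batch $b\le K$ draws only arm $b$; let $Q'_{1,i}$ be the empirical mean of arm $i$ in batch $i$. In batch $b=K+1,\dots,B+K-1$ it computes $\boldsymbol r_b=\boldsymbol r^*_{b-K}(\boldsymbol Q'_1,\dots,\boldsymbol Q'_{b-K})$, draws each arm $i$ for $n_{b,i}\ge r_{b,i}(T_B-K)$ times, where $\sum_i n_{b,i}=T_B$ and $(n_{b,i})_i$ is given by a fixed rule depending on $T_B$ and $\boldsymbol r_b$, observes the empirical means $Q_{b,i}$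 of the batch, and stores $Q'_{b-K+1,i}=Q'_{b-K,i}+r_{b,i}(Q_{b,i}-Q'_{b-K,i})$. It recommends $J^*(\boldsymbol Q'_1,\dots,\boldsymbol Q'_B)$. **Theorem (Optimality of DOT).** Assume that $H$ is such that $R^{\mathrm{go}}<\infty$. Then the limit $R^{\mathrm{go}}_\infty=\lim_{B\to\infty}R^{\mathrm{go}}_B$ exists and is finite. Moreover: 1. For every $\eta>0$ there are $B\ge1$ and $\varepsilon>0$ such that $\varepsilon$-optimal solutions (and rules for the numbers $n_{b,i}$) exist and, for each choice of them, $R(\{\pi_{\mathrm{DOT},T}\})\ge R^{\mathrm{go}}_\infty-\eta$. 2. Every sequence of algorithms satisfies $R(\{\pi_T\})\le R^{\mathrm{go}}_\infty$. Thus DOT is asymptotically minimax optimal for Bernoulli and Gaussian arms. -/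

import Mathlib

open MeasureTheory ProbabilityTheory Filter Topology
open scoped ENNReal NNReal BigOperators

noncomputable section

namespace BestArm

/-! ### Reward models -/

/-- The two reward models: Bernoulli rewards, or Gaussian rewards with a known variance `v > 0`.
In both of them a distribution is identified with its mean. -/
inductive RewardFamily where
  | bernoulli : RewardFamily
  | gaussian (v : ℝ≥0) (hv : 0 < v) : RewardFamily

/-- The set of the means of the full model (`𝒬`, the possible empirical means). -/
def RewardFamily.means : RewardFamily → Set ℝ
  | .bernoulli => Set.Icc 0 1
  | .gaussian _ _ => Set.univ

/-- The member of the family with mean `m`; it is only used for `m ∈ F.means`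
(outside `[0, 1]` the Bernoulli mean is clamped). -/
def RewardFamily.law : RewardFamily → ℝ → Measure ℝ
  | .bernoulli, m => bernoulliMeasure (1 : ℝ) 0 (Set.projIcc 0 1 zero_le_one m)
  | .gaussian v _, m => gaussianReal m v

instance RewardFamily.isProbabilityMeasure_law (F : RewardFamily) (m : ℝ) :
    IsProbabilityMeasure (F.law m) := by
  cases F <;> (unfold RewardFamily.law; infer_instance)

/-- The Kullback-Leibler divergence `D(q ‖ p)` between the members with means `q` and `p`. -/
def RewardFamily.kl (F : RewardFamily) (q p : ℝ) : ℝ≥0∞ :=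
  InformationTheory.klDiv (F.law q) (F.law p)

/-- The set of best arms of the instance with vector of means `P`. -/
def bestArms {K : ℕ} (P : Fin K → ℝ) : Set (Fin K) :=
  {i | ∀ j, P j ≤ P i}

/-- The product `h * x` of a complexity `h ∈ (0, ∞]` and a rate `x ∈ [0, ∞]`, with `∞ * x = ∞`
for every `x`, also for `x = 0`: an instance of infinite complexity imposes no constraint
(a probability of error `exp (- R T / h + o(T))` with `1 / h = 0` is no requirement). -/
def weigh (h x : ℝ≥0∞) : ℝ≥0∞ :=
  if h = ⊤ then ⊤ else h * x

/-! ### Algorithms and their worst-case rate -/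

/-- An algorithm for `K` arms and a budget of `T` rounds (rounds are numbered from `0`). It may use
a random seed in `[0, 1]`. The arm drawn in round `t` depends on the seed and on the pairs
(arm, reward) of the rounds before `t`; the recommendation depends on the seed and on all pairs. -/
structure Policy (K T : ℕ) where
  draw : (t : ℕ) → unitInterval → (Fin t → Fin K × ℝ) → Fin K
  recommend : unitInterval → (Fin T → Fin K × ℝ) → Fin K

/-- All decision rules of the algorithm are measurable. -/
def Policy.IsMeasurable {K T : ℕ} (π : Policy K T) : Prop :=
  (∀ t, Measurable fun x : unitInterval × (Fin t → Fin K × ℝ) => π.draw t x.1 x.2) ∧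
    Measurable fun x : unitInterval × (Fin T → Fin K × ℝ) => π.recommend x.1 x.2

/-- The pairs (arm, reward) of the first `t` rounds, when `Y (s, i)` is the reward that arm `i`
yields if it is drawn in round `s`. -/
def Policy.history {K T : ℕ} (π : Policy K T) (u : unitInterval) (Y : ℕ × Fin K → ℝ) :
    (t : ℕ) → Fin t → Fin K × ℝ
  | 0 => Fin.elim0
  | t + 1 =>
    let past := π.history u Y t
    let arm := π.draw t u past
    Fin.snoc (α := fun _ => Fin K × ℝ) past (arm, Y (t, arm))

/-- The joint law of the seed, uniform on `[0, 1]`, and of the rewards: all of them are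
independent, and every reward of arm `i` has the law with mean `P i`. -/
def rewardMeasure {K : ℕ} (F : RewardFamily) (P : Fin K → ℝ) :
    Measure (unitInterval × (ℕ × Fin K → ℝ)) :=
  (volume : Measure unitInterval).prod (Measure.infinitePi fun x : ℕ × Fin K => F.law (P x.2))

/-- The probability of error: the recommended arm is not a best arm. -/
def Policy.errorProb {K T : ℕ} (F : RewardFamily) (P : Fin K → ℝ) (π : Policy K T) : ℝ≥0∞ :=
  rewardMeasure F P {x | π.recommend x.1 (π.history x.1 x.2 T) ∉ bestArms P}

/-- `liminf_{T → ∞} (1 / T) log (1 / PoE)` under the instance `P`, in `[0, ∞]`. -/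
def errorExponent {K : ℕ} (F : RewardFamily) (P : Fin K → ℝ) (π : (T : ℕ) → Policy K T) : ℝ≥0∞ :=
  liminf (fun T : ℕ => (ENNReal.log ((π T).errorProb F P)⁻¹).toENNReal / (T : ℝ≥0∞)) atTop

/-- The worst-case rate of a sequence of algorithms: the infimum of
`H P * liminf_{T → ∞} (1 / T) log (1 / PoE)` over the instances `P` with means in `Θ`. -/
def worstRate {K : ℕ} (F : RewardFamily) (Θ : Set ℝ) (H : (Fin K → ℝ) → ℝ≥0∞)
    (π : (T : ℕ) → Policy K T) : ℝ≥0∞ :=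
  ⨅ (P : Fin K → ℝ) (_ : ∀ i, P i ∈ Θ), weigh (H P) (errorExponent F P π)

/-! ### Oracle rates -/

/-- The rate `R^go` of the oracle that chooses the allocation knowing the final empirical means.
The functions `r` and `J` are only evaluated at points of `𝒬 ^ K`. -/
def Rgo {K : ℕ} (F : RewardFamily) (Θ : Set ℝ) (H : (Fin K → ℝ) → ℝ≥0∞) : ℝ≥0∞ :=
  ⨆ (r : (Fin K → ℝ) → stdSimplex ℝ (Fin K)) (J : (Fin K → ℝ) → Fin K),
    ⨅ (Q : Fin K → ℝ) (_ : ∀ i, Q i ∈ F.means)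
      (P : Fin K → ℝ) (_ : ∀ i, P i ∈ Θ) (_ : J Q ∉ bestArms P),
      weigh (H P) (∑ i, ENNReal.ofReal ((r Q : Fin K → ℝ) i) * F.kl (Q i) (P i))

/-- A rule for `B` batches (numbered from `0`): the allocation `alloc b` in batch `b` is a
function of the empirical means of the batches `0, …, b`, and the recommendation is a function of
the empirical means of all `B` batches. Only the functions `alloc b` with `b < B` matter. -/
structure BatchOracle (K B : ℕ) where
  alloc : (b : ℕ) → (Fin (b + 1) → Fin K → ℝ) → stdSimplex ℝ (Fin K)
  recommend : (Fin B → Fin K → ℝ) → Fin K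

/-- The objective of the batch problem: the infimum over empirical means `Q` and instances `P`
for which the recommendation is wrong of `(H P / B) * ∑_{b, i} r_{b,i} D(Q_{b,i} ‖ P_i)`. -/
def BatchOracle.value {K B : ℕ} (F : RewardFamily) (Θ : Set ℝ) (H : (Fin K → ℝ) → ℝ≥0∞)
    (o : BatchOracle K B) : ℝ≥0∞ :=
  ⨅ (Q : Fin B → Fin K → ℝ) (_ : ∀ b i, Q b i ∈ F.means)
    (P : Fin K → ℝ) (_ : ∀ i, P i ∈ Θ) (_ : o.recommend Q ∉ bestArms P),
    weigh (H P)
      ((∑ b : Fin B, ∑ i,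
        ENNReal.ofReal
          ((o.alloc b fun a : Fin (b + 1) => Q (Fin.castLE b.isLt a) : Fin K → ℝ) i) *
          F.kl (Q b i) (P i)) / (B : ℝ≥0∞))

/-- The rate `R^go_B` of the best `B`-batch oracle. -/
def RgoBatch {K : ℕ} (F : RewardFamily) (Θ : Set ℝ) (H : (Fin K → ℝ) → ℝ≥0∞) (B : ℕ) : ℝ≥0∞ :=
  ⨆ o : BatchOracle K B, o.value F Θ H

/-- `o` is an `ε`-optimal solution of the `B`-batch problem. -/
def BatchOracle.IsOptimalUpTo {K B : ℕ} (F : RewardFamily) (Θ : Set ℝ)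
    (H : (Fin K → ℝ) → ℝ≥0∞) (ε : ℝ) (o : BatchOracle K B) : Prop :=
  RgoBatch F Θ H B - ENNReal.ofReal ε ≤ o.value F Θ H

/-! ### Delayed optimal tracking -/

/-- `n N r` are numbers of draws of the arms in a batch of `N` rounds with allocation `r`:
`n_i ≥ r_i (N - K)` and `∑ n_i = N`. -/
def IsRounding {K : ℕ} (n : ℕ → (Fin K → ℝ) → Fin K → ℕ) : Prop :=
  ∀ (N : ℕ), ∀ r ∈ stdSimplex ℝ (Fin K),
    (∀ i, r i * ((N : ℝ) - (K : ℝ)) ≤ (n N r i : ℝ)) ∧ ∑ i, n N r i = N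

/-- The empirical mean of arm `i` in batch `c` for batches of `N` rounds, read off the history of
the first `t` rounds (it is `0` if there is no draw of arm `i` in that batch). -/
def batchMean {K t : ℕ} (N : ℕ) (past : Fin t → Fin K × ℝ) (c : ℕ) (i : Fin K) : ℝ :=
  (∑ s ∈ Finset.univ.filter fun s : Fin t => (s : ℕ) / N = c ∧ (past s).1 = i, (past s).2) /
    ((Finset.univ.filter fun s : Fin t => (s : ℕ) / N = c ∧ (past s).1 = i).card : ℝ)

/-- The stored empirical means `Q'_0, …, Q'_m`, as a function of the empirical means `q c i` of the
batches. The first `K` batches draw one arm each, and `Q'_0` consists of the means observed there.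
Then `Q'_{m+1} = Q'_m + r (q_{K+m} - Q'_m)` componentwise, where `r` is the allocation in batch
`K + m`, which is the oracle allocation at the stored means `Q'_0, …, Q'_m`. -/
def stored {K B : ℕ} (o : BatchOracle K B) (q : ℕ → Fin K → ℝ) :
    (m : ℕ) → Fin (m + 1) → Fin K → ℝ
  | 0 => fun _ i => q i i
  | m + 1 =>
    let Q' := stored o q m
    Fin.snoc (α := fun _ => Fin K → ℝ) Q' fun i =>
      Q' (Fin.last m) i + (o.alloc m Q' : Fin K → ℝ) i * (q (K + m) i - Q' (Fin.last m) i)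

/-- The numbers of draws of the arms in batch `c` of `N` rounds: batch `c < K` draws only arm `c`,
and batch `c ≥ K` follows the oracle allocation at the stored means `Q'_0, …, Q'_{c-K}`. -/
def dotCounts {K B : ℕ} (o : BatchOracle K B) (n : ℕ → (Fin K → ℝ) → Fin K → ℕ) (N : ℕ)
    (q : ℕ → Fin K → ℝ) (c : ℕ) (i : Fin K) : ℕ :=
  if c < K then (if (i : ℕ) = c then N else 0)
  else n N (o.alloc (c - K) (stored o q (c - K)) : Fin K → ℝ) i

/-- The arm at position `s = 0, 1, …` of a batch that draws first arm `0` for `n 0` times, then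
arm `1` for `n 1` times, and so on: its index is the number of the arms that are already finished.
(Past the end of the batch it is arm `0`.) -/
def armAt {K : ℕ} [NeZero K] (n : Fin K → ℕ) (s : ℕ) : Fin K :=
  Fin.ofNat K (Finset.univ.filter fun i : Fin K => ∑ j ∈ Finset.Iic i, n j ≤ s).card

/-- The delayed optimal tracking algorithm (DOT) with `B` batches, the solution `o` of the
`B`-batch problem and the rule `n` for the numbers of draws. The budget `T` is divided into
`B + K - 1` batches of `⌊T / (B + K - 1)⌋` rounds each; the remaining rounds, in which arm `0` is
drawn, are ignored. The algorithm uses no randomness of its own. -/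
def dot {K B : ℕ} [NeZero K] (o : BatchOracle K B) (n : ℕ → (Fin K → ℝ) → Fin K → ℕ) (T : ℕ) :
    Policy K T where
  draw := fun t _ past =>
    let N := T / (B + K - 1)
    if t < (B + K - 1) * N then armAt (dotCounts o n N (batchMean N past) (t / N)) (t % N) else 0
  recommend := fun _ past =>
    let N := T / (B + K - 1)
    o.recommend fun b : Fin B => stored o (batchMean N past) b (Fin.last b)

end BestArm

end

/-!
The argument compares three quantities: the rate of DOT, the rates `R_B` of the batch oracles, and
the rate of an arbitrary algorithm.

**DOT.** The stored mean `Q'` moves only by the fraction `r` of the way to the new empirical mean.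
As the divergence is convex in its first argument (`kl_mix_le`), each update satisfies
`D(Q'_{b+1} ‖ P) ≤ (1 - r_b) D(Q'_b ‖ P) + r_b D(Q_b ‖ P)`, and these inequalities telescope: the
information `∑ r_b D(Q'_b ‖ P)` that the oracle would collect at the stored means is at most the
information that the batches really deliver (`sum_alloc_mul_kl_lastStored_le`). Hence an error under
`P` is possible only if `∑ n_{b,i} D(Q_{b,i} ‖ P_i)` is at least of the order required by the value
of the oracle (`value_mul_le_sum_dotCounts`). The probability of this event is bounded by Chernoff's
method: for a sample of given size, polynomially many test functions of mean at most `1` detect a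
large divergence of the empirical mean (`exists_testFunctions`), and the numbers of draws in the
batches take polynomially many values and determine the arms of all rounds. So a union bound over
polynomially many deterministic designs, with Markov's inequality for each, suffices
(`errorProb_dot_le`). The exponent is the value of the oracle, up to the factor `B / (B + K - 1)`
(`mul_value_le_worstRate_dot`).

**Batch rates.** An oracle for `B` batches can simulate one for `n` batches by treating each of its
batches as about `n / B` batches with the same empirical means. This gives `R_n ≤ (1 + B / n) R_B`
(`RgoBatch_le_mul`), hence `R_B` converges to its infimum, which is at most `R_1 ≤ Rgo < ∞`.

**Converse.** Every algorithm is imitated by an oracle for `B` batches. Let the algorithm run for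
`B n` rounds on rewards with means `Q_b` in the `b`-th batch of `n` rounds. The proportions of the
draws, rounded to multiples of `1 / m`, take finitely many values, and so does the recommendation;
along an ultrafilter of `n → ∞` one can therefore choose, batch by batch, values that keep a
positive probability (`isLikely_likelyCells`, `exists_likely_recommendation`). If the recommendation
chosen for `Q` is wrong under `P`, a change of measure from `Q` to `P` bounds the error probability
under `P` from below by about `exp (-n ∑ r_{b,i} D(Q_{b,i} ‖ P_i))`. The concentration of the
log-likelihood ratio along the adaptively chosen arms is obtained from its moments of small order,
whose growth rate is the divergence (`exists_likelihoodRatio`, `interactionMeasure_le_add`). The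
imitating allocation gives every arm a positive weight, so that instances with an infinite
divergence impose no constraint. Letting `m → ∞`, the rate of the algorithm is at most `R_B`
(`worstRate_le_RgoBatch`), for every `B`, and thus at most the limit.
-/

noncomputable section

namespace BestArm

/-! ### The two reward families -/

/-- The values that a reward can take: `0` and `1` in the Bernoulli model. -/
def RewardFamily.values : RewardFamily → Set ℝ
  | .bernoulli => {0, 1}
  | .gaussian _ _ => Set.univ

lemma lintegral_law_bernoulli {p : ℝ} (hp : p ∈ Set.Icc (0 : ℝ) 1) (f : ℝ → ℝ≥0∞) :
    ∫⁻ y, f y ∂(RewardFamily.bernoulli.law p) =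
      ENNReal.ofReal p * f 1 + ENNReal.ofReal (1 - p) * f 0 := by
  have h : Set.projIcc (0 : ℝ) 1 zero_le_one p = ⟨p, hp⟩ := Set.projIcc_of_mem _ hp
  simp only [RewardFamily.law, h, bernoulliMeasure_def]
  rw [lintegral_add_measure]
  simp only [lintegral_smul_measure, lintegral_dirac, ENNReal.smul_def, smul_eq_mul]
  congr 2
  · rw [ENNReal.ofReal_eq_coe_nnreal hp.1]; rfl
  · rw [ENNReal.ofReal_eq_coe_nnreal (sub_nonneg.2 hp.2)]; rfl

/-- The likelihood ratio of the Bernoulli distributions with means `q` and `p`. -/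
def bernoulliRatio (q p y : ℝ) : ℝ≥0∞ :=
  if y = 1 then ENNReal.ofReal q / ENNReal.ofReal p
  else ENNReal.ofReal (1 - q) / ENNReal.ofReal (1 - p)

lemma measurable_bernoulliRatio (q p : ℝ) : Measurable (bernoulliRatio q p) :=
  Measurable.ite (measurableSet_eq) measurable_const measurable_const

lemma ofReal_mul_div_cancel {q p : ℝ} (h : p ≤ 0 → q ≤ 0) :
    ENNReal.ofReal p * (ENNReal.ofReal q / ENNReal.ofReal p) = ENNReal.ofReal q := by
  by_cases hp : p ≤ 0
  · simp [ENNReal.ofReal_of_nonpos hp, ENNReal.ofReal_of_nonpos (h hp)]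
  · exact ENNReal.mul_div_cancel (by simpa using hp) ENNReal.ofReal_ne_top

lemma law_bernoulli_eq_withDensity {q p : ℝ} (hq : q ∈ Set.Icc (0 : ℝ) 1)
    (hp : p ∈ Set.Icc (0 : ℝ) 1) (h0 : p = 0 → q = 0) (h1 : p = 1 → q = 1) :
    RewardFamily.bernoulli.law q =
      (RewardFamily.bernoulli.law p).withDensity (bernoulliRatio q p) := by
  refine Measure.ext_of_lintegral _ fun f hf => ?_
  rw [lintegral_withDensity_eq_lintegral_mul _ (measurable_bernoulliRatio q p) hf,
    lintegral_law_bernoulli hq, lintegral_law_bernoulli hp]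
  simp only [Pi.mul_apply, bernoulliRatio, if_true, zero_ne_one, if_false, ← mul_assoc]
  rw [ofReal_mul_div_cancel fun h => (h0 (le_antisymm h hp.1)).le,
    ofReal_mul_div_cancel fun h => by
      rw [h1 (le_antisymm hp.2 (by linarith))]; simp]

lemma bernoulliRatio_toReal {q p : ℝ} (hq : q ∈ Set.Icc (0 : ℝ) 1)
    (hp : p ∈ Set.Icc (0 : ℝ) 1) (y : ℝ) :
    (bernoulliRatio q p y).toReal = if y = 1 then q / p else (1 - q) / (1 - p) := by
  unfold bernoulliRatio
  split_ifs <;> rw [ENNReal.toReal_div, ENNReal.toReal_ofReal, ENNReal.toReal_ofReal] <;>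
    linarith [hq.1, hq.2, hp.1, hp.2]

lemma kl_bernoulli {q p : ℝ} (hq : q ∈ Set.Icc (0 : ℝ) 1)
    (hp : p ∈ Set.Icc (0 : ℝ) 1) (h0 : p = 0 → q = 0) (h1 : p = 1 → q = 1) :
    RewardFamily.bernoulli.kl q p ≠ ⊤ ∧ (RewardFamily.bernoulli.kl q p).toReal =
      q * Real.log (q / p) + (1 - q) * Real.log ((1 - q) / (1 - p)) := by
  have hd := law_bernoulli_eq_withDensity hq hp h0 h1
  have hac : RewardFamily.bernoulli.law q ≪ RewardFamily.bernoulli.law p := by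
    rw [hd]; exact withDensity_absolutelyContinuous _ _
  have hint : ∀ f : ℝ → ℝ, Integrable f (RewardFamily.bernoulli.law q) := fun f =>
    integrable_bernoulliMeasure _ _ _ f
  refine ⟨InformationTheory.klDiv_ne_top hac (hint _), ?_⟩
  unfold RewardFamily.kl
  rw [InformationTheory.toReal_klDiv_of_measure_eq hac (by simp)]
  have hae : (RewardFamily.bernoulli.law q).rnDeriv (RewardFamily.bernoulli.law p)
      =ᵐ[RewardFamily.bernoulli.law q] bernoulliRatio q p := by
    refine hac.ae_le ?_
    have := Measure.rnDeriv_withDensity (RewardFamily.bernoulli.law p)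
      (measurable_bernoulliRatio q p)
    rwa [← hd] at this
  have : llr (RewardFamily.bernoulli.law q) (RewardFamily.bernoulli.law p)
      =ᵐ[RewardFamily.bernoulli.law q] fun y => Real.log (bernoulliRatio q p y).toReal := by
    filter_upwards [hae] with y hy
    simp only [llr, hy]
  rw [integral_congr_ae this]
  have hproj : Set.projIcc (0 : ℝ) 1 zero_le_one q = ⟨q, hq⟩ := Set.projIcc_of_mem _ hq
  simp only [RewardFamily.law, hproj]
  rw [integral_bernoulliMeasure]
  simp only [bernoulliRatio_toReal hq hp, if_true, zero_ne_one, if_false, smul_eq_mul]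

lemma kl_bernoulli_eq_top {q p : ℝ} (hq : q ∈ Set.Icc (0 : ℝ) 1)
    (hp : p ∈ Set.Icc (0 : ℝ) 1) (h : ¬((p = 0 → q = 0) ∧ (p = 1 → q = 1))) :
    RewardFamily.bernoulli.kl q p = ⊤ := by
  refine InformationTheory.klDiv_of_not_ac fun hac => h ⟨fun h0 => ?_, fun h1 => ?_⟩
  · have hz : RewardFamily.bernoulli.law p {1} = 0 := by
      rw [← lintegral_indicator_one (measurableSet_singleton _), lintegral_law_bernoulli hp]
      simp [h0]
    have := hac hz
    rw [← lintegral_indicator_one (measurableSet_singleton _), lintegral_law_bernoulli hq] at this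
    simp at this
    exact le_antisymm this hq.1
  · have hz : RewardFamily.bernoulli.law p {0} = 0 := by
      rw [← lintegral_indicator_one (measurableSet_singleton _), lintegral_law_bernoulli hp]
      simp [h1]
    have := hac hz
    rw [← lintegral_indicator_one (measurableSet_singleton _), lintegral_law_bernoulli hq] at this
    simp at this
    exact le_antisymm hq.2 this

lemma kl_bernoulli_ne_top_iff {q p : ℝ} (hq : q ∈ Set.Icc (0 : ℝ) 1)
    (hp : p ∈ Set.Icc (0 : ℝ) 1) :
    RewardFamily.bernoulli.kl q p ≠ ⊤ ↔ (p = 0 → q = 0) ∧ (p = 1 → q = 1) := by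
  constructor
  · intro h; by_contra h'; exact h (kl_bernoulli_eq_top hq hp h')
  · intro h; exact (kl_bernoulli hq hp h.1 h.2).1

section Gaussian

variable {v : ℝ≥0}

/-- The likelihood ratio of the normal distributions with means `q` and `p` and variance `v`. -/
def gaussianRatio (v : ℝ≥0) (q p y : ℝ) : ℝ≥0∞ :=
  ENNReal.ofReal (Real.exp ((q - p) * (2 * y - q - p) / (2 * v)))

lemma measurable_gaussianRatio (q p : ℝ) : Measurable (gaussianRatio v q p) := by
  unfold gaussianRatio; fun_prop


lemma law_gaussian_eq_withDensity (hv : 0 < v) (q p : ℝ) :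
    gaussianReal q v = (gaussianReal p v).withDensity (gaussianRatio v q p) := by
  rw [gaussianReal_of_var_ne_zero _ hv.ne', gaussianReal_of_var_ne_zero _ hv.ne',
    ← withDensity_mul _ (measurable_gaussianPDF _ _) (measurable_gaussianRatio q p)]
  congr 1
  ext y
  simp only [Pi.mul_apply, gaussianPDF, gaussianRatio]
  rw [← ENNReal.ofReal_mul (gaussianPDFReal_nonneg _ _ _)]
  congr 1
  simp only [gaussianPDFReal]
  rw [mul_assoc _ (Real.exp _) (Real.exp _), ← Real.exp_add]
  congr 2
  have : (v : ℝ) ≠ 0 := by exact_mod_cast hv.ne'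
  field_simp
  ring

lemma lintegral_exp_gaussian (q a b : ℝ) :
    ∫⁻ y, ENNReal.ofReal (Real.exp (a * y + b)) ∂(gaussianReal q v) =
      ENNReal.ofReal (Real.exp (q * a + v * a ^ 2 / 2 + b)) := by
  have hi : Integrable (fun y => Real.exp (a * y + b)) (gaussianReal q v) := by
    simp only [Real.exp_add]
    exact (integrable_exp_mul_gaussianReal a).mul_const _
  rw [← ofReal_integral_eq_lintegral_ofReal hi (ae_of_all _ fun y => (Real.exp_pos _).le)]
  congr 1
  simp only [Real.exp_add, integral_mul_const]
  have := congrFun (mgf_fun_id_gaussianReal (μ := q) (v := v)) a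
  simp only [mgf] at this
  rw [this, Real.exp_add]


lemma kl_gaussian (hv : 0 < v) (q p : ℝ) :
    (RewardFamily.gaussian v hv).kl q p = ENNReal.ofReal ((q - p) ^ 2 / (2 * v)) := by
  have hd := law_gaussian_eq_withDensity hv q p
  have hac : gaussianReal q v ≪ gaussianReal p v := by
    rw [hd]; exact withDensity_absolutelyContinuous _ _
  have hae : (gaussianReal q v).rnDeriv (gaussianReal p v)
      =ᵐ[gaussianReal q v] gaussianRatio v q p := by
    refine hac.ae_le ?_
    have := Measure.rnDeriv_withDensity (gaussianReal p v) (measurable_gaussianRatio (v := v) q p)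
    rwa [← hd] at this
  have hllr : llr (gaussianReal q v) (gaussianReal p v)
      =ᵐ[gaussianReal q v] fun y => (q - p) * (2 * y - q - p) / (2 * v) := by
    filter_upwards [hae] with y hy
    simp only [llr, hy, gaussianRatio]
    rw [ENNReal.toReal_ofReal (Real.exp_pos _).le, Real.log_exp]
  have hid : Integrable (fun y : ℝ => y) (gaussianReal q v) :=
    (memLp_id_gaussianReal 1).integrable le_rfl
  have hi : Integrable (fun y => (q - p) * (2 * y - q - p) / (2 * v)) (gaussianReal q v) := by
    refine Integrable.div_const (Integrable.const_mul ?_ _) _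
    exact ((hid.const_mul 2).sub (integrable_const q)).sub (integrable_const p)
  have hne := InformationTheory.klDiv_ne_top hac (hi.congr hllr.symm)
  change InformationTheory.klDiv (gaussianReal q v) (gaussianReal p v) = _
  rw [← ENNReal.ofReal_toReal hne, InformationTheory.toReal_klDiv_of_measure_eq hac (by simp),
    integral_congr_ae hllr, integral_div, integral_const_mul, integral_sub, integral_sub,
    integral_const_mul, integral_id_gaussianReal]
  · simp; ring_nf
  · exact hid.const_mul 2
  · exact integrable_const q
  · exact (hid.const_mul 2).sub (integrable_const q)
  · exact integrable_const p

end Gaussian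

/-! ### Convexity and regularity of the divergence -/

lemma convexOn_kl_bernoulli (p : ℝ) :
    ConvexOn ℝ (Set.Icc (0 : ℝ) 1) fun q =>
      (q * Real.log q + (1 - q) * Real.log (1 - q)) -
        (q * Real.log p + (1 - q) * Real.log (1 - p)) := by
  have h1 : ConvexOn ℝ (Set.Icc (0 : ℝ) 1) fun q => q * Real.log q :=
    Real.convexOn_mul_log.subset (fun x hx => hx.1) (convex_Icc 0 1)
  have h2 : ConvexOn ℝ (Set.Icc (0 : ℝ) 1) fun q => (1 - q) * Real.log (1 - q) := by
    refine ⟨convex_Icc 0 1, fun x hx y hy a b ha hb hab => ?_⟩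
    have := h1.2 (x := 1 - x) ⟨by linarith [hx.2], by linarith [hx.1]⟩ (y := 1 - y)
      ⟨by linarith [hy.2], by linarith [hy.1]⟩ ha hb hab
    simp only [smul_eq_mul] at this ⊢
    have e : a * (1 - x) + b * (1 - y) = 1 - (a * x + b * y) := by linear_combination hab
    rwa [e] at this
  have h3 : ConcaveOn ℝ (Set.Icc (0 : ℝ) 1) fun q => q * Real.log p + (1 - q) * Real.log (1 - p) := by
    refine ⟨convex_Icc 0 1, fun x hx y hy a b ha hb hab => le_of_eq ?_⟩
    simp only [smul_eq_mul]
    linear_combination (Real.log (1 - p)) * hab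
  exact (h1.add h2).sub h3

lemma mul_log_div_eq {q p : ℝ} (h : p = 0 → q = 0) :
    q * Real.log (q / p) = q * Real.log q - q * Real.log p := by
  by_cases hq : q = 0
  · simp [hq]
  · rw [Real.log_div hq fun hp => hq (h hp)]; ring

lemma means_convex (F : RewardFamily) : Convex ℝ F.means := by
  cases F
  · exact convex_Icc 0 1
  · exact convex_univ

lemma mix_mem_means (F : RewardFamily) {q q' r : ℝ} (hq : q ∈ F.means) (hq' : q' ∈ F.means)
    (hr0 : 0 ≤ r) (hr1 : r ≤ 1) : q + r * (q' - q) ∈ F.means := by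
  have := means_convex F hq hq' (sub_nonneg.2 hr1) hr0 (by ring)
  simp only [smul_eq_mul] at this
  convert this using 1; ring

/-- The divergence is convex in its first argument. -/
lemma kl_mix_le (F : RewardFamily) {q q' p r : ℝ} (hq : q ∈ F.means) (hq' : q' ∈ F.means)
    (hp : p ∈ F.means) (hr0 : 0 ≤ r) (hr1 : r ≤ 1) :
    F.kl (q + r * (q' - q)) p ≤
      ENNReal.ofReal (1 - r) * F.kl q p + ENNReal.ofReal r * F.kl q' p := by
  rcases hr0.eq_or_lt with rfl | hr0'
  · simp
  rcases hr1.eq_or_lt with rfl | hr1'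
  · simp
  have hm := mix_mem_means F hq hq' hr0 hr1
  by_cases h1 : F.kl q p = ⊤
  · rw [h1, ENNReal.mul_top (by simpa using hr1')]; simp
  by_cases h2 : F.kl q' p = ⊤
  · rw [h2, ENNReal.mul_top (by simpa using hr0')]; simp
  rw [← ENNReal.ofReal_toReal h1, ← ENNReal.ofReal_toReal h2,
    ← ENNReal.ofReal_mul (sub_nonneg.2 hr1), ← ENNReal.ofReal_mul hr0,
    ← ENNReal.ofReal_add (by have := sub_nonneg.2 hr1; positivity) (by positivity)]
  cases F with
  | bernoulli =>
    have g1 := (kl_bernoulli_ne_top_iff hq hp).1 h1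
    have g2 := (kl_bernoulli_ne_top_iff hq' hp).1 h2
    have key : ∀ {x : ℝ}, x ∈ Set.Icc (0 : ℝ) 1 → (p = 0 → x = 0) → (p = 1 → x = 1) →
        x * Real.log (x / p) + (1 - x) * Real.log ((1 - x) / (1 - p)) =
        (x * Real.log x + (1 - x) * Real.log (1 - x)) -
        (x * Real.log p + (1 - x) * Real.log (1 - p)) := by
      intro x _ hx0 hx1
      rw [mul_log_div_eq hx0, mul_log_div_eq fun h => by rw [hx1 (by linarith)]; ring]
      ring
    have g3 : (p = 0 → q + r * (q' - q) = 0) ∧ (p = 1 → q + r * (q' - q) = 1) :=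
      ⟨fun h => by rw [g1.1 h, g2.1 h]; ring, fun h => by rw [g1.2 h, g2.2 h]; ring⟩
    have e := kl_bernoulli hm hp g3.1 g3.2
    rw [← ENNReal.ofReal_toReal e.1]
    refine ENNReal.ofReal_le_ofReal ?_
    rw [e.2, (kl_bernoulli hq hp g1.1 g1.2).2, (kl_bernoulli hq' hp g2.1 g2.2).2,
      key hm g3.1 g3.2, key hq g1.1 g1.2, key hq' g2.1 g2.2]
    have := (convexOn_kl_bernoulli p).2 hq hq' (sub_nonneg.2 hr1) hr0 (by ring)
    simp only [smul_eq_mul] at this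
    have e' : (1 - r) * q + r * q' = q + r * (q' - q) := by ring
    rwa [e'] at this
  | gaussian v hv =>
    have hv' : (0 : ℝ) < v := by exact_mod_cast hv
    simp only [kl_gaussian hv]
    rw [ENNReal.toReal_ofReal (by positivity), ENNReal.toReal_ofReal (by positivity)]
    refine ENNReal.ofReal_le_ofReal ?_
    rw [mul_div_assoc', mul_div_assoc', ← add_div]
    gcongr
    nlinarith [mul_nonneg (mul_nonneg hr0 (sub_nonneg.2 hr1)) (sq_nonneg (q - q'))]

lemma eventually_le_exp_of_hasDerivAt {f : ℝ → ℝ} {D τ : ℝ} (hf : HasDerivAt f D 0)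
    (h0 : f 0 = 1) (hτ : 0 < τ) : ∀ᶠ x in 𝓝[>] (0 : ℝ), f x ≤ Real.exp (x * (D + τ)) := by
  have := (hasDerivAt_iff_tendsto_slope.1 hf).eventually (gt_mem_nhds (show D < D + τ by linarith))
  have h2 := this.filter_mono
    (nhdsWithin_mono (0 : ℝ) (s := Set.Ioi 0) fun x hx => (ne_of_gt hx : x ≠ 0))
  filter_upwards [h2, self_mem_nhdsWithin] with x hx hpos
  have hpos : 0 < x := hpos
  rw [slope_def_field, h0, sub_zero, div_lt_iff₀ hpos] at hx
  have := Real.add_one_le_exp (x * (D + τ))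
  nlinarith

/-- Two members of a family with finite divergence `D` have a likelihood ratio `ℓ`, and its moments
of small order `x` under the first member are at most `exp (x (D + τ))`: the divergence is the
derivative at `0` of the moment of order `x`. -/
lemma exists_likelihoodRatio (F : RewardFamily) {q p : ℝ} (hq : q ∈ F.means) (hp : p ∈ F.means)
    (h : F.kl q p ≠ ⊤) : ∃ ℓ : ℝ → ℝ≥0∞, Measurable ℓ ∧ F.law q = (F.law p).withDensity ℓ ∧
      ∀ τ : ℝ, 0 < τ → ∀ᶠ x in 𝓝[>] (0 : ℝ),
        ∫⁻ y, ℓ y ^ x ∂(F.law q) ≤ ENNReal.ofReal (Real.exp (x * ((F.kl q p).toReal + τ))) := by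
  cases F with
  | bernoulli =>
    obtain ⟨h0, h1⟩ := (kl_bernoulli_ne_top_iff hq hp).1 h
    refine ⟨bernoulliRatio q p, measurable_bernoulliRatio q p,
      law_bernoulli_eq_withDensity hq hp h0 h1, fun τ hτ => ?_⟩
    rw [(kl_bernoulli hq hp h0 h1).2]
    have hd : HasDerivAt (fun x : ℝ => q * Real.exp (x * Real.log (q / p)) +
        (1 - q) * Real.exp (x * Real.log ((1 - q) / (1 - p))))
        (q * Real.log (q / p) + (1 - q) * Real.log ((1 - q) / (1 - p))) 0 := by
      have g : ∀ c l : ℝ, HasDerivAt (fun x : ℝ => c * Real.exp (x * l)) (c * l) 0 := fun c l => by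
        have := (((hasDerivAt_id (0 : ℝ)).mul_const l).exp).const_mul c
        simpa using this
      exact (g _ _).add (g _ _)
    filter_upwards [eventually_le_exp_of_hasDerivAt hd (by simp) hτ, self_mem_nhdsWithin]
      with x hx hpos
    have hpos : 0 < x := hpos
    refine le_trans (le_of_eq ?_) (ENNReal.ofReal_le_ofReal hx)
    have g : ∀ a b : ℝ, 0 ≤ a → 0 ≤ b → (b = 0 → a = 0) →
        ENNReal.ofReal a * (ENNReal.ofReal a / ENNReal.ofReal b) ^ x =
          ENNReal.ofReal (a * Real.exp (x * Real.log (a / b))) := by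
      intro a b ha hb hab
      rcases ha.eq_or_lt with rfl | ha'
      · simp
      have hb' : 0 < b := lt_of_le_of_ne hb fun hb => ha'.ne' (hab hb.symm)
      rw [← ENNReal.ofReal_div_of_pos hb', ENNReal.ofReal_rpow_of_pos (by positivity),
        ← ENNReal.ofReal_mul ha, Real.rpow_def_of_pos (by positivity), mul_comm x]
    rw [lintegral_law_bernoulli hq,
      ENNReal.ofReal_add (mul_nonneg hq.1 (Real.exp_pos _).le)
        (mul_nonneg (sub_nonneg.2 hq.2) (Real.exp_pos _).le),
      ← g q p hq.1 hp.1 h0, ← g (1 - q) (1 - p) (sub_nonneg.2 hq.2) (sub_nonneg.2 hp.2)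
        fun h => by rw [h1 (by linarith)]; ring]
    simp [bernoulliRatio]
  | gaussian v hv =>
    have hv' : (0 : ℝ) < v := by exact_mod_cast hv
    refine ⟨gaussianRatio v q p, measurable_gaussianRatio q p, law_gaussian_eq_withDensity hv q p,
      fun τ hτ => ?_⟩
    rw [kl_gaussian hv, ENNReal.toReal_ofReal (by positivity)]
    have hlim : Tendsto (fun x : ℝ => x * ((q - p) ^ 2 / (2 * v))) (𝓝[>] 0) (𝓝 0) := by
      have : Tendsto (fun x : ℝ => x * ((q - p) ^ 2 / (2 * v))) (𝓝 0)
          (𝓝 (0 * ((q - p) ^ 2 / (2 * v)))) := tendsto_id.mul_const _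
      rw [zero_mul] at this
      exact this.mono_left nhdsWithin_le_nhds
    filter_upwards [hlim.eventually (gt_mem_nhds hτ), self_mem_nhdsWithin] with x hx hpos
    have hpos : 0 < x := hpos
    have e : ∀ y, gaussianRatio v q p y ^ x = ENNReal.ofReal (Real.exp
        ((x * (q - p) / v) * y + -(x * (q - p) * (q + p) / (2 * v)))) := fun y => by
      unfold gaussianRatio
      rw [ENNReal.ofReal_rpow_of_pos (Real.exp_pos _), ← Real.exp_mul]
      congr 2
      field_simp
      ring
    simp only [e]
    rw [show (RewardFamily.gaussian v hv).law q = gaussianReal q v from rfl, lintegral_exp_gaussian]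
    refine ENNReal.ofReal_le_ofReal (Real.exp_le_exp.2 ?_)
    have e2 : q * (x * (q - p) / v) + v * (x * (q - p) / v) ^ 2 / 2 +
        -(x * (q - p) * (q + p) / (2 * v)) =
        x * ((q - p) ^ 2 / (2 * v) + x * ((q - p) ^ 2 / (2 * v))) := by
      field_simp
      ring
    rw [e2]
    gcongr


/-! ### Test functions for large deviations -/

lemma bernoulliRatio_lintegral_le {q p : ℝ} (hq : q ∈ Set.Icc (0 : ℝ) 1)
    (hp : p ∈ Set.Icc (0 : ℝ) 1) :
    ∫⁻ y, bernoulliRatio q p y ∂(RewardFamily.bernoulli.law p) ≤ 1 := by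
  rw [lintegral_law_bernoulli hp]
  simp only [bernoulliRatio, if_true, zero_ne_one, if_false]
  calc _ ≤ ENNReal.ofReal q + ENNReal.ofReal (1 - q) :=
        add_le_add ENNReal.mul_div_le ENNReal.mul_div_le
    _ = 1 := by
        rw [← ENNReal.ofReal_add hq.1 (sub_nonneg.2 hq.2)]; simp

/-- For rewards in `{0, 1}` with mean `q`, the likelihood ratio of the whole sample is at least
`exp (n D(q ‖ p))`, here truncated at an arbitrary level `L`. -/
lemma exp_kl_le_prod_bernoulliRatio {ι : Type*} {p : ℝ} (hp : p ∈ Set.Icc (0 : ℝ) 1)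
    (S : Finset ι) (y : ι → ℝ) (hy : ∀ t ∈ S, y t = 0 ∨ y t = 1) {L : ℝ}
    (hS : S.Nonempty) :
    ENNReal.ofReal (Real.exp (min (ENNReal.ofReal L)
      (S.card * RewardFamily.bernoulli.kl ((∑ t ∈ S, y t) / S.card) p)).toReal) ≤
      ∏ t ∈ S, bernoulliRatio ((∑ t ∈ S, y t) / S.card) p (y t) := by
  classical
  have hn : (0 : ℝ) < S.card := by exact_mod_cast hS.card_pos
  obtain ⟨n1, hn1⟩ : ∃ n1, n1 = (S.filter fun t => y t = 1).card := ⟨_, rfl⟩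
  obtain ⟨n0, hn0⟩ : ∃ n0, n0 = (S.filter fun t => ¬ y t = 1).card := ⟨_, rfl⟩
  have hadd : n1 + n0 = S.card := by
    rw [hn1, hn0]; exact Finset.card_filter_add_card_filter_not _
  have hsum : ∑ t ∈ S, y t = n1 := by
    have e : ∑ t ∈ S, y t = ∑ t ∈ S, if y t = 1 then (1 : ℝ) else 0 := by
      refine Finset.sum_congr rfl fun t ht => ?_
      rcases hy t ht with h | h <;> simp [h]
    rw [e, Finset.sum_boole, hn1]
  obtain ⟨q, hq⟩ : ∃ q : ℝ, q = (∑ t ∈ S, y t) / S.card := ⟨_, rfl⟩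
  rw [← hq]
  have haddR : (n1 : ℝ) + n0 = S.card := by exact_mod_cast hadd
  have hq1 : S.card * q = n1 := by rw [hq, hsum]; field_simp
  have hq0 : S.card * (1 - q) = n0 := by linear_combination (-1 : ℝ) * hq1 - haddR
  have hqm : q ∈ Set.Icc (0 : ℝ) 1 := by
    constructor
    · by_contra h; push Not at h
      have := mul_neg_of_pos_of_neg hn h
      have : (0 : ℝ) ≤ n1 := by positivity
      linarith
    · by_contra h; push Not at h
      have := mul_neg_of_pos_of_neg hn (sub_neg.2 h)
      have : (0 : ℝ) ≤ n0 := by positivity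
      linarith
  have hprod : ∏ t ∈ S, bernoulliRatio q p (y t) =
      (ENNReal.ofReal q / ENNReal.ofReal p) ^ n1 *
        (ENNReal.ofReal (1 - q) / ENNReal.ofReal (1 - p)) ^ n0 := by
    simp only [bernoulliRatio]
    rw [Finset.prod_ite, Finset.prod_const, Finset.prod_const, hn1, hn0]
  rw [hprod]
  have n1z : q = 0 → n1 = 0 := fun h => by
    rw [h, mul_zero] at hq1; exact_mod_cast hq1.symm
  have n0z : q = 1 → n0 = 0 := fun h => by
    rw [h, sub_self, mul_zero] at hq0; exact_mod_cast hq0.symm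
  have n1z' : q ≠ 0 → n1 ≠ 0 := fun h h' => by
    rw [h', Nat.cast_zero, mul_eq_zero] at hq1; exact h (hq1.resolve_left hn.ne')
  have n0z' : q ≠ 1 → n0 ≠ 0 := fun h h' => by
    rw [h', Nat.cast_zero, mul_eq_zero] at hq0
    exact h (by linarith [hq0.resolve_left hn.ne'])
  -- each of the two factors is the exponential of its term of `n D(q ‖ p)`
  have g : ∀ (a b : ℝ) (k : ℕ), 0 ≤ a → 0 ≤ b → (b = 0 → a = 0) → (a = 0 → k = 0) →
      S.card * a = k → (ENNReal.ofReal a / ENNReal.ofReal b) ^ k =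
        ENNReal.ofReal (Real.exp (S.card * (a * Real.log (a / b)))) := by
    intro a b k ha hb hab hak hk
    rcases ha.eq_or_lt with rfl | ha'
    · simp [hak rfl]
    have hb' : 0 < b := lt_of_le_of_ne hb fun hb => ha'.ne' (hab hb.symm)
    rw [← ENNReal.ofReal_div_of_pos hb', ← ENNReal.ofReal_pow (by positivity), ← mul_assoc, hk,
      Real.exp_nat_mul, Real.exp_log (by positivity)]
  by_cases hac : (p = 0 → q = 0) ∧ (p = 1 → q = 1)
  · obtain ⟨hne, hkl⟩ := kl_bernoulli hqm hp hac.1 hac.2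
    rw [g q p n1 hqm.1 hp.1 hac.1 n1z hq1,
      g (1 - q) (1 - p) n0 (sub_nonneg.2 hqm.2) (sub_nonneg.2 hp.2)
        (fun h => by rw [hac.2 (by linarith)]; ring) (fun h => n0z (by linarith)) hq0,
      ← ENNReal.ofReal_mul (Real.exp_pos _).le, ← Real.exp_add, ← mul_add, ← hkl]
    refine ENNReal.ofReal_le_ofReal (Real.exp_le_exp.2 ?_)
    refine (ENNReal.toReal_mono (ENNReal.mul_ne_top (by simp) hne) (min_le_right _ _)).trans ?_
    rw [ENNReal.toReal_mul]; simp
  · have htop : (ENNReal.ofReal q / ENNReal.ofReal p) ^ n1 *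
        (ENNReal.ofReal (1 - q) / ENNReal.ofReal (1 - p)) ^ n0 = ⊤ := by
      by_cases hp0 : p = 0
      · have hq0' : q ≠ 0 := fun h => hac ⟨fun _ => h, fun h' => by rw [hp0] at h'; simp at h'⟩
        have h1 : ENNReal.ofReal q / ENNReal.ofReal p = ⊤ := by
          rw [hp0, ENNReal.ofReal_zero, ENNReal.div_zero]
          simpa using lt_of_le_of_ne hqm.1 (Ne.symm hq0')
        rw [h1, ENNReal.top_pow (n1z' hq0'), ENNReal.top_mul]
        by_cases hq1' : q = 1
        · simp [n0z hq1']
        · refine pow_ne_zero _ ?_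
          rw [hp0]; simpa using lt_of_le_of_ne hqm.2 hq1'
      · have hp1 : p = 1 := by
          by_contra h; exact hac ⟨fun h' => absurd h' hp0, fun h' => absurd h' h⟩
        have hq1' : q ≠ 1 := fun h => hac ⟨fun h' => absurd h' hp0, fun _ => h⟩
        have h1 : ENNReal.ofReal (1 - q) / ENNReal.ofReal (1 - p) = ⊤ := by
          rw [hp1, sub_self, ENNReal.ofReal_zero, ENNReal.div_zero]
          simpa using lt_of_le_of_ne hqm.2 hq1'
        rw [h1, ENNReal.top_pow (n0z' hq1'), ENNReal.mul_top]
        by_cases hq0' : q = 0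
        · simp [n1z hq0']
        · refine pow_ne_zero _ ?_
          rw [hp1]; simpa using lt_of_le_of_ne hqm.1 (Ne.symm hq0')
    rw [htop]; exact le_top

/-- The Chernoff test function `exp (θ (y - p) - θ² v / 2)` with `θ = ± √(2 k / (v n))`. -/
def gaussianTest (v : ℝ≥0) (n : ℕ) (p : ℝ) (k : ℕ) (s : ℝ) (y : ℝ) : ℝ≥0∞ :=
  ENNReal.ofReal (Real.exp (s * √(2 * k / (v * n)) * (y - p) - (2 * k / (v * n)) * v / 2))

lemma gaussianTest_lintegral (v : ℝ≥0) (n : ℕ) (p : ℝ) (k : ℕ) {s : ℝ} (hs : s ^ 2 = 1) :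
    ∫⁻ y, gaussianTest v n p k s y ∂(gaussianReal p v) = 1 := by
  have hθ : √(2 * k / (v * n) : ℝ) ^ 2 = 2 * k / (v * n) := Real.sq_sqrt (by positivity)
  obtain ⟨θ, h⟩ : ∃ θ, θ = √(2 * k / (v * n) : ℝ) := ⟨_, rfl⟩
  rw [← h] at hθ
  have e : ∀ y, gaussianTest v n p k s y =
      ENNReal.ofReal (Real.exp (s * θ * y + (-(s * θ * p) - θ ^ 2 * v / 2))) := fun y => by
    unfold gaussianTest
    rw [← h, ← hθ]; congr 2; ring
  simp only [e]
  rw [lintegral_exp_gaussian, ← ENNReal.ofReal_one]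
  congr 1
  rw [Real.exp_eq_one_iff]
  linear_combination (v * θ ^ 2 / 2) * hs

lemma exp_le_prod_gaussianTest {ι : Type*} {v : ℝ≥0} (hv : 0 < v) (p : ℝ) (S : Finset ι)
    (y : ι → ℝ) (k : ℕ) (hS : S.Nonempty)
    (hk : (k : ℝ) ≤ S.card * (((∑ t ∈ S, y t) / S.card - p) ^ 2 / (2 * v))) :
    ∃ s : ℝ, (s = 1 ∨ s = -1) ∧
      ENNReal.ofReal (Real.exp k) ≤ ∏ t ∈ S, gaussianTest v S.card p k s (y t) := by
  have hv' : (0 : ℝ) < v := by exact_mod_cast hv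
  have hn : (0 : ℝ) < S.card := by exact_mod_cast hS.card_pos
  obtain ⟨d, hd⟩ : ∃ d, d = (∑ t ∈ S, y t) / S.card - p := ⟨_, rfl⟩
  rw [← hd] at hk
  have hsum : ∑ t ∈ S, (y t - p) = S.card * d := by
    rw [Finset.sum_sub_distrib, Finset.sum_const, hd, nsmul_eq_mul]; field_simp
  have hprod : ∀ s : ℝ, ∏ t ∈ S, gaussianTest v S.card p k s (y t) =
      ENNReal.ofReal (Real.exp (s * √(2 * k / (v * S.card)) * (S.card * d) - k)) := fun s => by
    unfold gaussianTest
    rw [← ENNReal.ofReal_prod_of_nonneg fun _ _ => (Real.exp_pos _).le, ← Real.exp_sum,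
      Finset.sum_sub_distrib, ← Finset.mul_sum, hsum, Finset.sum_const, nsmul_eq_mul]
    congr 3
    field_simp
  have habs : (2 * k : ℝ) ≤ √(2 * k / (v * S.card)) * (S.card * |d|) := by
    have h1 : √(2 * k / (v * S.card) : ℝ) * (S.card * |d|) =
        √((2 * k / (v * S.card)) * (S.card * d) ^ 2) := by
      rw [Real.sqrt_mul (by positivity), Real.sqrt_sq_eq_abs, abs_mul, abs_of_pos hn]
    rw [h1]
    refine Real.le_sqrt_of_sq_le ?_
    have : (2 * k / (v * S.card)) * (S.card * d) ^ 2 =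
        (4 * k : ℝ) * (S.card * (d ^ 2 / (2 * v))) := by field_simp; ring
    rw [this]
    nlinarith [mul_le_mul_of_nonneg_left hk (show (0 : ℝ) ≤ 4 * k by positivity)]
  rcases le_total 0 d with h | h
  · refine ⟨1, Or.inl rfl, ?_⟩
    rw [hprod]
    refine ENNReal.ofReal_le_ofReal (Real.exp_le_exp.2 ?_)
    rw [abs_of_nonneg h] at habs
    linarith
  · refine ⟨-1, Or.inr rfl, ?_⟩
    rw [hprod]
    refine ENNReal.ofReal_le_ofReal (Real.exp_le_exp.2 ?_)
    rw [abs_of_nonpos h] at habs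
    linarith

/-- Chernoff's method with a finite family of test functions: for samples of size `n` from the
distribution with mean `p` there are `2 (n + L + 1)` functions of mean at most `1`, such that for
every sample one of them has a product that exceeds `exp (min L (n D(q ‖ p)) - 1)`,
where `q` is the empirical mean. -/
lemma exists_testFunctions (F : RewardFamily) {p : ℝ} (hp : p ∈ F.means) (n L : ℕ) :
    ∃ w : ℕ → ℝ → ℝ≥0∞, (∀ j, Measurable (w j)) ∧ (∀ j, ∫⁻ y, w j y ∂(F.law p) ≤ 1) ∧
      ∀ (S : Finset ℕ) (y : ℕ → ℝ), S.card = n → (∀ t ∈ S, y t ∈ F.values) →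
        ∃ j < 2 * (n + L + 1), ENNReal.ofReal (Real.exp
          ((min (L : ℝ≥0∞) (n * F.kl ((∑ t ∈ S, y t) / n) p)).toReal - 1)) ≤
            ∏ t ∈ S, w j (y t) := by
  rcases Nat.eq_zero_or_pos n with rfl | hn
  · refine ⟨fun _ _ => 1, fun _ => measurable_const, fun _ => by simp, fun S y hS _ =>
      ⟨0, by omega, ?_⟩⟩
    simp
  cases F with
  | bernoulli =>
    refine ⟨fun j => if j ≤ n then bernoulliRatio (j / n) p else 1, fun j => ?_, fun j => ?_, ?_⟩
    · dsimp only; split_ifs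
      exacts [measurable_bernoulliRatio _ _, measurable_const]
    · dsimp only; split_ifs with hj
      · refine bernoulliRatio_lintegral_le ⟨by positivity, ?_⟩ hp
        rw [div_le_one (by positivity)]; exact_mod_cast hj
      · simp
    · intro S y hS hy
      have hSn : S.Nonempty := Finset.card_pos.1 (by omega)
      have hy' : ∀ t ∈ S, y t = 0 ∨ y t = 1 := fun t ht => hy t ht
      have hsum : ∑ t ∈ S, y t = (S.filter fun t => y t = 1).card := by
        have e : ∑ t ∈ S, y t = ∑ t ∈ S, if y t = 1 then (1 : ℝ) else 0 := by
          refine Finset.sum_congr rfl fun t ht => ?_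
          rcases hy' t ht with h | h <;> simp [h]
        rw [e, Finset.sum_boole]
      have hle : (S.filter fun t => y t = 1).card ≤ n := hS ▸ Finset.card_filter_le _ _
      refine ⟨(S.filter fun t => y t = 1).card, by omega, ?_⟩
      simp only [if_pos hle, ← hsum]
      have := exp_kl_le_prod_bernoulliRatio hp S y hy' (L := L) hSn
      rw [hS, ENNReal.ofReal_natCast] at this
      refine le_trans (ENNReal.ofReal_le_ofReal (Real.exp_le_exp.2 (by linarith))) this
  | gaussian v hv =>
    refine ⟨fun j => gaussianTest v n p (j / 2) (if j % 2 = 0 then 1 else -1), fun j => ?_,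
      fun j => ?_, ?_⟩
    · unfold gaussianTest; fun_prop
    · exact (gaussianTest_lintegral v n p _ (by split_ifs <;> norm_num)).le
    · intro S y hS _
      have hSn : S.Nonempty := Finset.card_pos.1 (by omega)
      obtain ⟨x, hx⟩ : ∃ x, x = (min (L : ℝ≥0∞)
        (n * (RewardFamily.gaussian v hv).kl ((∑ t ∈ S, y t) / n) p)).toReal := ⟨_, rfl⟩
      rw [← hx]
      have hv' : (0 : ℝ) < v := by exact_mod_cast hv
      have hx0 : 0 ≤ x := hx ▸ ENNReal.toReal_nonneg
      have hxL : x ≤ L := by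
        rw [hx]
        have := ENNReal.toReal_mono (ENNReal.natCast_ne_top L) (min_le_left (L : ℝ≥0∞)
          (n * (RewardFamily.gaussian v hv).kl ((∑ t ∈ S, y t) / n) p))
        simpa using this
      have hxn : x ≤ n * ((((∑ t ∈ S, y t) / n) - p) ^ 2 / (2 * v)) := by
        rw [hx, kl_gaussian hv]
        refine (ENNReal.toReal_mono (ENNReal.mul_ne_top (by simp) ENNReal.ofReal_ne_top)
          (min_le_right _ _)).trans ?_
        rw [ENNReal.toReal_mul, ENNReal.toReal_ofReal (by positivity)]; simp
      have hfl : (⌊x⌋₊ : ℝ) ≤ x := Nat.floor_le hx0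
      have hflL : ⌊x⌋₊ ≤ L := Nat.floor_le_of_le hxL
      obtain ⟨s, hs, hle⟩ := exp_le_prod_gaussianTest hv p S y ⌊x⌋₊ hSn
        (by rw [hS]; exact hfl.trans hxn)
      have hexp : ENNReal.ofReal (Real.exp (x - 1)) ≤ ENNReal.ofReal (Real.exp ⌊x⌋₊) :=
        ENNReal.ofReal_le_ofReal (Real.exp_le_exp.2 (by linarith [Nat.lt_floor_add_one x]))
      rw [hS] at hle
      rcases hs with rfl | rfl
      · refine ⟨2 * ⌊x⌋₊, by omega, hexp.trans (hle.trans (le_of_eq ?_))⟩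
        simp
      · refine ⟨2 * ⌊x⌋₊ + 1, by omega, hexp.trans (hle.trans (le_of_eq ?_))⟩
        have h1 : (2 * ⌊x⌋₊ + 1) / 2 = ⌊x⌋₊ := by omega
        have h2 : (2 * ⌊x⌋₊ + 1) % 2 ≠ 0 := by omega
        simp only [h1, if_neg h2]

lemma ae_mem_values (F : RewardFamily) {p : ℝ} (hp : p ∈ F.means) :
    ∀ᵐ y ∂(F.law p), y ∈ F.values := by
  cases F with
  | bernoulli =>
    have hm : MeasurableSet ({0, 1} : Set ℝ)ᶜ := by measurability
    rw [ae_iff]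
    change RewardFamily.bernoulli.law p ({0, 1} : Set ℝ)ᶜ = 0
    rw [← lintegral_indicator_one hm, lintegral_law_bernoulli hp]
    simp
  | gaussian v hv => simp [RewardFamily.values]

lemma mean_mem_means (F : RewardFamily) {ι : Type*} (S : Finset ι) (y : ι → ℝ)
    (hy : ∀ t ∈ S, y t ∈ F.values) : (∑ t ∈ S, y t) / (S.card : ℝ) ∈ F.means := by
  cases F with
  | bernoulli =>
    have hy' : ∀ t ∈ S, 0 ≤ y t ∧ y t ≤ 1 := fun t ht => by
      have h : y t = 0 ∨ y t = 1 := hy t ht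
      rcases h with h | h <;> simp [h]
    refine ⟨div_nonneg (Finset.sum_nonneg fun t ht => (hy' t ht).1) (by positivity), ?_⟩
    refine div_le_one_of_le₀ ?_ (by positivity)
    calc ∑ t ∈ S, y t ≤ ∑ t ∈ S, (1 : ℝ) := Finset.sum_le_sum fun t ht => (hy' t ht).2
      _ = S.card := by simp
  | gaussian v hv => trivial

end BestArm

namespace BestArm

/-! ### The interaction of an algorithm with independent rewards -/

/-- Resampling one coordinate of a product measure does not change it. -/
lemma infinitePi_map_update {ι : Type*} [DecidableEq ι] (ρ : ι → Measure ℝ)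
    [∀ i, IsProbabilityMeasure (ρ i)] (x : ι) :
    ((Measure.infinitePi ρ).prod (ρ x)).map (fun z => Function.update z.1 x z.2) =
      Measure.infinitePi ρ := by
  refine Measure.eq_infinitePi ρ fun s t ht => ?_
  have hmeas : Measurable fun z : (ι → ℝ) × ℝ => Function.update z.1 x z.2 := by
    refine measurable_pi_lambda _ fun i => ?_
    by_cases h : i = x
    · subst h; simpa using measurable_snd
    · simp only [Function.update_of_ne h]; fun_prop
  rw [Measure.map_apply hmeas (MeasurableSet.pi s.countable_toSet fun i _ => ht i)]
  have hpre : (fun z : (ι → ℝ) × ℝ => Function.update z.1 x z.2) ⁻¹' (Set.pi s t) =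
      (Set.pi (s.erase x : Finset ι) t) ×ˢ (if x ∈ s then t x else Set.univ) := by
    ext z
    simp only [Set.mem_preimage, Set.mem_pi, Finset.mem_coe, Set.mem_prod, Finset.mem_erase]
    constructor
    · intro h
      refine ⟨fun i hi => by simpa [Function.update_of_ne hi.1] using h i hi.2, ?_⟩
      split_ifs with hx
      · simpa using h x hx
      · trivial
    · rintro ⟨h1, h2⟩ i hi
      by_cases hix : i = x
      · subst hix; simpa [hi] using h2
      · simpa [Function.update_of_ne hix] using h1 i ⟨hix, hi⟩
  rw [hpre, Measure.prod_prod, Measure.infinitePi_pi ρ fun i _ => ht i]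
  split_ifs with hx
  · rw [mul_comm]; exact Finset.mul_prod_erase s (fun i => ρ i (t i)) hx
  · rw [Finset.erase_eq_of_notMem hx]; simp

lemma measurable_finSnoc {E : Type*} [MeasurableSpace E] (t : ℕ) :
    Measurable fun z : (Fin t → E) × E => (Fin.snoc (α := fun _ => E) z.1 z.2 : Fin (t + 1) → E) := by
  refine measurable_pi_lambda _ fun i => ?_
  refine Fin.lastCases ?_ (fun j => ?_) i
  · simpa using measurable_snd
  · simp only [Fin.snoc_castSucc]; fun_prop

lemma _root_.Measurable.finSnoc {α E : Type*} [MeasurableSpace α] [MeasurableSpace E] {t : ℕ}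
    {f : α → Fin t → E} {g : α → E} (hf : Measurable f) (hg : Measurable g) :
    Measurable fun a => (Fin.snoc (α := fun _ => E) (f a) (g a) : Fin (t + 1) → E) :=
  (measurable_finSnoc t).comp (hf.prodMk hg)

namespace Policy

variable {K T : ℕ} (π : Policy K T)

/-- The arm drawn in round `t`. -/
def arm (u : unitInterval) (Y : ℕ × Fin K → ℝ) (t : ℕ) : Fin K :=
  π.draw t u (π.history u Y t)

lemma history_succ (u : unitInterval) (Y : ℕ × Fin K → ℝ) (t : ℕ) :
    π.history u Y (t + 1) = Fin.snoc (α := fun _ => Fin K × ℝ) (π.history u Y t)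
      (π.arm u Y t, Y (t, π.arm u Y t)) := rfl

lemma history_apply (u : unitInterval) (Y : ℕ × Fin K → ℝ) (t : ℕ) (s : Fin t) :
    π.history u Y t s = (π.arm u Y s, Y (s, π.arm u Y s)) := by
  induction t with
  | zero => exact s.elim0
  | succ t ih =>
    rw [history_succ]
    refine Fin.lastCases ?_ (fun j => ?_) s
    · simp
    · simp only [Fin.snoc_castSucc, Fin.val_castSucc]; exact ih j

lemma history_congr (u : unitInterval) {Y Y' : ℕ × Fin K → ℝ} {t : ℕ}
    (h : ∀ s < t, ∀ i, Y (s, i) = Y' (s, i)) : π.history u Y t = π.history u Y' t := by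
  induction t with
  | zero => rfl
  | succ t ih =>
    have e := ih fun s hs => h s (by omega)
    have ea : π.arm u Y t = π.arm u Y' t := by unfold arm; rw [e]
    rw [history_succ, history_succ, e, ea, h t (by omega)]

variable {π}

lemma IsMeasurable.arm_history (hπ : π.IsMeasurable) (t : ℕ) :
    (Measurable fun x : unitInterval × (ℕ × Fin K → ℝ) => π.arm x.1 x.2 t) ∧
      Measurable fun x : unitInterval × (ℕ × Fin K → ℝ) => π.history x.1 x.2 t := by
  have key : ∀ t, (Measurable fun x : unitInterval × (ℕ × Fin K → ℝ) => π.history x.1 x.2 t) →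
      Measurable fun x : unitInterval × (ℕ × Fin K → ℝ) => π.arm x.1 x.2 t := fun t h =>
    (hπ.1 t).comp (measurable_fst.prodMk h)
  suffices h : ∀ t, Measurable fun x : unitInterval × (ℕ × Fin K → ℝ) => π.history x.1 x.2 t from
    ⟨key t (h t), h t⟩
  intro t
  induction t with
  | zero => exact measurable_const
  | succ t ih =>
    simp only [history_succ]
    have hY : Measurable fun z : Fin K × (ℕ × Fin K → ℝ) => z.2 (t, z.1) :=
      measurable_from_prod_countable_right fun i => measurable_pi_apply (t, i)
    refine ih.finSnoc ((key t ih).prodMk ?_)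
    exact hY.comp ((key t ih).prodMk measurable_snd)

lemma IsMeasurable.history (hπ : π.IsMeasurable) (t : ℕ) :
    Measurable fun x : unitInterval × (ℕ × Fin K → ℝ) => π.history x.1 x.2 t :=
  (hπ.arm_history t).2

lemma IsMeasurable.arm (hπ : π.IsMeasurable) (t : ℕ) :
    Measurable fun x : unitInterval × (ℕ × Fin K → ℝ) => π.arm x.1 x.2 t :=
  (hπ.arm_history t).1

end Policy

/-- The joint law of a uniform seed and of independent rewards, where `ρ (t, i)` is the law of
the reward of arm `i` in round `t`. -/
def interactionMeasure {K : ℕ} (ρ : ℕ × Fin K → Measure ℝ) :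
    Measure (unitInterval × (ℕ × Fin K → ℝ)) :=
  (volume : Measure unitInterval).prod (Measure.infinitePi ρ)

instance {K : ℕ} (ρ : ℕ × Fin K → Measure ℝ) [∀ x, IsProbabilityMeasure (ρ x)] :
    IsProbabilityMeasure (interactionMeasure ρ) := by
  unfold interactionMeasure; infer_instance

/-- The product of the values of the functions `w s i` at the rewards of a history. -/
def historyProd {K : ℕ} (w : ℕ → Fin K → ℝ → ℝ≥0∞) (t : ℕ) (h : Fin t → Fin K × ℝ) : ℝ≥0∞ :=
  ∏ s : Fin t, w s (h s).1 (h s).2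

section

variable {K T : ℕ} {π : Policy K T} (ρ : ℕ × Fin K → Measure ℝ)
  [∀ x, IsProbabilityMeasure (ρ x)]

lemma measurable_historyProd {w : ℕ → Fin K → ℝ → ℝ≥0∞} (hw : ∀ s i, Measurable (w s i)) (t : ℕ) :
    Measurable (historyProd w t) := by
  refine Finset.measurable_prod _ fun s _ => ?_
  have : Measurable fun z : Fin K × ℝ => w s z.1 z.2 :=
    measurable_from_prod_countable_right fun i => hw s i
  exact this.comp (measurable_pi_apply s)

lemma historyProd_snoc (w : ℕ → Fin K → ℝ → ℝ≥0∞) (t : ℕ) (h : Fin t → Fin K × ℝ)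
    (z : Fin K × ℝ) :
    historyProd w (t + 1) (Fin.snoc (α := fun _ => Fin K × ℝ) h z) =
      historyProd w t h * w t z.1 z.2 := by
  simp [historyProd, Fin.prod_univ_castSucc]

/-- Given the past, the reward of round `t` has the law of the arm that is drawn. -/
lemma lintegral_history_succ (hπ : π.IsMeasurable) (t : ℕ)
    {g : unitInterval × (Fin (t + 1) → Fin K × ℝ) → ℝ≥0∞} (hg : Measurable g) :
    ∫⁻ x, g (x.1, π.history x.1 x.2 (t + 1)) ∂(interactionMeasure ρ) =
      ∫⁻ x, ∫⁻ y, g (x.1, Fin.snoc (α := fun _ => Fin K × ℝ) (π.history x.1 x.2 t)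
        (π.arm x.1 x.2 t, y)) ∂(ρ (t, π.arm x.1 x.2 t)) ∂(interactionMeasure ρ) := by
  classical
  -- the integrand on the event that arm `i` is drawn, as a function of the reward `y`
  let G : Fin K → (unitInterval × (ℕ × Fin K → ℝ)) → ℝ → ℝ≥0∞ := fun i x y =>
    if π.arm x.1 x.2 t = i then
      g (x.1, Fin.snoc (α := fun _ => Fin K × ℝ) (π.history x.1 x.2 t) (i, y)) else 0
  have hG : ∀ i, Measurable fun z : (unitInterval × (ℕ × Fin K → ℝ)) × ℝ => G i z.1 z.2 := by
    intro i
    refine Measurable.ite ?_ ?_ measurable_const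
    · exact ((hπ.arm t).comp measurable_fst) (measurableSet_singleton i)
    · refine hg.comp ((measurable_fst.comp measurable_fst).prodMk ?_)
      exact ((hπ.history t).comp measurable_fst).finSnoc (measurable_const.prodMk measurable_snd)
  have hGY : ∀ i, Measurable fun x : unitInterval × (ℕ × Fin K → ℝ) => G i x (x.2 (t, i)) :=
    fun i => (hG i).comp (measurable_id.prodMk ((measurable_pi_apply (t, i)).comp measurable_snd))
  have hGint : ∀ i, Measurable fun x : unitInterval × (ℕ × Fin K → ℝ) =>
      ∫⁻ y, G i x y ∂(ρ (t, i)) := fun i => (hG i).lintegral_prod_right'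
  have e1 : ∀ x : unitInterval × (ℕ × Fin K → ℝ), g (x.1, π.history x.1 x.2 (t + 1)) =
      ∑ i, G i x (x.2 (t, i)) := fun x => by
    simp only [G, Finset.sum_ite_eq, Finset.mem_univ, if_true, Policy.history_succ]
  have e2 : ∀ x : unitInterval × (ℕ × Fin K → ℝ),
      ∫⁻ y, g (x.1, Fin.snoc (α := fun _ => Fin K × ℝ) (π.history x.1 x.2 t)
        (π.arm x.1 x.2 t, y)) ∂(ρ (t, π.arm x.1 x.2 t)) = ∑ i, ∫⁻ y, G i x y ∂(ρ (t, i)) :=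
    fun x => by
    rw [Finset.sum_eq_single (π.arm x.1 x.2 t)]
    · simp [G]
    · intro i _ hi; simp [G, Ne.symm hi]
    · simp
  simp only [e1, e2]
  rw [lintegral_finsetSum _ fun i _ => hGY i, lintegral_finsetSum _ fun i _ => hGint i]
  refine Finset.sum_congr rfl fun i _ => ?_
  unfold interactionMeasure
  rw [lintegral_prod _ (hGY i).aemeasurable, lintegral_prod _ (hGint i).aemeasurable]
  refine lintegral_congr fun u => ?_
  have hu : Measurable fun Y : ℕ × Fin K → ℝ => G i (u, Y) (Y (t, i)) :=
    (hGY i).comp measurable_prodMk_left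
  have hup : Measurable fun z : (ℕ × Fin K → ℝ) × ℝ => Function.update z.1 (t, i) z.2 := by
    refine measurable_pi_lambda _ fun j => ?_
    by_cases h : j = (t, i)
    · subst h; simpa using measurable_snd
    · simp only [Function.update_of_ne h]; fun_prop
  have hmp := infinitePi_map_update ρ (t, i)
  calc ∫⁻ Y, G i (u, Y) (Y (t, i)) ∂(Measure.infinitePi ρ)
      = ∫⁻ z, G i (u, Function.update z.1 (t, i) z.2) (Function.update z.1 (t, i) z.2 (t, i))
          ∂((Measure.infinitePi ρ).prod (ρ (t, i))) := by
        conv_lhs => rw [← hmp]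
        rw [lintegral_map hu hup]
    _ = ∫⁻ z, G i (u, z.1) z.2 ∂((Measure.infinitePi ρ).prod (ρ (t, i))) := by
        refine lintegral_congr fun z => ?_
        have hh : π.history u (Function.update z.1 (t, i) z.2) t = π.history u z.1 t :=
          π.history_congr u fun s hs j => Function.update_of_ne (by simp; omega) _ _
        simp only [G, Policy.arm, hh, Function.update_self]
        congr
    _ = ∫⁻ Y, ∫⁻ y, G i (u, Y) y ∂(ρ (t, i)) ∂(Measure.infinitePi ρ) := by
        refine lintegral_prod _ (Measurable.aemeasurable ?_)
        exact (hG i).comp ((measurable_const.prodMk measurable_fst).prodMk measurable_snd)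

/-- Change of measure along the history: only the likelihood ratios of the drawn arms count. -/
lemma lintegral_history_withDensity (hπ : π.IsMeasurable) (ρ' : ℕ × Fin K → Measure ℝ)
    [∀ x, IsProbabilityMeasure (ρ' x)] {ℓ : ℕ → Fin K → ℝ → ℝ≥0∞} (hℓ : ∀ s i, Measurable (ℓ s i))
    (t : ℕ) (h : ∀ s < t, ∀ i, ρ (s, i) = (ρ' (s, i)).withDensity (ℓ s i))
    {g : unitInterval × (Fin t → Fin K × ℝ) → ℝ≥0∞} (hg : Measurable g) :
    ∫⁻ x, g (x.1, π.history x.1 x.2 t) ∂(interactionMeasure ρ) =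
      ∫⁻ x, g (x.1, π.history x.1 x.2 t) * historyProd ℓ t (π.history x.1 x.2 t)
        ∂(interactionMeasure ρ') := by
  induction t with
  | zero =>
    have e : ∀ (μ : ℕ × Fin K → Measure ℝ) [∀ x, IsProbabilityMeasure (μ x)],
        ∫⁻ x, g (x.1, π.history x.1 x.2 0) ∂(interactionMeasure μ) =
          ∫⁻ u, g (u, Fin.elim0) ∂(volume : Measure unitInterval) := by
      intro μ _
      unfold interactionMeasure
      have hg' : Measurable fun u : unitInterval => g (u, Fin.elim0) :=
        hg.comp (measurable_id.prodMk measurable_const)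
      simp only [Policy.history]
      rw [lintegral_prod (fun x : unitInterval × (ℕ × Fin K → ℝ) => g (x.1, Fin.elim0))
        ((hg'.comp measurable_fst).aemeasurable)]
      simp
    rw [e ρ]
    simp only [historyProd, Finset.univ_eq_empty, Finset.prod_empty, mul_one]
    rw [e ρ']
  | succ t ih =>
    -- the conditional expectation of `g` given the history of the first `t` rounds
    let g' : unitInterval × (Fin t → Fin K × ℝ) → ℝ≥0∞ := fun z =>
      ∫⁻ y, g (z.1, Fin.snoc (α := fun _ => Fin K × ℝ) z.2 (π.draw t z.1 z.2, y))
        ∂(ρ (t, π.draw t z.1 z.2))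
    have hg' : Measurable g' := by
      have : ∀ i, Measurable fun z : unitInterval × (Fin t → Fin K × ℝ) =>
          ∫⁻ y, g (z.1, Fin.snoc (α := fun _ => Fin K × ℝ) z.2 (i, y)) ∂(ρ (t, i)) := fun i => by
        refine Measurable.lintegral_prod_right' (f := fun w : (unitInterval ×
          (Fin t → Fin K × ℝ)) × ℝ => g (w.1.1, Fin.snoc (α := fun _ => Fin K × ℝ) w.1.2 (i, w.2))) ?_
        refine hg.comp ((measurable_fst.comp measurable_fst).prodMk ?_)
        exact (measurable_snd.comp measurable_fst).finSnoc (measurable_const.prodMk measurable_snd)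
      have h2 : Measurable fun w : Fin K × (unitInterval × (Fin t → Fin K × ℝ)) =>
          ∫⁻ y, g (w.2.1, Fin.snoc (α := fun _ => Fin K × ℝ) w.2.2 (w.1, y)) ∂(ρ (t, w.1)) :=
        measurable_from_prod_countable_right this
      exact h2.comp ((hπ.1 t).prodMk measurable_id)
    have hprod : Measurable fun z : unitInterval × (Fin (t + 1) → Fin K × ℝ) =>
        g z * historyProd ℓ (t + 1) z.2 :=
      hg.mul ((measurable_historyProd hℓ _).comp measurable_snd)
    rw [lintegral_history_succ ρ hπ t hg]
    refine (ih (fun s hs => h s (by omega)) hg').trans ?_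
    rw [lintegral_history_succ ρ' hπ t hprod]
    refine lintegral_congr fun x => ?_
    simp only [g', historyProd_snoc]
    have hgm : Measurable fun y => g (x.1, Fin.snoc (α := fun _ => Fin K × ℝ)
        (π.history x.1 x.2 t) (π.arm x.1 x.2 t, y)) :=
      hg.comp (measurable_const.prodMk
        (measurable_const.finSnoc (measurable_const.prodMk measurable_id)))
    change (∫⁻ y, g (x.1, Fin.snoc (α := fun _ => Fin K × ℝ)
        (π.history x.1 x.2 t) (π.arm x.1 x.2 t, y)) ∂(ρ (t, π.arm x.1 x.2 t))) * _ = _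
    rw [h t (by omega), lintegral_withDensity_eq_lintegral_mul _ (hℓ _ _) hgm,
      ← lintegral_mul_const _ ((hℓ _ _).mul hgm)]
    refine lintegral_congr fun y => ?_
    simp only [Pi.mul_apply]
    ring

/-- Test functions of mean at most `1` multiply to a nonnegative supermartingale. -/
lemma lintegral_historyProd_le_one (hπ : π.IsMeasurable) {w : ℕ → Fin K → ℝ → ℝ≥0∞}
    (hw : ∀ s i, Measurable (w s i)) (t : ℕ) (h : ∀ s < t, ∀ i, ∫⁻ y, w s i y ∂(ρ (s, i)) ≤ 1) :
    ∫⁻ x, historyProd w t (π.history x.1 x.2 t) ∂(interactionMeasure ρ) ≤ 1 := by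
  induction t with
  | zero => simp [historyProd]
  | succ t ih =>
    rw [lintegral_history_succ ρ hπ t (g := fun z => historyProd w (t + 1) z.2)
      ((measurable_historyProd hw _).comp measurable_snd)]
    refine le_trans (lintegral_mono fun x => ?_) (ih fun s hs => h s (by omega))
    simp only [historyProd_snoc]
    rw [lintegral_const_mul _ (hw _ _)]
    exact mul_le_of_le_one_right' (h t (by omega) _)

/-- The probability of an event that depends on the first `t` rounds only depends on the laws of
the rewards in these rounds. -/
lemma interactionMeasure_history_congr (hπ : π.IsMeasurable) (ρ' : ℕ × Fin K → Measure ℝ)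
    [∀ x, IsProbabilityMeasure (ρ' x)] (t : ℕ) (h : ∀ s < t, ∀ i, ρ (s, i) = ρ' (s, i))
    {A : Set (Fin t → Fin K × ℝ)} (hA : MeasurableSet A) :
    interactionMeasure ρ {x | π.history x.1 x.2 t ∈ A} =
      interactionMeasure ρ' {x | π.history x.1 x.2 t ∈ A} := by
  have key := lintegral_history_withDensity ρ hπ ρ' (ℓ := fun _ _ _ => 1)
    (fun _ _ => measurable_const) t (fun s hs i => by rw [h s hs i]; exact withDensity_one.symm)
    (g := fun z => A.indicator 1 z.2) ((measurable_one.indicator hA).comp measurable_snd)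
  simp only [historyProd, Finset.prod_const_one, mul_one] at key
  have e : ∀ x : unitInterval × (ℕ × Fin K → ℝ), A.indicator (1 : (Fin t → Fin K × ℝ) → ℝ≥0∞) (π.history x.1 x.2 t) =
      Set.indicator {x : unitInterval × (ℕ × Fin K → ℝ) | π.history x.1 x.2 t ∈ A} 1 x := fun x => by
    by_cases hx : π.history x.1 x.2 t ∈ A <;> simp [hx]
  simp only [e] at key
  have hS : MeasurableSet {x : unitInterval × (ℕ × Fin K → ℝ) | π.history x.1 x.2 t ∈ A} :=
    hπ.history t hA
  rwa [lintegral_indicator_one hS, lintegral_indicator_one hS] at key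

end

end BestArm

namespace BestArm

/-! ### Error exponents -/

lemma le_toENNReal_log_inv {x : ℝ≥0∞} {a : ℝ} (h : x ≤ ENNReal.ofReal (Real.exp (-a))) :
    ENNReal.ofReal a ≤ (ENNReal.log x⁻¹).toENNReal := by
  have h1 : ENNReal.log x ≤ ((-a : ℝ) : EReal) := by
    have := ENNReal.log_le_log h
    rwa [ENNReal.log_ofReal_of_pos (Real.exp_pos _), Real.log_exp] at this
  have h2 : (a : EReal) ≤ ENNReal.log x⁻¹ := by
    rw [ENNReal.log_inv, EReal.le_neg]; simpa using h1
  simpa using EReal.toENNReal_le_toENNReal h2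

lemma toENNReal_log_inv_le {x : ℝ≥0∞} {a : ℝ} (h : ENNReal.ofReal (Real.exp (-a)) ≤ x) :
    (ENNReal.log x⁻¹).toENNReal ≤ ENNReal.ofReal a := by
  have h1 : ((-a : ℝ) : EReal) ≤ ENNReal.log x := by
    have := ENNReal.log_le_log h
    rwa [ENNReal.log_ofReal_of_pos (Real.exp_pos _), Real.log_exp] at this
  have h2 : ENNReal.log x⁻¹ ≤ (a : EReal) := by
    rw [ENNReal.log_inv, EReal.neg_le]; simpa using h1
  simpa using EReal.toENNReal_le_toENNReal h2

variable {K : ℕ} {F : RewardFamily} {P : Fin K → ℝ} {π : (T : ℕ) → Policy K T}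

lemma le_errorExponent {c : ℝ}
    (h : ∀ᶠ T : ℕ in atTop, (π T).errorProb F P ≤ ENNReal.ofReal (Real.exp (-(c * T)))) :
    ENNReal.ofReal c ≤ errorExponent F P π := by
  refine le_liminf_of_le (by isBoundedDefault) ?_
  filter_upwards [h, eventually_gt_atTop 0] with T hT hpos
  have hT0 : (((T : ℝ≥0) : ℝ≥0∞)) ≠ 0 := by simpa using hpos.ne'
  refine (ENNReal.le_div_iff_mul_le (Or.inl hT0) (Or.inl (by simp))).2
    (le_trans (le_of_eq ?_) (le_toENNReal_log_inv hT))
  rw [ENNReal.ofReal_mul' (by positivity)]; simp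

lemma errorExponent_le {c : ℝ}
    (h : ∃ᶠ T : ℕ in atTop, ENNReal.ofReal (Real.exp (-(c * T))) ≤ (π T).errorProb F P) :
    errorExponent F P π ≤ ENNReal.ofReal c := by
  refine liminf_le_of_frequently_le ((h.and_eventually (eventually_gt_atTop 0)).mono ?_)
    (by isBoundedDefault)
  rintro T ⟨hT, hpos⟩
  refine ENNReal.div_le_of_le_mul ((toENNReal_log_inv_le hT).trans (le_of_eq ?_))
  rw [ENNReal.ofReal_mul' (by positivity)]; simp

lemma weigh_mono (h : ℝ≥0∞) {x y : ℝ≥0∞} (hxy : x ≤ y) : weigh h x ≤ weigh h y := by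
  unfold weigh; split_ifs
  · exact le_rfl
  · gcongr

lemma mul_weigh_le (h c x : ℝ≥0∞) : c * weigh h x ≤ weigh h (c * x) := by
  unfold weigh; split_ifs
  · exact le_top
  · exact le_of_eq (by ring)

/-! ### Convergence of the rates of the batch oracles -/

lemma sum_range_mul_eq {M : Type*} [AddCommMonoid M] (f : ℕ → M) (B m : ℕ) :
    ∑ a ∈ Finset.range (B * m), f a =
      ∑ b ∈ Finset.range B, ∑ j ∈ Finset.range m, f (b * m + j) := by
  induction B with
  | zero => simp
  | succ B ih => rw [Nat.succ_mul, Finset.sum_range_add, ih, Finset.sum_range_succ]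

/-- The average of the allocations of `m` consecutive batches in which the same empirical means
are observed. -/
def mergedAlloc {B : ℕ} (o : BatchOracle K B) {m : ℕ} (hm : 0 < m) (b : ℕ)
    (q : Fin (b + 1) → Fin K → ℝ) : stdSimplex ℝ (Fin K) :=
  ⟨∑ j : Fin m, (1 / (m : ℝ)) • (o.alloc (b * m + j) fun c : Fin (b * m + j + 1) =>
      q ⟨c / m, Nat.div_lt_of_lt_mul (by
        have := c.isLt; have := j.isLt; rw [Nat.mul_comm m, Nat.succ_mul]; omega)⟩ : Fin K → ℝ),
    (convex_stdSimplex ℝ (Fin K)).sum_mem (fun _ _ => by positivity)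
      (by simp; field_simp) (fun j _ => Subtype.prop _)⟩

/-- The oracle for `B` batches that simulates an oracle for `n ≤ B m` batches: each of its batches
serves as `m` batches of the other oracle with the same empirical means. -/
def mergedOracle {n : ℕ} (o : BatchOracle K n) {m B : ℕ} (hm : 0 < m) (hn : n ≤ B * m) :
    BatchOracle K B where
  alloc := mergedAlloc o hm
  recommend := fun q => o.recommend fun a : Fin n =>
    q ⟨a / m, Nat.div_lt_of_lt_mul (by have := a.isLt; rw [Nat.mul_comm m]; omega)⟩

/-- When the `B` batches show `Q`, the merged oracle collects what the other oracle collects when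
each `Q b` is shown `m` times in a row; the factor accounts for the batches beyond `n`. -/
lemma mul_value_le_value_mergedOracle (F : RewardFamily) (Θ : Set ℝ) (H : (Fin K → ℝ) → ℝ≥0∞)
    {n : ℕ} (o : BatchOracle K n) {m B : ℕ} (hm : 0 < m) (hn : n ≤ B * m) (hn0 : 0 < n) :
    (n : ℝ≥0∞) / (B * m : ℕ) * o.value F Θ H ≤ (mergedOracle o hm hn).value F Θ H := by
  have hm' : (m : ℝ≥0∞) ≠ 0 := by simpa using hm.ne'
  have hn' : (n : ℝ≥0∞) ≠ 0 := by simpa using hn0.ne'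
  refine le_iInf₂ fun Q hQ => le_iInf₂ fun P hP => le_iInf fun hJ => ?_
  have hlt : ∀ a < B * m, a / m < B := fun a ha =>
    Nat.div_lt_of_lt_mul (by rw [Nat.mul_comm m]; exact ha)
  obtain ⟨Qe, hQe⟩ : ∃ Qe : ℕ → Fin K → ℝ, ∀ b : Fin B, Qe b = Q b :=
    ⟨fun b => if h : b < B then Q ⟨b, h⟩ else 0, fun b => by simp⟩
  obtain ⟨f, hf⟩ : ∃ f : ℕ → ℝ≥0∞, ∀ a, f a = ∑ i,
      ENNReal.ofReal ((o.alloc a fun c : Fin (a + 1) => Qe (c / m) : Fin K → ℝ) i) *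
        F.kl (Qe (a / m) i) (P i) := ⟨_, fun _ => rfl⟩
  have h1 : o.value F Θ H ≤ weigh (H P) ((∑ a ∈ Finset.range n, f a) / (n : ℝ≥0∞)) := by
    refine (iInf₂_le (fun a : Fin n => Q ⟨a / m, hlt a (by omega)⟩)
      fun a i => hQ _ i).trans ((iInf₂_le P hP).trans ((iInf_le _ hJ).trans (le_of_eq ?_)))
    rw [Finset.sum_range]
    congr 2
    refine Finset.sum_congr rfl fun a _ => ?_
    rw [hf]
    refine Finset.sum_congr rfl fun i _ => ?_
    have hq : ∀ (b : ℕ) (h : b < B), Q ⟨b, h⟩ = Qe b := fun b h => (hQe ⟨b, h⟩).symm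
    simp only [hq, Fin.val_castLE]
  have h2 : (∑ b : Fin B, ∑ i, ENNReal.ofReal
      (((mergedOracle o hm hn).alloc b fun a : Fin (b + 1) => Q (Fin.castLE b.isLt a) :
        Fin K → ℝ) i) * F.kl (Q b i) (P i)) =
      (m : ℝ≥0∞)⁻¹ * ∑ a ∈ Finset.range (B * m), f a := by
    rw [sum_range_mul_eq, Finset.sum_range, Finset.mul_sum]
    refine Finset.sum_congr rfl fun b _ => ?_
    have e : ∀ i, ENNReal.ofReal (((mergedOracle o hm hn).alloc b fun a : Fin (b + 1) =>
        Q (Fin.castLE b.isLt a) : Fin K → ℝ) i) = ∑ j : Fin m, (m : ℝ≥0∞)⁻¹ *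
          ENNReal.ofReal ((o.alloc (b * m + j) fun c : Fin (b * m + j + 1) => Qe (c / m) :
            Fin K → ℝ) i) := fun i => by
      change ENNReal.ofReal ((∑ j : Fin m, (1 / (m : ℝ)) • (_ : Fin K → ℝ)) i) = _
      rw [Finset.sum_apply, ENNReal.ofReal_sum_of_nonneg]
      · refine Finset.sum_congr rfl fun j _ => ?_
        rw [Pi.smul_apply, smul_eq_mul, ENNReal.ofReal_mul (by positivity), one_div,
          ENNReal.ofReal_inv_of_pos (by exact_mod_cast hm), ENNReal.ofReal_natCast]
        congr 5
        funext c
        refine (hQe ⟨c / m, hlt c ?_⟩).symm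
        have := b.isLt; have := c.isLt; have := j.isLt
        calc (c : ℕ) < b * m + m := by omega
          _ = (b + 1) * m := by ring
          _ ≤ B * m := Nat.mul_le_mul_right m (by omega)
      · intro j _
        exact mul_nonneg (by positivity) ((o.alloc _ _).2.1 i)
    simp only [e, Finset.sum_mul]
    rw [Finset.sum_comm, Finset.mul_sum, Finset.sum_range]
    refine Finset.sum_congr rfl fun j _ => ?_
    rw [hf, Finset.mul_sum]
    refine Finset.sum_congr rfl fun i _ => ?_
    have hdiv : ((b : ℕ) * m + j) / m = b := by
      rw [Nat.mul_comm, Nat.mul_add_div hm, Nat.div_eq_of_lt j.isLt, Nat.add_zero]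
    rw [hdiv, hQe, mul_assoc]
  rw [h2]
  calc (n : ℝ≥0∞) / (B * m : ℕ) * o.value F Θ H
      ≤ (n : ℝ≥0∞) / (B * m : ℕ) *
          weigh (H P) ((∑ a ∈ Finset.range n, f a) / (n : ℝ≥0∞)) := by gcongr
    _ ≤ weigh (H P) ((n : ℝ≥0∞) / (B * m : ℕ) *
          ((∑ a ∈ Finset.range n, f a) / (n : ℝ≥0∞))) := mul_weigh_le _ _ _
    _ ≤ _ := by
        refine weigh_mono _ ?_
        have hsum : ∑ a ∈ Finset.range n, f a ≤ ∑ a ∈ Finset.range (B * m), f a :=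
          Finset.sum_le_sum_of_subset (by simpa using hn)
        have hBm : 0 < B * m := hn0.trans_le hn
        calc (n : ℝ≥0∞) / (B * m : ℕ) * ((∑ a ∈ Finset.range n, f a) / (n : ℝ≥0∞))
            = (∑ a ∈ Finset.range n, f a) / (B * m : ℕ) * ((n : ℝ≥0∞) / n) := by
              simp only [div_eq_mul_inv]; ring
          _ = (∑ a ∈ Finset.range n, f a) / (B * m : ℕ) := by
              rw [ENNReal.div_self hn' (by simp), mul_one]
          _ ≤ (∑ a ∈ Finset.range (B * m), f a) / (B * m : ℕ) := by gcongr
          _ = _ := by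
              rw [Nat.cast_mul, div_eq_mul_inv, div_eq_mul_inv,
                ENNReal.mul_inv (Or.inr (by simp)) (Or.inr hm')]
              ring

variable (F) in
/-- Merging `⌊n / B⌋ + 1` batches into one: the rate for `n` batches exceeds that for `B` batches
at most by a factor that tends to `1` as `n` grows. -/
lemma RgoBatch_le_mul (Θ : Set ℝ) (H : (Fin K → ℝ) → ℝ≥0∞) {n B : ℕ} (hn : 0 < n) (hB : 0 < B) :
    RgoBatch F Θ H n ≤ ENNReal.ofReal (1 + B / n) * RgoBatch F Θ H B := by
  have hm : 0 < n / B + 1 := Nat.succ_pos _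
  have hle : n ≤ B * (n / B + 1) := (Nat.lt_mul_div_succ n hB).le
  have hle2 : B * (n / B + 1) ≤ n + B := by
    have := Nat.mul_div_le n B; rw [Nat.mul_add]; omega
  have hn' : (n : ℝ≥0∞) ≠ 0 := by simpa using hn.ne'
  refine iSup_le fun o => ?_
  have h1 := (mul_value_le_value_mergedOracle F Θ H o hm hle hn).trans
    (le_iSup (fun o : BatchOracle K B => o.value F Θ H) _)
  have hc : ENNReal.ofReal (1 + B / n) = ((n + B : ℕ) : ℝ≥0∞) / n := by
    rw [← ENNReal.ofReal_natCast, ← ENNReal.ofReal_natCast n, ← ENNReal.ofReal_div_of_pos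
      (by exact_mod_cast hn)]
    congr 1; push_cast; field_simp
  have hnB : ((n + B : ℕ) : ℝ≥0∞) ≠ 0 := by simp; omega
  calc o.value F Θ H = ((n + B : ℕ) : ℝ≥0∞) / n * ((n : ℝ≥0∞) / (n + B : ℕ) * o.value F Θ H) := by
        rw [← mul_assoc]
        have : ((n + B : ℕ) : ℝ≥0∞) / n * ((n : ℝ≥0∞) / (n + B : ℕ)) = 1 := by
          rw [← ENNReal.inv_div (Or.inl (by simp)) (Or.inl hnB)]
          refine ENNReal.inv_mul_cancel ?_ ?_
          · exact ENNReal.div_ne_zero.2 ⟨hn', by simp⟩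
          · exact ENNReal.div_ne_top (by simp) hnB
        rw [this, one_mul]
    _ ≤ ENNReal.ofReal (1 + B / n) *
        ((n : ℝ≥0∞) / (B * (n / B + 1) : ℕ) * o.value F Θ H) := by
        rw [hc]; gcongr
    _ ≤ _ := by
        gcongr
        exact h1

variable (F) in
/-- A single batch is the problem of `Rgo`, so that `Rgo < ∞` bounds all the batch rates. -/
lemma RgoBatch_one_le (Θ : Set ℝ) (H : (Fin K → ℝ) → ℝ≥0∞) :
    RgoBatch F Θ H 1 ≤ Rgo F Θ H := by
  refine iSup_le fun o => ?_
  refine le_trans ?_ (le_iSup₂ (fun Q => o.alloc 0 fun _ => Q) fun Q => o.recommend fun _ => Q)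
  refine le_iInf₂ fun Q hQ => le_iInf₂ fun P hP => le_iInf fun hJ => ?_
  refine (iInf₂_le (fun _ => Q) fun _ => hQ).trans ((iInf₂_le P hP).trans
    ((iInf_le _ hJ).trans (le_of_eq ?_)))
  simp

variable (F) in
/-- The batch rates need not be monotone, but by `RgoBatch_le_mul` they converge to their infimum. -/
lemma tendsto_RgoBatch (Θ : Set ℝ) (H : (Fin K → ℝ) → ℝ≥0∞) :
    Tendsto (fun B : ℕ => RgoBatch F Θ H B) atTop (𝓝 (⨅ B : ℕ, RgoBatch F Θ H (B + 1))) := by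
  refine tendsto_order.2 ⟨fun a ha => ?_, fun a ha => ?_⟩
  · filter_upwards [eventually_gt_atTop 0] with n hn
    refine ha.trans_le ((iInf_le _ (n - 1)).trans (le_of_eq ?_))
    rw [Nat.sub_add_cancel hn]
  · obtain ⟨B, hB⟩ := iInf_lt_iff.1 ha
    have hlim : Tendsto (fun n : ℕ => ENNReal.ofReal (1 + ((B + 1 : ℕ) : ℝ) / n) *
        RgoBatch F Θ H (B + 1)) atTop (𝓝 (RgoBatch F Θ H (B + 1))) := by
      have h1 : Tendsto (fun n : ℕ => 1 + ((B + 1 : ℕ) : ℝ) / n) atTop (𝓝 (1 + 0)) :=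
        tendsto_const_nhds.add (tendsto_const_div_atTop_nhds_zero_nat _)
      have h2 := ENNReal.tendsto_ofReal h1
      have h3 := ENNReal.Tendsto.mul_const h2 (b := RgoBatch F Θ H (B + 1))
        (Or.inl (by simp))
      simpa using h3
    filter_upwards [hlim.eventually (gt_mem_nhds hB), eventually_gt_atTop 0] with n hn hpos
    exact (RgoBatch_le_mul F Θ H hpos (Nat.succ_pos B)).trans_lt hn

end BestArm

namespace BestArm

/-! ### The course of delayed optimal tracking -/

section Counting

variable {K : ℕ}

lemma exists_isRounding [NeZero K] : ∃ n : ℕ → (Fin K → ℝ) → Fin K → ℕ, IsRounding n := by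
  let m : ℕ → (Fin K → ℝ) → Fin K → ℕ := fun N r i => ⌈r i * ((N : ℝ) - K)⌉₊
  refine ⟨fun N r i => m N r i + if i = 0 then N - ∑ j, m N r j else 0, fun N r hr => ⟨fun i => ?_, ?_⟩⟩
  · push_cast
    have := Nat.le_ceil (r i * ((N : ℝ) - K))
    have h2 : (0 : ℝ) ≤ ((if i = 0 then N - ∑ j, m N r j else 0 : ℕ) : ℝ) := by positivity
    push_cast at h2
    exact this.trans (le_add_of_nonneg_right h2)
  · have hle : ∑ j, m N r j ≤ N := by
      rcases le_total N K with h | h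
      · have : ∀ j, m N r j = 0 := fun j => by
          refine Nat.ceil_eq_zero.2 (mul_nonpos_of_nonneg_of_nonpos (hr.1 j) ?_)
          rw [sub_nonpos]; exact_mod_cast h
        simp [this]
      · have h' : (0 : ℝ) ≤ (N : ℝ) - K := by rw [sub_nonneg]; exact_mod_cast h
        have h1 : ∀ j, (m N r j : ℝ) ≤ r j * ((N : ℝ) - K) + 1 := fun j =>
          (Nat.ceil_lt_add_one (mul_nonneg (hr.1 j) h')).le
        have h2 : (∑ j, (m N r j : ℝ)) ≤ N := by
          refine (Finset.sum_le_sum fun j _ => h1 j).trans ?_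
          rw [Finset.sum_add_distrib, ← Finset.sum_mul, hr.2]
          simp
        exact_mod_cast h2
    rw [Finset.sum_add_distrib, Finset.sum_ite_eq' Finset.univ (0 : Fin K), if_pos (Finset.mem_univ _)]
    omega

lemma armAt_eq [NeZero K] (n : Fin K → ℕ) {s : ℕ} {i : Fin K}
    (h1 : ∑ j ∈ Finset.Iio i, n j ≤ s) (h2 : s < ∑ j ∈ Finset.Iic i, n j) : armAt n s = i := by
  have hset : (Finset.univ.filter fun i' : Fin K => ∑ j ∈ Finset.Iic i', n j ≤ s) =
      Finset.Iio i := by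
    ext k
    simp only [Finset.mem_filter, Finset.mem_univ, true_and, Finset.mem_Iio]
    constructor
    · intro hk
      by_contra hik
      push Not at hik
      have : ∑ j ∈ Finset.Iic i, n j ≤ ∑ j ∈ Finset.Iic k, n j :=
        Finset.sum_le_sum_of_subset (Finset.Iic_subset_Iic.2 hik)
      omega
    · intro hk
      refine le_trans (Finset.sum_le_sum_of_subset fun j hj => ?_) h1
      rw [Finset.mem_Iic] at hj
      exact Finset.mem_Iio.2 (hj.trans_lt hk)
  unfold armAt
  rw [hset, Fin.card_Iio]
  exact Fin.ext (by simp)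

/-- In a batch with the numbers of draws `n` every arm `i` is drawn `n i` times. -/
lemma card_armAt [NeZero K] (n : Fin K → ℕ) (i : Fin K) :
    ((Finset.range (∑ j, n j)).filter fun s => armAt n s = i).card = n i := by
  have hle : ∀ i ∈ Finset.univ, n i ≤
      ((Finset.range (∑ j, n j)).filter fun s => armAt n s = i).card := fun i _ => by
    have hcard : (Finset.Ico (∑ j ∈ Finset.Iio i, n j) (∑ j ∈ Finset.Iic i, n j)).card = n i := by
      rw [Nat.card_Ico, ← Finset.Iio_insert, Finset.sum_insert (by simp)]
      omega
    rw [← hcard]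
    refine Finset.card_le_card fun s hs => ?_
    rw [Finset.mem_Ico] at hs
    have hsub : ∑ j ∈ Finset.Iic i, n j ≤ ∑ j, n j :=
      Finset.sum_le_sum_of_subset (Finset.subset_univ _)
    exact Finset.mem_filter.2 ⟨Finset.mem_range.2 (by omega), armAt_eq n hs.1 hs.2⟩
  -- the lower bounds for all arms add up to the length of the batch
  have hsum : ∑ i, n i =
      ∑ i, ((Finset.range (∑ j, n j)).filter fun s => armAt n s = i).card := by
    rw [← Finset.card_eq_sum_card_fiberwise (f := armAt n) (fun _ _ => Finset.mem_coe.2 (Finset.mem_univ _)),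
      Finset.card_range]
  exact ((Finset.sum_eq_sum_iff_of_le hle).1 hsum i (Finset.mem_univ i)).symm

/-- The rounds in batch `c` in which arm `i` is drawn, for `C` batches of `N` rounds and the
arms `a 0, a 1, …`. -/
def batchRounds (C N : ℕ) (a : ℕ → Fin K) (c : ℕ) (i : Fin K) : Finset ℕ :=
  (Finset.range (C * N)).filter fun s => s / N = c ∧ a s = i

lemma card_batchRounds [NeZero K] {C N c : ℕ} (hN : 0 < N) (hc : c < C) {a : ℕ → Fin K} {m : Fin K → ℕ}
    (hm : ∑ i, m i = N) (ha : ∀ s < C * N, s / N = c → a s = armAt m (s % N)) (i : Fin K) :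
    (batchRounds C N a c i).card = m i := by
  rw [← card_armAt m i, hm]
  refine (Finset.card_bij' (fun s _ => c * N + s) (fun s _ => s % N) ?_ ?_ ?_ ?_).symm
  · intro s hs
    rw [Finset.mem_filter, Finset.mem_range] at hs
    have hlt : c * N + s < C * N := by
      calc c * N + s < c * N + N := by omega
        _ = (c + 1) * N := by ring
        _ ≤ C * N := Nat.mul_le_mul_right _ hc
    have hdiv : (c * N + s) / N = c := by
      rw [Nat.mul_comm, Nat.mul_add_div hN, Nat.div_eq_of_lt hs.1, Nat.add_zero]
    have hmod : (c * N + s) % N = s := by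
      rw [Nat.mul_add_mod_self_right, Nat.mod_eq_of_lt hs.1]
    refine Finset.mem_filter.2 ⟨Finset.mem_range.2 hlt, hdiv, ?_⟩
    rw [ha _ hlt hdiv, hmod, hs.2]
  · intro s hs
    rw [batchRounds, Finset.mem_filter, Finset.mem_range] at hs
    refine Finset.mem_filter.2 ⟨Finset.mem_range.2 (Nat.mod_lt _ hN), ?_⟩
    rw [← ha s hs.1 hs.2.1, hs.2.2]
  · intro s hs
    rw [Finset.mem_filter, Finset.mem_range] at hs
    simp only [Nat.mul_add_mod_self_right, Nat.mod_eq_of_lt hs.1]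
  · intro s hs
    rw [batchRounds, Finset.mem_filter, Finset.mem_range] at hs
    rw [← hs.2.1]
    exact Nat.div_add_mod' s N

lemma batchMean_eq {C N c t : ℕ} (hN : 0 < N) (hc : c < C) (ht : (c + 1) * N ≤ t)
    (past : Fin t → Fin K × ℝ) (a : ℕ → Fin K) (y : ℕ → ℝ) (h : ∀ s, past s = (a s, y s))
    (i : Fin K) :
    batchMean N past c i =
      (∑ s ∈ batchRounds C N a c i, y s) / (batchRounds C N a c i).card := by
  have hset : batchRounds C N a c i = (Finset.univ.filter fun s : Fin t =>
      (s : ℕ) / N = c ∧ (past s).1 = i).map Fin.valEmbedding := by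
    ext s
    simp only [batchRounds, Finset.mem_filter, Finset.mem_range, Finset.mem_map, Finset.mem_univ,
      true_and, Fin.valEmbedding_apply]
    constructor
    · rintro ⟨_, h1, h2⟩
      have hs : s < t := by
        refine lt_of_lt_of_le ?_ ht
        rw [← h1, Nat.mul_comm]; exact Nat.lt_mul_div_succ s hN
      exact ⟨⟨s, hs⟩, ⟨h1, by rw [h]; exact h2⟩, rfl⟩
    · rintro ⟨s', ⟨h1, h2⟩, rfl⟩
      refine ⟨?_, h1, by rw [h] at h2; exact h2⟩
      refine lt_of_lt_of_le ?_ (Nat.mul_le_mul_right N (Nat.succ_le_of_lt hc))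
      rw [← h1, Nat.mul_comm]; exact Nat.lt_mul_div_succ _ hN
  unfold batchMean
  rw [hset, Finset.sum_map, Finset.card_map]
  congr 1
  refine Finset.sum_congr rfl fun s _ => ?_
  rw [h]; rfl

end Counting

section Stored

variable {K B : ℕ} (o : BatchOracle K B)

lemma stored_congr {q q' : ℕ → Fin K → ℝ} {m : ℕ} (h : ∀ c < K + m, q c = q' c) :
    stored o q m = stored o q' m := by
  induction m with
  | zero => funext _ i; simp only [stored]; rw [h i (by omega)]
  | succ m ih =>
    have e := ih fun c hc => h c (by omega)
    simp only [stored]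
    rw [e, h (K + m) (by omega)]

lemma dotCounts_congr (n : ℕ → (Fin K → ℝ) → Fin K → ℕ) (N : ℕ) {q q' : ℕ → Fin K → ℝ} {c : ℕ}
    (h : ∀ c' < c, q c' = q' c') : dotCounts o n N q c = dotCounts o n N q' c := by
  funext i
  unfold dotCounts
  split_ifs with hc
  · rfl
  · rfl
  · rw [stored_congr o fun c' hc' => h c' (by omega)]

lemma stored_apply (q : ℕ → Fin K → ℝ) (m : ℕ) (a : Fin (m + 1)) :
    stored o q m a = stored o q a (Fin.last a) := by
  induction m with
  | zero =>
    obtain rfl : a = 0 := Fin.ext (by omega)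
    rfl
  | succ m ih =>
    refine Fin.lastCases ?_ (fun j => ?_) a
    · rfl
    · rw [stored, Fin.snoc_castSucc]; exact ih j

/-- The mean that is stored before batch `K + m`. -/
def lastStored (q : ℕ → Fin K → ℝ) (m : ℕ) : Fin K → ℝ := stored o q m (Fin.last m)

lemma lastStored_succ (q : ℕ → Fin K → ℝ) (m : ℕ) (i : Fin K) :
    lastStored o q (m + 1) i = lastStored o q m i +
      (o.alloc m (stored o q m) : Fin K → ℝ) i * (q (K + m) i - lastStored o q m i) := by
  simp [lastStored, stored]

lemma alloc_nonneg (b : ℕ) (q : Fin (b + 1) → Fin K → ℝ) (i : Fin K) :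
    0 ≤ (o.alloc b q : Fin K → ℝ) i := (o.alloc b q).2.1 i

lemma alloc_le_one (b : ℕ) (q : Fin (b + 1) → Fin K → ℝ) (i : Fin K) :
    (o.alloc b q : Fin K → ℝ) i ≤ 1 := by
  rw [← (o.alloc b q).2.2]
  exact Finset.single_le_sum (fun j _ => (o.alloc b q).2.1 j) (Finset.mem_univ i)

lemma lastStored_mem (F : RewardFamily) {q : ℕ → Fin K → ℝ} (hq : ∀ c i, q c i ∈ F.means)
    (m : ℕ) (i : Fin K) : lastStored o q m i ∈ F.means := by
  induction m with
  | zero => exact hq i i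
  | succ m ih =>
    rw [lastStored_succ]
    exact mix_mem_means F ih (hq _ _) (alloc_nonneg o _ _ i) (alloc_le_one o _ _ i)

/-- The delayed updates never lose information: by convexity of the divergence, the information
`∑ r D(Q' ‖ P)` that the oracle would collect at the stored means is bounded by the information
that the batches deliver. -/
lemma sum_alloc_mul_kl_lastStored_le (F : RewardFamily) {q : ℕ → Fin K → ℝ}
    (hq : ∀ c i, q c i ∈ F.means) {P : Fin K → ℝ} (hP : ∀ i, P i ∈ F.means) (M : ℕ) (i : Fin K) :
    ∑ m ∈ Finset.range (M + 1), ENNReal.ofReal ((o.alloc m (stored o q m) : Fin K → ℝ) i) *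
        F.kl (lastStored o q m i) (P i) ≤
      F.kl (q i i) (P i) + ∑ m ∈ Finset.range M,
        ENNReal.ofReal ((o.alloc m (stored o q m) : Fin K → ℝ) i) * F.kl (q (K + m) i) (P i) := by
  obtain ⟨r, hr⟩ : ∃ r : ℕ → ℝ, ∀ m, r m = (o.alloc m (stored o q m) : Fin K → ℝ) i :=
    ⟨_, fun _ => rfl⟩
  simp only [← hr]
  have hr0 : ∀ m, 0 ≤ r m := fun m => hr m ▸ alloc_nonneg o _ _ i
  have hr1 : ∀ m, r m ≤ 1 := fun m => hr m ▸ alloc_le_one o _ _ i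
  have hstep : ∀ m, F.kl (lastStored o q (m + 1) i) (P i) ≤
      ENNReal.ofReal (1 - r m) * F.kl (lastStored o q m i) (P i) +
        ENNReal.ofReal (r m) * F.kl (q (K + m) i) (P i) := fun m => by
    rw [lastStored_succ, ← hr]
    exact kl_mix_le F (lastStored_mem o F hq m i) (hq _ _) (hP i) (hr0 m) (hr1 m)
  have key : ∀ M, F.kl (lastStored o q M i) (P i) + ∑ m ∈ Finset.range M,
      ENNReal.ofReal (r m) * F.kl (lastStored o q m i) (P i) ≤
      F.kl (q i i) (P i) + ∑ m ∈ Finset.range M,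
        ENNReal.ofReal (r m) * F.kl (q (K + m) i) (P i) := by
    intro M
    induction M with
    | zero => simp [lastStored, stored]
    | succ M ih =>
      rw [Finset.sum_range_succ, Finset.sum_range_succ]
      have h1 : ENNReal.ofReal (1 - r M) + ENNReal.ofReal (r M) = 1 := by
        rw [← ENNReal.ofReal_add (sub_nonneg.2 (hr1 M)) (hr0 M)]; simp
      calc _ ≤ (ENNReal.ofReal (1 - r M) * F.kl (lastStored o q M i) (P i) +
            ENNReal.ofReal (r M) * F.kl (q (K + M) i) (P i)) + _ := add_le_add_left (hstep M) _
        _ = ((ENNReal.ofReal (1 - r M) + ENNReal.ofReal (r M)) * F.kl (lastStored o q M i) (P i) +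
            ∑ m ∈ Finset.range M, ENNReal.ofReal (r m) * F.kl (lastStored o q m i) (P i)) +
            ENNReal.ofReal (r M) * F.kl (q (K + M) i) (P i) := by ring
        _ ≤ _ := by
            rw [h1, one_mul, ← add_assoc]
            exact add_le_add_left ih _
  rw [Finset.sum_range_succ, add_comm]
  refine le_trans (add_le_add_left ?_ _) (key M)
  exact mul_le_of_le_one_left' (by simpa using hr1 M)

lemma sum_dotCounts {n : ℕ → (Fin K → ℝ) → Fin K → ℕ} (hn : IsRounding n) (N : ℕ)
    (q : ℕ → Fin K → ℝ) (c : ℕ) : ∑ i, dotCounts o n N q c i = N := by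
  unfold dotCounts
  by_cases hc : c < K
  · simp only [hc, if_true]
    rw [Finset.sum_eq_single (⟨c, hc⟩ : Fin K)]
    · simp
    · intro i _ hi
      rw [if_neg]; intro h; exact hi (Fin.ext h)
    · simp
  · simp only [hc, if_false]
    exact (hn N _ (Subtype.prop _)).2

/-- If DOT errs under `P`, then the empirical means of its batches carry the information that the
value of the oracle requires. -/
lemma value_mul_le_sum_dotCounts (hB : 0 < B) (F : RewardFamily) {Θ : Set ℝ} (hΘ : Θ ⊆ F.means)
    (H : (Fin K → ℝ) → ℝ≥0∞) {n : ℕ → (Fin K → ℝ) → Fin K → ℕ} (hn : IsRounding n) (N : ℕ)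
    {q : ℕ → Fin K → ℝ} (hq : ∀ c i, q c i ∈ F.means) {P : Fin K → ℝ} (hP : ∀ i, P i ∈ Θ)
    (hHP : H P ≠ ⊤) (herr : (o.recommend fun b : Fin B => lastStored o q b) ∉ bestArms P) :
    o.value F Θ H * ((B : ℝ≥0∞) * (N - K : ℕ)) ≤
      H P * ∑ c ∈ Finset.range (B + K - 1), ∑ i, (dotCounts o n N q c i : ℝ≥0∞) *
        F.kl (q c i) (P i) := by
  have hP' : ∀ i, P i ∈ F.means := fun i => hΘ (hP i)
  have hB' : (B : ℝ≥0∞) ≠ 0 := by simpa using hB.ne'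
  have h1 : o.value F Θ H ≤ H P * ((∑ b ∈ Finset.range B, ∑ i,
      ENNReal.ofReal ((o.alloc b (stored o q b) : Fin K → ℝ) i) *
        F.kl (lastStored o q b i) (P i)) / (B : ℝ≥0∞)) := by
    refine (iInf₂_le (fun b : Fin B => lastStored o q b) fun (b : Fin B) i => lastStored_mem o F hq b.1 i).trans
      ((iInf₂_le P hP).trans ((iInf_le _ herr).trans (le_of_eq ?_)))
    rw [weigh, if_neg hHP, Finset.sum_range]
    congr 2
    refine Finset.sum_congr rfl fun b _ => ?_
    have : (fun a : Fin (b + 1) => lastStored o q (Fin.castLE b.isLt a)) = stored o q b :=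
      funext fun a => (stored_apply o q b a).symm
    rw [this]
  obtain ⟨M, rfl⟩ : ∃ M, B = M + 1 := ⟨B - 1, by omega⟩
  have hC : M + 1 + K - 1 = K + M := by omega
  rw [hC, Finset.sum_range_add]
  have hfirst : ∑ i : Fin K, ((N - K : ℕ) : ℝ≥0∞) * F.kl (q i i) (P i) ≤
      ∑ c ∈ Finset.range K, ∑ i, (dotCounts o n N q c i : ℝ≥0∞) * F.kl (q c i) (P i) := by
    rw [Finset.sum_range]
    refine Finset.sum_le_sum fun c _ => ?_
    refine le_trans ?_ (Finset.single_le_sum (f := fun i => (dotCounts o n N q c i : ℝ≥0∞) *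
      F.kl (q c i) (P i)) (fun _ _ => zero_le) (Finset.mem_univ c))
    have : dotCounts o n N q c c = N := by simp [dotCounts]
    simp only [this]
    gcongr
    omega
  have hrest : ∑ m ∈ Finset.range M, ∑ i, ((N - K : ℕ) : ℝ≥0∞) *
      (ENNReal.ofReal ((o.alloc m (stored o q m) : Fin K → ℝ) i) * F.kl (q (K + m) i) (P i)) ≤
      ∑ m ∈ Finset.range M, ∑ i, (dotCounts o n N q (K + m) i : ℝ≥0∞) *
        F.kl (q (K + m) i) (P i) := by
    refine Finset.sum_le_sum fun m _ => Finset.sum_le_sum fun i _ => ?_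
    rw [← mul_assoc]
    gcongr
    have hr := (hn N _ (o.alloc m (stored o q m)).2).1 i
    have e : dotCounts o n N q (K + m) i = n N (o.alloc m (stored o q m) : Fin K → ℝ) i := by
      have : ∀ m', m' = m → n N (o.alloc m' (stored o q m') : Fin K → ℝ) i =
          n N (o.alloc m (stored o q m) : Fin K → ℝ) i := by rintro _ rfl; rfl
      simp only [dotCounts, if_neg (show ¬K + m < K by omega)]
      exact this _ (Nat.add_sub_cancel_left K m)
    rw [e, ← ENNReal.ofReal_natCast, ← ENNReal.ofReal_natCast,
      ← ENNReal.ofReal_mul (by positivity)]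
    refine ENNReal.ofReal_le_ofReal ?_
    rcases le_total N K with h | h
    · rw [Nat.sub_eq_zero_of_le h]; simp
    · rw [Nat.cast_sub h, mul_comm]; exact hr
  have hsum : ((N - K : ℕ) : ℝ≥0∞) * (∑ b ∈ Finset.range (M + 1), ∑ i,
      ENNReal.ofReal ((o.alloc b (stored o q b) : Fin K → ℝ) i) *
        F.kl (lastStored o q b i) (P i)) ≤
      ∑ i : Fin K, ((N - K : ℕ) : ℝ≥0∞) * F.kl (q i i) (P i) +
      ∑ m ∈ Finset.range M, ∑ i, ((N - K : ℕ) : ℝ≥0∞) *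
      (ENNReal.ofReal ((o.alloc m (stored o q m) : Fin K → ℝ) i) * F.kl (q (K + m) i) (P i)) := by
    rw [Finset.sum_comm, Finset.sum_comm (s := Finset.range M), Finset.mul_sum,
      ← Finset.sum_add_distrib]
    refine Finset.sum_le_sum fun i _ => ?_
    rw [← Finset.mul_sum, ← mul_add]
    gcongr
    exact sum_alloc_mul_kl_lastStored_le o F hq hP' M i
  calc _ ≤ (H P * ((∑ b ∈ Finset.range (M + 1), ∑ i,
      ENNReal.ofReal ((o.alloc b (stored o q b) : Fin K → ℝ) i) *
        F.kl (lastStored o q b i) (P i)) / ((M + 1 : ℕ) : ℝ≥0∞))) *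
          (((M + 1 : ℕ) : ℝ≥0∞) * (N - K : ℕ)) := by gcongr
    _ = H P * (((N - K : ℕ) : ℝ≥0∞) * (∑ b ∈ Finset.range (M + 1), ∑ i,
      ENNReal.ofReal ((o.alloc b (stored o q b) : Fin K → ℝ) i) *
        F.kl (lastStored o q b i) (P i))) * ((((M + 1 : ℕ) : ℝ≥0∞))⁻¹ * ((M + 1 : ℕ) : ℝ≥0∞)) := by
        rw [div_eq_mul_inv]; ring
    _ ≤ _ := by
        rw [ENNReal.inv_mul_cancel hB' (by simp), mul_one]
        gcongr
        exact hsum.trans (add_le_add hfirst hrest)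

end Stored

end BestArm

namespace BestArm

/-! ### The error probability of delayed optimal tracking -/

variable {K : ℕ}

/-- Products of test functions along a deterministic sequence of arms, obtained as the special case
of an algorithm that ignores its observations. -/
lemma lintegral_prod_le_one (ρ : ℕ × Fin K → Measure ℝ) [∀ x, IsProbabilityMeasure (ρ x)]
    (a : ℕ → Fin K) {w : ℕ → Fin K → ℝ → ℝ≥0∞} (hw : ∀ s i, Measurable (w s i)) (t : ℕ)
    (h : ∀ s < t, ∀ i, ∫⁻ y, w s i y ∂(ρ (s, i)) ≤ 1) :
    ∫⁻ x, ∏ s ∈ Finset.range t, w s (a s) (x.2 (s, a s)) ∂(interactionMeasure ρ) ≤ 1 := by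
  -- the algorithm that draws the arms `a 0, a 1, …` whatever it observes
  let π : Policy K 0 := ⟨fun t _ _ => a t, fun _ _ => a 0⟩
  have hπ : π.IsMeasurable := ⟨fun _ => measurable_const, measurable_const⟩
  refine le_trans (le_of_eq (lintegral_congr fun x => ?_))
    (lintegral_historyProd_le_one ρ hπ hw t h)
  rw [historyProd, Finset.prod_range]
  refine Finset.prod_congr rfl fun s _ => ?_
  rw [Policy.history_apply]
  rfl

lemma ae_interactionMeasure (ρ : ℕ × Fin K → Measure ℝ) [∀ x, IsProbabilityMeasure (ρ x)]
    {p : ℕ × Fin K → ℝ → Prop} (h : ∀ s, ∀ᵐ y ∂(ρ s), p s y) :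
    ∀ᵐ x ∂(interactionMeasure ρ), ∀ s, p s (x.2 s) := by
  rw [ae_all_iff]
  intro s
  have h1 : ∀ᵐ Y ∂(Measure.infinitePi ρ), p s (Y s) :=
    (measurePreserving_eval_infinitePi ρ s).quasiMeasurePreserving.ae (h s)
  exact (measurePreserving_snd (μ := (volume : Measure unitInterval))
    (ν := Measure.infinitePi ρ)).quasiMeasurePreserving.ae h1

/-- The divergence of the empirical means may be infinite; the test functions only see it truncated
at a level `L`, which loses nothing for a total information of at most `L`. -/
lemma le_sum_toReal_min {ι : Type*} (s : Finset ι) (X : ι → ℝ≥0∞) {L : ℕ} {A : ℝ} (hAL : A ≤ L)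
    (h : ENNReal.ofReal A ≤ ∑ i ∈ s, X i) : A ≤ ∑ i ∈ s, (min (L : ℝ≥0∞) (X i)).toReal := by
  have hne : ∀ i, min (L : ℝ≥0∞) (X i) ≠ ⊤ := fun i =>
    ne_top_of_le_ne_top (ENNReal.natCast_ne_top L) (min_le_left _ _)
  by_cases hex : ∃ i ∈ s, (L : ℝ≥0∞) ≤ X i
  · obtain ⟨i, hi, hLi⟩ := hex
    refine hAL.trans (le_trans (le_of_eq ?_) (Finset.single_le_sum
      (f := fun i => (min (L : ℝ≥0∞) (X i)).toReal) (fun _ _ => ENNReal.toReal_nonneg) hi))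
    simp only [min_eq_left hLi, ENNReal.toReal_natCast]
  · push Not at hex
    rw [← ENNReal.toReal_sum fun i _ => hne i]
    have e : ∑ i ∈ s, min (L : ℝ≥0∞) (X i) = ∑ i ∈ s, X i :=
      Finset.sum_congr rfl fun i hi => min_eq_right (hex i hi).le
    refine (ENNReal.ofReal_le_iff_le_toReal (by
      rw [ENNReal.sum_ne_top]; exact fun i _ => hne i)).1 ?_
    rwa [e]

/-- The extension by `0` of a function of finitely many batches. The finitely many functions of
this kind index the events of the union bound. -/
def extendCounts {C M : ℕ} (ν : Fin C → Fin K → Fin M) (c : ℕ) (i : Fin K) : ℕ :=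
  if h : c < C then (ν ⟨c, h⟩ i : ℕ) else 0

lemma exists_extendCounts_eq {C M : ℕ} (f : ℕ → Fin K → ℕ) (h : ∀ c < C, ∀ i, f c i < M) :
    ∃ ν : Fin C → Fin K → Fin M, ∀ c < C, ∀ i, extendCounts ν c i = f c i :=
  ⟨fun c i => ⟨f c i, h c c.isLt i⟩, fun c hc i => by simp [extendCounts, hc]⟩

lemma batchMean_mem_means (F : RewardFamily) {t : ℕ} (N : ℕ) (past : Fin t → Fin K × ℝ)
    (h : ∀ s, (past s).2 ∈ F.values) (c : ℕ) (i : Fin K) : batchMean N past c i ∈ F.means :=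
  mean_mem_means F _ _ fun s _ => h s

variable [NeZero K] {B : ℕ} (o : BatchOracle K B)

/-- The arms drawn by DOT are determined by the numbers of draws in the batches. -/
lemma arm_dot (n : ℕ → (Fin K → ℝ) → Fin K → ℕ) {T C N : ℕ} (hC : C = B + K - 1) (hNT : N = T / C)
    (hN : 0 < N) (u : unitInterval) (Y : ℕ × Fin K → ℝ) {t : ℕ} (ht : t < C * N) :
    (dot o n T).arm u Y t =
      armAt (dotCounts o n N (batchMean N ((dot o n T).history u Y T)) (t / N)) (t % N) := by
  have hCN : C * N ≤ T := hNT ▸ Nat.mul_div_le T C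
  have htC : t / N < C := Nat.div_lt_of_lt_mul (by rwa [Nat.mul_comm])
  have e : (dot o n T).arm u Y t =
      armAt (dotCounts o n N (batchMean N ((dot o n T).history u Y t)) (t / N)) (t % N) := by
    subst hNT hC
    exact if_pos ht
  rw [e, dotCounts_congr o n N fun c hc => ?_]
  funext i
  have hct : (c + 1) * N ≤ t := by
    calc (c + 1) * N ≤ (t / N) * N := Nat.mul_le_mul_right N hc
      _ ≤ t := Nat.div_mul_le_self t N
  rw [batchMean_eq hN (hc.trans htC) hct _ (fun s => (dot o n T).arm u Y s)
      (fun s => Y (s, (dot o n T).arm u Y s)) (fun s => Policy.history_apply _ _ _ _ s) i,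
    batchMean_eq hN (hc.trans htC) (hct.trans (ht.le.trans hCN)) _ (fun s => (dot o n T).arm u Y s)
      (fun s => Y (s, (dot o n T).arm u Y s)) (fun s => Policy.history_apply _ _ _ _ s) i]

/-- An error of DOT forces one of finitely many products of test functions to be large: `ν` is the
numbers of draws in the batches, which determine the arms in all rounds, and `η` is the choice of
a test function for every batch and arm. -/
lemma exists_testProd_of_error (hB : 0 < B) (F : RewardFamily) {Θ : Set ℝ} (hΘ : Θ ⊆ F.means)
    (H : (Fin K → ℝ) → ℝ≥0∞) {n : ℕ → (Fin K → ℝ) → Fin K → ℕ} (hn : IsRounding n)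
    {P : Fin K → ℝ} (hP : ∀ i, P i ∈ Θ) (hH0 : H P ≠ 0) (hHP : H P ≠ ⊤) {α : ℝ}
    (hα0 : 0 ≤ α) (hα : ENNReal.ofReal α * H P ≤ o.value F Θ H)
    {T C N L : ℕ} (hC : C = B + K - 1) (hNT : N = T / C) (hN : 0 < N)
    (hL : α * B * (N - K : ℕ) ≤ L)
    {W : Fin K → ℕ → ℕ → ℝ → ℝ≥0∞}
    (hW : ∀ i m (S : Finset ℕ) (y : ℕ → ℝ), S.card = m → (∀ t ∈ S, y t ∈ F.values) →
        ∃ j < 2 * (m + L + 1), ENNReal.ofReal (Real.exp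
          ((min (L : ℝ≥0∞) (m * F.kl ((∑ t ∈ S, y t) / m) (P i))).toReal - 1)) ≤
            ∏ t ∈ S, W i m j (y t))
    (u : unitInterval) (Y : ℕ × Fin K → ℝ) (hY : ∀ s, Y s ∈ F.values)
    (herr : (dot o n T).recommend u ((dot o n T).history u Y T) ∉ bestArms P) :
    ∃ (ν : Fin C → Fin K → Fin (N + 1)) (η : Fin C → Fin K → Fin (2 * (N + L + 1))),
      ENNReal.ofReal (Real.exp (α * B * (N - K : ℕ) - C * K)) ≤
        ∏ t ∈ Finset.range (C * N),
          W (armAt (extendCounts ν (t / N)) (t % N))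
            (extendCounts ν (t / N) (armAt (extendCounts ν (t / N)) (t % N)))
            (extendCounts η (t / N) (armAt (extendCounts ν (t / N)) (t % N)))
            (Y (t, armAt (extendCounts ν (t / N)) (t % N))) := by
  have hCN : C * N ≤ T := hNT ▸ Nat.mul_div_le T C
  obtain ⟨a, ha⟩ : ∃ a : ℕ → Fin K, a = fun s => (dot o n T).arm u Y s := ⟨_, rfl⟩
  obtain ⟨q, hq⟩ : ∃ q, q = batchMean N ((dot o n T).history u Y T) := ⟨_, rfl⟩
  obtain ⟨m, hm⟩ : ∃ m, m = dotCounts o n N q := ⟨_, rfl⟩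
  have hsum : ∀ c, ∑ i, m c i = N := fun c => hm ▸ sum_dotCounts o hn N q c
  have hmle : ∀ c i, m c i ≤ N := fun c i => by
    rw [← hsum c]; exact Finset.single_le_sum (fun _ _ => Nat.zero_le _) (Finset.mem_univ i)
  have harm : ∀ t < C * N, a t = armAt (m (t / N)) (t % N) := fun t ht => by
    rw [ha, hm, hq]; exact arm_dot o n hC hNT hN u Y ht
  have hcard : ∀ c < C, ∀ i, (batchRounds C N a c i).card = m c i := fun c hc i =>
    card_batchRounds hN hc (hsum c) (fun s hs hsc => by rw [harm s hs, hsc]) i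
  have hqm : ∀ c i, q c i ∈ F.means := fun c i => by
    rw [hq]
    exact batchMean_mem_means F N _ (fun s => by rw [Policy.history_apply]; exact hY _) c i
  have hmean : ∀ c < C, ∀ i, q c i = (∑ s ∈ batchRounds C N a c i, Y (s, i)) / (m c i : ℝ) := by
    intro c hc i
    have hct : (c + 1) * N ≤ T := (Nat.mul_le_mul_right N hc).trans hCN
    rw [hq, batchMean_eq hN hc hct _ a (fun s => Y (s, a s))
      (fun s => by rw [ha]; exact Policy.history_apply _ _ _ _ s) i, hcard c hc]
    congr 1
    refine Finset.sum_congr rfl fun s hs => ?_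
    rw [(Finset.mem_filter.1 hs).2.2]
  have hinfo := value_mul_le_sum_dotCounts o hB F hΘ H hn N hqm hP hHP
    (by rw [hq]; subst hC hNT; exact herr)
  rw [← hm, ← hC] at hinfo
  have hA : ENNReal.ofReal (α * B * (N - K : ℕ)) ≤
      ∑ p ∈ Finset.range C ×ˢ (Finset.univ : Finset (Fin K)),
        (m p.1 p.2 : ℝ≥0∞) * F.kl (q p.1 p.2) (P p.2) := by
    rw [Finset.sum_product]
    refine (ENNReal.mul_le_mul_iff_right hH0 hHP).1 (le_trans ?_ hinfo)
    calc _ = (ENNReal.ofReal α * H P) * ((B : ℝ≥0∞) * (N - K : ℕ)) := by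
          rw [ENNReal.ofReal_mul (by positivity), ENNReal.ofReal_mul hα0, ENNReal.ofReal_natCast,
            ENNReal.ofReal_natCast]
          ring
      _ ≤ _ := by gcongr
  have hA' := le_sum_toReal_min _ _ hL hA
  -- the test function of each block
  choose! η hη hηle using fun (c : ℕ) (hc : c < C) (i : Fin K) =>
    hW i (m c i) (batchRounds C N a c i) (fun s => Y (s, i)) (hcard c hc i) (fun s _ => hY _)
  obtain ⟨ν', hν'⟩ := exists_extendCounts_eq (C := C) (M := N + 1) m
    fun c _ i => Nat.lt_succ_of_le (hmle c i)
  obtain ⟨η', hη'⟩ := exists_extendCounts_eq (C := C) (M := 2 * (N + L + 1)) η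
    fun c hc i => (hη c hc i).trans_le (by have := hmle c i; omega)
  refine ⟨ν', η', ?_⟩
  have hprod : ∏ t ∈ Finset.range (C * N),
          W (armAt (extendCounts ν' (t / N)) (t % N))
            (extendCounts ν' (t / N) (armAt (extendCounts ν' (t / N)) (t % N)))
            (extendCounts η' (t / N) (armAt (extendCounts ν' (t / N)) (t % N)))
            (Y (t, armAt (extendCounts ν' (t / N)) (t % N))) =
      ∏ p ∈ Finset.range C ×ˢ (Finset.univ : Finset (Fin K)),
        ∏ t ∈ batchRounds C N a p.1 p.2, W p.2 (m p.1 p.2) (η p.1 p.2) (Y (t, p.2)) := by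
    rw [← Finset.prod_fiberwise_of_maps_to (g := fun t => (t / N, a t))
      (t := Finset.range C ×ˢ (Finset.univ : Finset (Fin K)))]
    · refine Finset.prod_congr rfl fun p hp => ?_
      have hpC : p.1 < C := by simpa using hp
      have hset : (Finset.range (C * N)).filter (fun t => (t / N, a t) = p) =
          batchRounds C N a p.1 p.2 := by
        ext t; simp [batchRounds, Prod.ext_iff]
      rw [hset]
      refine Finset.prod_congr rfl fun t ht => ?_
      obtain ⟨ht1, ht2, ht3⟩ := Finset.mem_filter.1 ht
      have e : extendCounts ν' (t / N) = m (t / N) :=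
        funext fun i => hν' _ (by rw [ht2]; exact hpC) i
      have e2 : armAt (m (t / N)) (t % N) = p.2 := by
        rw [← harm t (Finset.mem_range.1 ht1), ht3]
      rw [e, e2, hη' _ (by rw [ht2]; exact hpC), ht2]
    · intro t ht
      have : t / N < C := Nat.div_lt_of_lt_mul (by rw [Nat.mul_comm]; exact Finset.mem_range.1 ht)
      simp [this]
  rw [hprod]
  calc _ ≤ ENNReal.ofReal (Real.exp (∑ p ∈ Finset.range C ×ˢ (Finset.univ : Finset (Fin K)),
          ((min (L : ℝ≥0∞) ((m p.1 p.2 : ℝ≥0∞) * F.kl (q p.1 p.2) (P p.2))).toReal - 1))) := by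
        refine ENNReal.ofReal_le_ofReal (Real.exp_le_exp.2 ?_)
        rw [Finset.sum_sub_distrib]
        simp only [Finset.sum_const, Finset.card_product, Finset.card_range, Finset.card_univ,
          Fintype.card_fin, nsmul_eq_mul, mul_one]
        push_cast at hA' ⊢
        linarith
    _ = ∏ p ∈ Finset.range C ×ˢ (Finset.univ : Finset (Fin K)), ENNReal.ofReal (Real.exp
          ((min (L : ℝ≥0∞) ((m p.1 p.2 : ℝ≥0∞) * F.kl (q p.1 p.2) (P p.2))).toReal - 1)) := by
        rw [Real.exp_sum, ENNReal.ofReal_prod_of_nonneg fun _ _ => (Real.exp_pos _).le]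
    _ ≤ _ := by
        refine Finset.prod_le_prod' fun p hp => ?_
        have hpC : p.1 < C := by simpa using hp
        rw [hmean p.1 hpC]
        exact hηle p.1 hpC p.2

/-- The number of test products is polynomial in the budget, and Markov's inequality applies to
each of them. DOT need not be measurable: the bound holds for the outer measure. -/
lemma errorProb_dot_le (hB : 0 < B) (F : RewardFamily) {Θ : Set ℝ} (hΘ : Θ ⊆ F.means)
    (H : (Fin K → ℝ) → ℝ≥0∞) {n : ℕ → (Fin K → ℝ) → Fin K → ℕ} (hn : IsRounding n)
    {P : Fin K → ℝ} (hP : ∀ i, P i ∈ Θ) (hH0 : H P ≠ 0) (hHP : H P ≠ ⊤) {α : ℝ}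
    (hα0 : 0 ≤ α) (hα : ENNReal.ofReal α * H P ≤ o.value F Θ H)
    {T C N L : ℕ} (hC : C = B + K - 1) (hNT : N = T / C) (hN : 0 < N)
    (hL : α * B * (N - K : ℕ) ≤ L) :
    (dot o n T).errorProb F P ≤ ENNReal.ofReal ((((N + 1 : ℕ) : ℝ) ^ K) ^ C *
      (((2 * (N + L + 1) : ℕ) : ℝ) ^ K) ^ C * Real.exp (C * K - α * B * (N - K : ℕ))) := by
  choose W hWm hW1 hW using fun (i : Fin K) (m : ℕ) => exists_testFunctions F (hΘ (hP i)) m L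
  obtain ⟨G, hG⟩ : ∃ G : (Fin C → Fin K → Fin (N + 1)) →
      (Fin C → Fin K → Fin (2 * (N + L + 1))) → (unitInterval × (ℕ × Fin K → ℝ)) → ℝ≥0∞,
      G = fun ν η x => ∏ t ∈ Finset.range (C * N),
          W (armAt (extendCounts ν (t / N)) (t % N))
            (extendCounts ν (t / N) (armAt (extendCounts ν (t / N)) (t % N)))
            (extendCounts η (t / N) (armAt (extendCounts ν (t / N)) (t % N)))
            (x.2 (t, armAt (extendCounts ν (t / N)) (t % N))) := ⟨_, rfl⟩
  obtain ⟨x0, hx0⟩ : ∃ x0 : ℝ, x0 = α * B * (N - K : ℕ) - C * K := ⟨_, rfl⟩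
  have hGm : ∀ ν η, Measurable (G ν η) := fun ν η => by
    rw [hG]
    refine Finset.measurable_prod _ fun t _ => (hWm _ _ _).comp ?_
    exact (measurable_pi_apply _).comp measurable_snd
  have hmarkov : ∀ ν η, interactionMeasure (fun x : ℕ × Fin K => F.law (P x.2))
      {x | ENNReal.ofReal (Real.exp x0) ≤ G ν η x} ≤ ENNReal.ofReal (Real.exp (-x0)) := by
    intro ν η
    have h1 := mul_meas_ge_le_lintegral (μ := interactionMeasure
      (fun x : ℕ × Fin K => F.law (P x.2))) (hGm ν η) (ENNReal.ofReal (Real.exp x0))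
    have h2 : ∫⁻ x, G ν η x ∂(interactionMeasure (fun x : ℕ × Fin K => F.law (P x.2))) ≤ 1 := by
      rw [hG]
      exact lintegral_prod_le_one (fun x : ℕ × Fin K => F.law (P x.2))
        (fun t => armAt (extendCounts ν (t / N)) (t % N))
        (w := fun t i => W i (extendCounts ν (t / N) i) (extendCounts η (t / N) i))
        (fun _ _ => hWm _ _ _) (C * N) fun t _ i => hW1 _ _ _
    rw [Real.exp_neg, ENNReal.ofReal_inv_of_pos (Real.exp_pos _),
      ENNReal.le_inv_iff_mul_le, mul_comm]
    exact h1.trans h2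
  have hsub : ∀ᵐ x ∂(interactionMeasure (fun x : ℕ × Fin K => F.law (P x.2))),
      (dot o n T).recommend x.1 ((dot o n T).history x.1 x.2 T) ∉ bestArms P →
        ∃ ν η, ENNReal.ofReal (Real.exp x0) ≤ G ν η x := by
    filter_upwards [ae_interactionMeasure (fun x : ℕ × Fin K => F.law (P x.2))
      (p := fun _ y => y ∈ F.values) fun s => ae_mem_values F (hΘ (hP s.2))] with x hx herr
    rw [hG, hx0]
    exact exists_testProd_of_error o hB F hΘ H hn hP hH0 hHP hα0 hα hC hNT hN hL hW x.1 x.2 hx herr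
  calc (dot o n T).errorProb F P
      ≤ interactionMeasure (fun x : ℕ × Fin K => F.law (P x.2))
          (⋃ ν, ⋃ η, {x | ENNReal.ofReal (Real.exp x0) ≤ G ν η x}) := by
        refine measure_mono_ae ?_
        filter_upwards [hsub] with x hx herr
        obtain ⟨ν, η, h⟩ := hx herr
        exact Set.mem_iUnion.2 ⟨ν, Set.mem_iUnion.2 ⟨η, h⟩⟩
    _ ≤ ∑ ν, ∑ η, interactionMeasure (fun x : ℕ × Fin K => F.law (P x.2))
          {x | ENNReal.ofReal (Real.exp x0) ≤ G ν η x} := by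
        refine (measure_iUnion_fintype_le _ _).trans (Finset.sum_le_sum fun ν _ => ?_)
        exact measure_iUnion_fintype_le _ _
    _ ≤ ∑ ν : Fin C → Fin K → Fin (N + 1), ∑ η : Fin C → Fin K → Fin (2 * (N + L + 1)),
          ENNReal.ofReal (Real.exp (-x0)) :=
        Finset.sum_le_sum fun ν _ => Finset.sum_le_sum fun η _ => hmarkov ν η
    _ = _ := by
        simp only [Finset.sum_const, Finset.card_univ, Fintype.card_fun, Fintype.card_fin,
          nsmul_eq_mul]
        rw [ENNReal.ofReal_mul (by positivity), ENNReal.ofReal_mul (by positivity), mul_assoc,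
          ENNReal.ofReal_pow (by positivity), ENNReal.ofReal_pow (by positivity),
          ENNReal.ofReal_pow (by positivity), ENNReal.ofReal_pow (by positivity),
          ENNReal.ofReal_natCast, ENNReal.ofReal_natCast, hx0, neg_sub]
        push_cast
        rfl

end BestArm

namespace BestArm

/-! ### The rate of delayed optimal tracking -/

lemma ofReal_le_of_forall_lt {x : ℝ} {y : ℝ≥0∞} (h : ∀ c < x, ENNReal.ofReal c ≤ y) :
    ENNReal.ofReal x ≤ y := by
  have ht : Tendsto ENNReal.ofReal (𝓝[<] x) (𝓝 (ENNReal.ofReal x)) :=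
    (ENNReal.continuous_ofReal.tendsto x).mono_left nhdsWithin_le_nhds
  exact le_of_tendsto ht (eventually_mem_nhdsWithin.mono fun c hc => h c hc)

lemma eventually_mul_pow_le_exp (κ : ℝ) (p : ℕ) {δ : ℝ} (hδ : 0 < δ) :
    ∀ᶠ T : ℕ in atTop, κ * (T : ℝ) ^ p ≤ Real.exp (δ * T) := by
  have h1 : (fun x : ℝ => κ * x ^ p) =o[atTop] fun x => Real.exp (δ * x) :=
    (isLittleO_pow_exp_pos_mul_atTop p hδ).const_mul_left κ
  have h2 := (h1.bound one_pos).natCast_atTop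
  filter_upwards [h2] with T hT
  rw [Real.norm_eq_abs, Real.norm_eq_abs, one_mul, Real.abs_exp] at hT
  exact (le_abs_self _).trans hT

variable {K : ℕ} [NeZero K] {B : ℕ} (o : BatchOracle K B)

/-- The rate of DOT is the value of its oracle up to the factor `B / (B + K - 1)`, which is lost
because of the `K - 1` additional batches. -/
lemma mul_value_le_worstRate_dot (hB : 0 < B) (F : RewardFamily) {Θ : Set ℝ} (hΘ : Θ ⊆ F.means)
    (H : (Fin K → ℝ) → ℝ≥0∞) (hH : ∀ P : Fin K → ℝ, (∀ i, P i ∈ Θ) → 0 < H P)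
    {n : ℕ → (Fin K → ℝ) → Fin K → ℕ} (hn : IsRounding n) (hV : o.value F Θ H ≠ ⊤) :
    ENNReal.ofReal (B / (B + K - 1 : ℕ)) * o.value F Θ H ≤
      worstRate F Θ H fun T => dot o n T := by
  refine le_iInf₂ fun P hP => ?_
  by_cases hHP : H P = ⊤
  · rw [weigh, if_pos hHP]; exact le_top
  rw [weigh, if_neg hHP]
  have hH0 : H P ≠ 0 := (hH P hP).ne'
  obtain ⟨C, hC⟩ : ∃ C, C = B + K - 1 := ⟨_, rfl⟩
  have hCpos : 0 < C := by have := NeZero.pos K; omega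
  have hC' : (0 : ℝ) < C := by exact_mod_cast hCpos
  rw [← hC]
  -- the exponent that the value of the oracle demands at `P`
  obtain ⟨α, hα⟩ : ∃ α, α = (o.value F Θ H / H P).toReal := ⟨_, rfl⟩
  have hα0 : 0 ≤ α := hα ▸ ENNReal.toReal_nonneg
  have hαV : ENNReal.ofReal α * H P = o.value F Θ H := by
    rw [hα, ENNReal.ofReal_toReal (ENNReal.div_ne_top hV hH0), ENNReal.div_mul_cancel hH0 hHP]
  rw [← hαV, ← mul_assoc, ← ENNReal.ofReal_mul (by positivity), mul_comm (H P)]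
  gcongr
  refine ofReal_le_of_forall_lt fun c hc => le_errorExponent ?_
  -- `κ T` bounds the numbers of choices per batch and arm
  obtain ⟨κ, hκ⟩ : ∃ κ : ℝ, κ = 2 * (3 + α * B) := ⟨_, rfl⟩
  have hκ0 : 0 ≤ κ := hκ ▸ by positivity
  have hδ : 0 < B / C * α - c := sub_pos.2 hc
  filter_upwards [eventually_mul_pow_le_exp
      ((κ ^ (K * C)) * (κ ^ (K * C)) * Real.exp (C * K + α * B * (1 + K))) (2 * (K * C)) hδ,
    eventually_ge_atTop C] with T hT hTC
  have hT1 : (1 : ℝ) ≤ T := by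
    have : 1 ≤ T := by omega
    exact_mod_cast this
  have hN : 0 < T / C := Nat.div_pos hTC hCpos
  have hNT : ((T / C : ℕ) : ℝ) ≤ T := by exact_mod_cast Nat.div_le_self T C
  obtain ⟨L, hL⟩ : ∃ L, L = ⌈α * B * T⌉₊ := ⟨_, rfl⟩
  have hsub : ((T / C - K : ℕ) : ℝ) ≤ T :=
    le_trans (by exact_mod_cast Nat.sub_le _ _) hNT
  have hαB : 0 ≤ α * B := by positivity
  have hLA : α * B * (T / C - K : ℕ) ≤ L :=
    (mul_le_mul_of_nonneg_left hsub hαB).trans (hL ▸ Nat.le_ceil _)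
  have hLle : (L : ℝ) ≤ α * B * T + 1 := by
    rw [hL]; exact (Nat.ceil_lt_add_one (by positivity)).le
  refine (errorProb_dot_le o hB F hΘ H hn hP hH0 hHP hα0 hαV.le hC rfl hN hLA).trans
    (ENNReal.ofReal_le_ofReal ?_)
  have h1 : (((T / C + 1 : ℕ) : ℝ)) ≤ κ * T := by
    push_cast [hκ]
    nlinarith
  have h2 : ((2 * (T / C + L + 1) : ℕ) : ℝ) ≤ κ * T := by
    push_cast [hκ]
    nlinarith
  have hdiv : (T : ℝ) / C - 1 ≤ ((T / C : ℕ) : ℝ) := by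
    have h := Nat.lt_mul_div_succ T hCpos
    have h' : (T : ℝ) < C * ((T / C : ℕ) + 1) := by exact_mod_cast h
    rw [sub_le_iff_le_add, div_le_iff₀ hC']
    linarith
  have h3 : (T : ℝ) / C - 1 - K ≤ ((T / C - K : ℕ) : ℝ) := by
    have : ((T / C : ℕ) : ℝ) ≤ ((T / C - K : ℕ) : ℝ) + K := by
      have h : T / C ≤ T / C - K + K := by omega
      exact_mod_cast h
    linarith
  have h4 : C * K - α * B * ((T / C - K : ℕ) : ℝ) ≤
      (C * K + α * B * (1 + K)) + -(B / C * α * T) := by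
    have := mul_le_mul_of_nonneg_left h3 hαB
    have e : α * B * ((T : ℝ) / C - 1 - K) = B / C * α * T - α * B * (1 + K) := by
      field_simp; ring
    linarith
  rw [← pow_mul, ← pow_mul]
  calc _ ≤ (κ * T) ^ (K * C) * (κ * T) ^ (K * C) *
        Real.exp ((C * K + α * B * (1 + K)) + -(B / C * α * T)) := by gcongr
    _ = ((κ ^ (K * C)) * (κ ^ (K * C)) * Real.exp (C * K + α * B * (1 + K)) *
          (T : ℝ) ^ (2 * (K * C))) * Real.exp (-(B / C * α * T)) := by
        rw [Real.exp_add, mul_pow, two_mul (K * C), pow_add]; ring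
    _ ≤ Real.exp ((B / C * α - c) * T) * Real.exp (-(B / C * α * T)) := by gcongr
    _ = Real.exp (-(c * T)) := by rw [← Real.exp_add]; congr 1; ring

end BestArm

namespace BestArm

/-! ### A lower bound for the error probability by change of measure -/

variable {K : ℕ}

section ChangeOfMeasure

variable {T : ℕ} {π : Policy K T} (ρ ρ' : ℕ × Fin K → Measure ℝ)
  [∀ x, IsProbabilityMeasure (ρ x)] [∀ x, IsProbabilityMeasure (ρ' x)]

lemma indicator_history (t : ℕ) (G : Set (unitInterval × (Fin t → Fin K × ℝ)))
    (z : unitInterval × (ℕ × Fin K → ℝ)) :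
    G.indicator (1 : unitInterval × (Fin t → Fin K × ℝ) → ℝ≥0∞) (z.1, π.history z.1 z.2 t) =
      Set.indicator {z | (z.1, π.history z.1 z.2 t) ∈ G} 1 z := by
  by_cases hz : (z.1, π.history z.1 z.2 t) ∈ G <;> simp [hz]

/-- An event on which the likelihood ratio is at most `r` is at most `r` times as likely under `ρ`
as under `ρ'`. -/
lemma interactionMeasure_le_mul (hπ : π.IsMeasurable) {ℓ : ℕ → Fin K → ℝ → ℝ≥0∞}
    (hℓ : ∀ s i, Measurable (ℓ s i)) (t : ℕ)
    (h : ∀ s < t, ∀ i, ρ (s, i) = (ρ' (s, i)).withDensity (ℓ s i))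
    {G : Set (unitInterval × (Fin t → Fin K × ℝ))} (hG : MeasurableSet G) {r : ℝ≥0∞}
    (hr : ∀ w ∈ G, historyProd ℓ t w.2 ≤ r) :
    interactionMeasure ρ {z | (z.1, π.history z.1 z.2 t) ∈ G} ≤
      r * interactionMeasure ρ' {z | (z.1, π.history z.1 z.2 t) ∈ G} := by
  have hzm : Measurable fun z : unitInterval × (ℕ × Fin K → ℝ) => (z.1, π.history z.1 z.2 t) :=
    measurable_fst.prodMk (hπ.history t)
  have hU : MeasurableSet {z : unitInterval × (ℕ × Fin K → ℝ) | (z.1, π.history z.1 z.2 t) ∈ G} :=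
    hzm hG
  have key := lintegral_history_withDensity ρ hπ ρ' hℓ t h (g := G.indicator 1)
    (measurable_one.indicator hG)
  simp only [indicator_history] at key
  rw [lintegral_indicator_one hU] at key
  rw [key, ← lintegral_indicator_one hU,
    ← lintegral_const_mul _ (measurable_one.indicator hU)]
  refine lintegral_mono fun z => ?_
  by_cases hz : (z.1, π.history z.1 z.2 t) ∈ G
  · simpa [Set.indicator, hz] using hr _ hz
  · simp [Set.indicator, hz]

lemma historyProd_moment {ℓ : ℕ → Fin K → ℝ → ℝ≥0∞} (t : ℕ) {x : ℝ} (hx : 0 < x)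
    (d : ℕ → Fin K → ℝ) (z : unitInterval × (ℕ × Fin K → ℝ)) :
    historyProd (fun s i y => ENNReal.ofReal (Real.exp (-(x * d s i))) * ℓ s i y ^ x) t
        (π.history z.1 z.2 t) =
      ENNReal.ofReal (Real.exp (-(x * ∑ s ∈ Finset.range t, d s (π.arm z.1 z.2 s)))) *
        historyProd ℓ t (π.history z.1 z.2 t) ^ x := by
  unfold historyProd
  rw [Finset.prod_mul_distrib, ENNReal.prod_rpow_of_nonneg hx.le]
  congr 1
  rw [← ENNReal.ofReal_prod_of_nonneg fun _ _ => (Real.exp_pos _).le, ← Real.exp_sum,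
    Finset.mul_sum, Finset.sum_range, ← Finset.sum_neg_distrib]
  congr 2
  refine Finset.sum_congr rfl fun s _ => ?_
  rw [Policy.history_apply]

/-- Markov's inequality for the normalized moment of order `x` of the likelihood ratio. -/
lemma interactionMeasure_moment_le (hπ : π.IsMeasurable) {ℓ : ℕ → Fin K → ℝ → ℝ≥0∞}
    (hℓ : ∀ s i, Measurable (ℓ s i)) (t : ℕ) {x : ℝ} {d : ℕ → Fin K → ℝ}
    (hd : ∀ s < t, ∀ i, ∫⁻ y, ℓ s i y ^ x ∂(ρ (s, i)) ≤ ENNReal.ofReal (Real.exp (x * d s i)))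
    (b : ℝ) :
    interactionMeasure ρ {z | ENNReal.ofReal (Real.exp (x * b)) ≤
      historyProd (fun s i y => ENNReal.ofReal (Real.exp (-(x * d s i))) * ℓ s i y ^ x) t
        (π.history z.1 z.2 t)} ≤ ENNReal.ofReal (Real.exp (-(x * b))) := by
  have hw : ∀ s i, Measurable fun y =>
      ENNReal.ofReal (Real.exp (-(x * d s i))) * ℓ s i y ^ x :=
    fun s i => ((hℓ s i).pow_const x).const_mul _
  have h1 := mul_meas_ge_le_lintegral (μ := interactionMeasure ρ)
    ((measurable_historyProd hw t).comp (hπ.history t)) (ENNReal.ofReal (Real.exp (x * b)))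
  rw [Real.exp_neg, ENNReal.ofReal_inv_of_pos (Real.exp_pos _),
    ENNReal.le_inv_iff_mul_le, mul_comm]
  refine h1.trans (lintegral_historyProd_le_one ρ hπ hw t fun s hs i => ?_)
  rw [lintegral_const_mul _ ((hℓ s i).pow_const x)]
  calc _ ≤ ENNReal.ofReal (Real.exp (-(x * d s i))) * ENNReal.ofReal (Real.exp (x * d s i)) := by
        gcongr; exact hd s hs i
    _ = 1 := by rw [← ENNReal.ofReal_mul (Real.exp_pos _).le, ← Real.exp_add]; simp

/-- Change of measure with a moment condition: let `d s i` bound the growth rate of the moment of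
order `x` of the likelihood ratio. An event `G` of the history on which the sum of these rates over
the drawn arms is at most `a` cannot be much less likely under `ρ'` than under `ρ`. -/
lemma interactionMeasure_le_add (hπ : π.IsMeasurable) {ℓ : ℕ → Fin K → ℝ → ℝ≥0∞}
    (hℓ : ∀ s i, Measurable (ℓ s i)) (t : ℕ)
    (h : ∀ s < t, ∀ i, ρ (s, i) = (ρ' (s, i)).withDensity (ℓ s i))
    {x : ℝ} (hx : 0 < x) {d : ℕ → Fin K → ℝ}
    (hd : ∀ s < t, ∀ i, ∫⁻ y, ℓ s i y ^ x ∂(ρ (s, i)) ≤ ENNReal.ofReal (Real.exp (x * d s i)))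
    {G : Set (unitInterval × (Fin t → Fin K × ℝ))} (hG : MeasurableSet G) {a b : ℝ}
    (hGa : ∀ z : unitInterval × (ℕ × Fin K → ℝ), (z.1, π.history z.1 z.2 t) ∈ G →
      ∑ s ∈ Finset.range t, d s (π.arm z.1 z.2 s) ≤ a) :
    interactionMeasure ρ {z | (z.1, π.history z.1 z.2 t) ∈ G} ≤
      ENNReal.ofReal (Real.exp (-(x * b))) +
        ENNReal.ofReal (Real.exp (a + b)) *
          interactionMeasure ρ' {z | (z.1, π.history z.1 z.2 t) ∈ G} := by
  -- the part of `G` where the likelihood ratio is at most `exp (a + b)`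
  obtain ⟨G', hG'⟩ : ∃ G', G' = G ∩ {w | historyProd ℓ t w.2 ≤ ENNReal.ofReal (Real.exp (a + b))} :=
    ⟨_, rfl⟩
  have hG'm : MeasurableSet G' := hG' ▸ hG.inter
    (measurableSet_le ((measurable_historyProd hℓ t).comp measurable_snd) measurable_const)
  have hsmall := (interactionMeasure_le_mul ρ ρ' hπ hℓ t h hG'm
    (r := ENNReal.ofReal (Real.exp (a + b))) (fun w hw => by rw [hG'] at hw; exact hw.2)).trans
      (mul_le_mul_right (measure_mono (t := {z | (z.1, π.history z.1 z.2 t) ∈ G})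
        fun z hz => by rw [hG'] at hz; exact hz.1) _)
  refine le_trans (measure_mono fun z hz => ?_)
      ((measure_union_le _ _).trans (add_le_add
        (interactionMeasure_moment_le ρ hπ hℓ t hd b) hsmall))
  by_cases hzU : (z.1, π.history z.1 z.2 t) ∈ G'
  · exact Or.inr hzU
  · -- elsewhere in `G` the normalized moment exceeds `exp (x b)`
    refine Or.inl ?_
    have hΛz : ENNReal.ofReal (Real.exp (a + b)) ≤ historyProd ℓ t (π.history z.1 z.2 t) := by
      by_contra hlt
      push Not at hlt
      exact hzU (by rw [hG']; exact ⟨hz, hlt.le⟩)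
    have ha := hGa z hz
    rw [Set.mem_ofPred_eq, historyProd_moment t hx]
    calc ENNReal.ofReal (Real.exp (x * b))
        = ENNReal.ofReal (Real.exp (-(x * a))) * ENNReal.ofReal (Real.exp (a + b)) ^ x := by
          rw [ENNReal.ofReal_rpow_of_pos (Real.exp_pos _), ← Real.exp_mul,
            ← ENNReal.ofReal_mul (Real.exp_pos _).le, ← Real.exp_add]
          congr 2; ring
      _ ≤ _ := by
          gcongr

end ChangeOfMeasure

/-! ### The oracle that imitates an algorithm -/

/-- Pigeonhole along an ultrafilter: if events of probability at least `κ` are covered by finitely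
many events, then the same one of these has a probability bounded below for almost all `n`. -/
lemma exists_eventually_le_measure {Ω ι : Type*} [MeasurableSpace Ω] [Fintype ι] [Nonempty ι]
    (𝒰 : Ultrafilter ℕ) (μ : ℕ → Measure Ω) {E : ℕ → Set Ω} {E' : ℕ → ι → Set Ω}
    (hE : ∀ n, E n ⊆ ⋃ d, E' n d) {κ : ℝ} (h : ∀ᶠ n in 𝒰, ENNReal.ofReal κ ≤ μ n (E n)) :
    ∃ d, ∀ᶠ n in 𝒰, ENNReal.ofReal (κ / Fintype.card ι) ≤ μ n (E' n d) := by
  rw [← Ultrafilter.eventually_exists_iff]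
  filter_upwards [h] with n hn
  by_contra hcon
  push Not at hcon
  have hcard : (0 : ℝ) < Fintype.card ι := by exact_mod_cast Fintype.card_pos
  have h1 : μ n (E n) ≤ ∑ d, μ n (E' n d) :=
    (measure_mono (hE n)).trans (measure_iUnion_fintype_le _ _)
  have h2 : ∑ d, μ n (E' n d) < ∑ _d : ι, ENNReal.ofReal (κ / Fintype.card ι) :=
    ENNReal.sum_lt_sum_of_nonempty Finset.univ_nonempty fun d _ => hcon d
  rw [Finset.sum_const, Finset.card_univ, ← ENNReal.ofReal_nsmul, nsmul_eq_mul,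
    mul_div_cancel₀ _ hcard.ne'] at h2
  exact absurd (hn.trans h1) (not_le.2 h2)

lemma batchRounds_congr {C N : ℕ} {f f' : ℕ → Fin K} (h : ∀ s < C * N, f s = f' s) (c : ℕ)
    (i : Fin K) : batchRounds C N f c i = batchRounds C N f' c i := by
  refine Finset.filter_congr fun s hs => ?_
  rw [h s (Finset.mem_range.1 hs)]

/-- The proportions of the draws of the arms in batch `a` of `n` rounds, rounded down to multiples
of `1 / m` and multiplied by `m`, when the arms `f 0, f 1, …` are drawn. -/
def drawnCell (m n : ℕ) (f : ℕ → Fin K) (a : ℕ) : Fin K → Fin (m + 1) := fun i =>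
  ⟨min (m * (batchRounds (a + 1) n f a i).card / n) m, by omega⟩

lemma drawnCell_congr (m n : ℕ) {f f' : ℕ → Fin K} {a : ℕ} (h : ∀ s < (a + 1) * n, f s = f' s) :
    drawnCell m n f a = drawnCell m n f' a := by
  unfold drawnCell
  simp only [batchRounds_congr h]

lemma sum_card_batchRounds_le {n : ℕ} (hn : 0 < n) (f : ℕ → Fin K) (a : ℕ) :
    ∑ i, (batchRounds (a + 1) n f a i).card ≤ n := by
  have hdisj : ∑ i, (batchRounds (a + 1) n f a i).card =
      ((Finset.range ((a + 1) * n)).filter fun s => s / n = a).card := by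
    rw [Finset.card_eq_sum_card_fiberwise (f := f) (t := Finset.univ)
      fun _ _ => Finset.mem_coe.2 (Finset.mem_univ _)]
    refine Finset.sum_congr rfl fun i _ => ?_
    rw [Finset.filter_filter]; rfl
  rw [hdisj]
  have hsub : ((Finset.range ((a + 1) * n)).filter fun s => s / n = a) ⊆
      Finset.Ico (a * n) ((a + 1) * n) := fun s hs => by
    rw [Finset.mem_filter, Finset.mem_range] at hs
    rw [Finset.mem_Ico]
    exact ⟨by rw [← hs.2]; exact Nat.div_mul_le_self s n, hs.1⟩
  refine (Finset.card_le_card hsub).trans (le_of_eq ?_)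
  rw [Nat.card_Ico, Nat.succ_mul]; omega

lemma sum_drawnCell_le (m : ℕ) {n : ℕ} (hn : 0 < n) (f : ℕ → Fin K) (a : ℕ) :
    ∑ i, (drawnCell m n f a i : ℕ) ≤ m := by
  have h1 : n * ∑ i, (drawnCell m n f a i : ℕ) ≤ m * n := by
    rw [Finset.mul_sum]
    calc _ ≤ ∑ i, m * (batchRounds (a + 1) n f a i).card := by
          refine Finset.sum_le_sum fun i _ => ?_
          exact (Nat.mul_le_mul_left n (min_le_left _ _)).trans (Nat.mul_div_le _ _)
      _ ≤ m * n := by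
          rw [← Finset.mul_sum]; exact Nat.mul_le_mul_left m (sum_card_batchRounds_le hn f a)
  rw [Nat.mul_comm m] at h1
  exact Nat.le_of_mul_le_mul_left h1 hn

lemma card_batchRounds_le {m : ℕ} (hm : 0 < m) {n : ℕ} (hn : 0 < n) (f : ℕ → Fin K) (a : ℕ)
    (i : Fin K) :
    ((batchRounds (a + 1) n f a i).card : ℝ) ≤ n * (((drawnCell m n f a i : ℕ) + 1 : ℝ) / m) := by
  have hle : (batchRounds (a + 1) n f a i).card ≤ n :=
    (Finset.single_le_sum (f := fun i => (batchRounds (a + 1) n f a i).card)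
      (fun _ _ => Nat.zero_le _) (Finset.mem_univ i)).trans (sum_card_batchRounds_le hn f a)
  have hmin : (drawnCell m n f a i : ℕ) = m * (batchRounds (a + 1) n f a i).card / n :=
    min_eq_left (Nat.div_le_of_le_mul (by rw [Nat.mul_comm]; exact Nat.mul_le_mul_right m hle))
  have h := Nat.lt_mul_div_succ (m * (batchRounds (a + 1) n f a i).card) hn
  rw [← hmin] at h
  have h' : (m : ℝ) * (batchRounds (a + 1) n f a i).card < n * ((drawnCell m n f a i : ℕ) + 1) := by
    exact_mod_cast h
  rw [mul_div_assoc', le_div_iff₀ (by exact_mod_cast hm)]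
  linarith

/-- The allocation proportional to `c i + 1`. All its weights are positive, so that the oracle that
uses it has an infinite objective as soon as one of the divergences is infinite. -/
def cellAlloc [NeZero K] {m : ℕ} (c : Fin K → Fin (m + 1)) : stdSimplex ℝ (Fin K) :=
  ⟨fun i => ((c i : ℕ) + 1 : ℝ) / ∑ j, ((c j : ℕ) + 1 : ℝ), fun i => by positivity, by
    rw [← Finset.sum_div]
    refine div_self (ne_of_gt (Finset.sum_pos (fun i _ => by positivity) ?_))
    exact ⟨0, Finset.mem_univ _⟩⟩

lemma cellAlloc_pos [NeZero K] {m : ℕ} (c : Fin K → Fin (m + 1)) (i : Fin K) :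
    0 < (cellAlloc c : Fin K → ℝ) i := by
  have : (0 : ℝ) < ∑ j, ((c j : ℕ) + 1 : ℝ) :=
    Finset.sum_pos (fun i _ => by positivity) ⟨0, Finset.mem_univ _⟩
  change 0 < ((c i : ℕ) + 1 : ℝ) / ∑ j, ((c j : ℕ) + 1 : ℝ)
  positivity

lemma le_cellAlloc [NeZero K] {m : ℕ} (hm : 0 < m) (c : Fin K → Fin (m + 1))
    (hc : ∑ i, (c i : ℕ) ≤ m) (i : Fin K) :
    ((c i : ℕ) + 1 : ℝ) / m ≤ (1 + K / m) * (cellAlloc c : Fin K → ℝ) i := by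
  have hm' : (0 : ℝ) < m := by exact_mod_cast hm
  have hpos : (0 : ℝ) < ∑ j, ((c j : ℕ) + 1 : ℝ) :=
    Finset.sum_pos (fun i _ => by positivity) ⟨0, Finset.mem_univ _⟩
  have hle : ∑ j, ((c j : ℕ) + 1 : ℝ) ≤ m + K := by
    rw [Finset.sum_add_distrib]
    have : ∑ j, ((c j : ℕ) : ℝ) ≤ m := by exact_mod_cast hc
    simpa using this
  change _ ≤ (1 + K / m) * (((c i : ℕ) + 1 : ℝ) / ∑ j, ((c j : ℕ) + 1 : ℝ))
  have e : (1 + K / m : ℝ) = (m + K) / m := by field_simp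
  rw [e, div_mul_div_comm, div_le_div_iff₀ hm' (by positivity)]
  have : (0 : ℝ) ≤ ((c i : ℕ) + 1 : ℝ) * m := by positivity
  nlinarith

/-- The laws of the rewards when arm `i` has mean `q b i` in the `b`-th batch of `n` rounds, and
mean `0` (an arbitrary choice) in the rounds after these batches. -/
def batchLaw (F : RewardFamily) (n : ℕ) {b : ℕ} (q : Fin b → Fin K → ℝ) (x : ℕ × Fin K) :
    Measure ℝ :=
  F.law (if h : x.1 / n < b then q ⟨x.1 / n, h⟩ x.2 else 0)

instance (F : RewardFamily) (n : ℕ) {b : ℕ} (q : Fin b → Fin K → ℝ) (x : ℕ × Fin K) :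
    IsProbabilityMeasure (batchLaw F n q x) := by
  unfold batchLaw; infer_instance

section Imitation

variable (F : RewardFamily) (π : (T : ℕ) → Policy K T) (B m : ℕ)

/-- The event that the algorithm with budget `B n` draws the arms in the first `b` batches of `n`
rounds in the rounded proportions `c`. -/
def cellEvent (n : ℕ) {b : ℕ} (c : Fin b → Fin K → Fin (m + 1)) :
    Set (unitInterval × (ℕ × Fin K → ℝ)) :=
  {x | ∀ a : Fin b, drawnCell m n (fun s => (π (B * n)).arm x.1 x.2 s) a = c a}

/-- The rounded proportions `c` keep a positive probability along the ultrafilter if the means of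
the rewards in the first `b` batches are `q`. -/
def IsLikely {b : ℕ} (q : Fin b → Fin K → ℝ) (c : Fin b → Fin K → Fin (m + 1)) : Prop :=
  ∃ κ : ℝ, 0 < κ ∧ ∀ᶠ n in (hyperfilter ℕ : Filter ℕ),
    ENNReal.ofReal κ ≤ interactionMeasure (batchLaw F n q) (cellEvent π B m n c)

open Classical in
/-- Rounded proportions that are likely in the batches seen so far, chosen batch by batch: the
choice for batch `b` uses only the means of the batches up to `b`, as an oracle has to. -/
def likelyCells : (b : ℕ) → (Fin b → Fin K → ℝ) → Fin b → Fin K → Fin (m + 1)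
  | 0 => fun _ => Fin.elim0
  | b + 1 => fun q =>
    let c := likelyCells b (Fin.init q)
    Fin.snoc (α := fun _ => Fin K → Fin (m + 1)) c
      (if h : ∃ d, IsLikely F π B m q (Fin.snoc (α := fun _ => Fin K → Fin (m + 1)) c d) then
        h.choose else 0)

lemma likelyCells_apply {b : ℕ} (q : Fin b → Fin K → ℝ) (a : Fin b) :
    likelyCells F π B m b q a =
      likelyCells F π B m (a + 1) (fun c : Fin (a + 1) => q (Fin.castLE a.isLt c)) (Fin.last a) := by
  induction b with
  | zero => exact a.elim0
  | succ b ih =>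
    refine Fin.lastCases ?_ (fun j => ?_) a
    · rfl
    · have h := ih (Fin.init q) j
      have e : likelyCells F π B m (b + 1) q j.castSucc = likelyCells F π B m b (Fin.init q) j := by
        simp only [likelyCells, Fin.snoc_castSucc]
      rw [e, h]
      rfl

variable {π}
variable [NeZero K]

/-- The drawn proportions in the first `b` batches are determined by the first `b n` rounds. -/
lemma exists_cellEvent_eq (n : ℕ) {b t : ℕ} (ht : b * n ≤ t)
    (c : Fin b → Fin K → Fin (m + 1)) :
    ∃ A : Set (Fin t → Fin K × ℝ), MeasurableSet A ∧
      cellEvent π B m n c = {x | (π (B * n)).history x.1 x.2 t ∈ A} := by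
  let A' : Set (Fin t → Fin K) := {f | ∀ a : Fin b,
    drawnCell m n (fun s => if hs : s < t then f ⟨s, hs⟩ else 0) a = c a}
  have hg : Measurable fun (h : Fin t → Fin K × ℝ) (s : Fin t) => (h s).1 :=
    measurable_pi_lambda _ fun s => measurable_fst.comp (measurable_pi_apply s)
  refine ⟨(fun (h : Fin t → Fin K × ℝ) (s : Fin t) => (h s).1) ⁻¹' A',
    hg (Set.toFinite A').measurableSet, ?_⟩
  ext x
  refine forall_congr' fun a => ?_
  rw [drawnCell_congr m n (f' := fun s => if hs : s < t then
    ((π (B * n)).history x.1 x.2 t ⟨s, hs⟩).1 else 0)]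
  intro s hs
  have hst : s < t := hs.trans_le ((Nat.mul_le_mul_right n a.isLt).trans ht)
  simp only [hst, dif_pos, Policy.history_apply]

/-- A likely choice for the first `b` batches remains likely when the means of the next batch are
revealed, since they do not affect the past, and it extends to this batch by pigeonhole. -/
lemma isLikely_likelyCells (hπ : ∀ T, (π T).IsMeasurable) {b : ℕ} (q : Fin b → Fin K → ℝ) :
    IsLikely F π B m q (likelyCells F π B m b q) := by
  induction b with
  | zero =>
    refine ⟨1, one_pos, Eventually.of_forall fun n => ?_⟩
    have : cellEvent π B m n (likelyCells F π B m 0 q) = Set.univ :=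
      Set.eq_univ_of_forall fun x a => a.elim0
    rw [this, measure_univ]; simp
  | succ b ih =>
    obtain ⟨κ, hκ, h⟩ := ih (Fin.init q)
    obtain ⟨c, hc⟩ : ∃ c, c = likelyCells F π B m b (Fin.init q) := ⟨_, rfl⟩
    rw [← hc] at h
    -- the law of the first `b` batches does not depend on the means in batch `b`
    have h' : ∀ᶠ n in (hyperfilter ℕ : Filter ℕ), ENNReal.ofReal κ ≤
        interactionMeasure (batchLaw F n q) (cellEvent π B m n c) := by
      filter_upwards [h, Nat.hyperfilter_le_atTop (eventually_gt_atTop 0)] with n hn hn0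
      obtain ⟨A, hA, e⟩ := exists_cellEvent_eq B m n (le_refl (b * n)) c
      rw [e] at hn ⊢
      refine hn.trans (le_of_eq ?_)
      refine interactionMeasure_history_congr _ (hπ _) _ _ (fun s hs i => ?_) hA
      have hsb : s / n < b := Nat.div_lt_of_lt_mul (by rwa [Nat.mul_comm])
      simp only [batchLaw, hsb, dif_pos, hsb.trans (Nat.lt_succ_self b)]
      rfl
    obtain ⟨d, hd⟩ := exists_eventually_le_measure (hyperfilter ℕ)
      (fun n => interactionMeasure (batchLaw F n q))
      (E' := fun n d => cellEvent π B m n (Fin.snoc (α := fun _ => Fin K → Fin (m + 1)) c d))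
      (fun n x hx => Set.mem_iUnion.2
        ⟨drawnCell m n (fun s => (π (B * n)).arm x.1 x.2 s) b, fun a => by
          refine Fin.lastCases ?_ (fun j => ?_) a
          · simp
          · simpa using hx j⟩) h'
    have hex : ∃ d, IsLikely F π B m q (Fin.snoc (α := fun _ => Fin K → Fin (m + 1)) c d) :=
      ⟨d, _, by positivity, hd⟩
    have e : likelyCells F π B m (b + 1) q =
        Fin.snoc (α := fun _ => Fin K → Fin (m + 1)) c hex.choose := by
      subst hc
      simp only [likelyCells, hex, dif_pos]
    rw [e]
    exact hex.choose_spec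

/-- Some recommendation has a positive probability jointly with the likely proportions. -/
lemma exists_likely_recommendation (hπ : ∀ T, (π T).IsMeasurable) (Q : Fin B → Fin K → ℝ) :
    ∃ j : Fin K, ∃ κ : ℝ, 0 < κ ∧ ∀ᶠ n in (hyperfilter ℕ : Filter ℕ),
      ENNReal.ofReal κ ≤ interactionMeasure (batchLaw F n Q)
        (cellEvent π B m n (likelyCells F π B m B Q) ∩
          {x | (π (B * n)).recommend x.1 ((π (B * n)).history x.1 x.2 (B * n)) = j}) := by
  obtain ⟨κ, hκ, h⟩ := isLikely_likelyCells F B m hπ Q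
  obtain ⟨j, hj⟩ := exists_eventually_le_measure (hyperfilter ℕ)
    (fun n => interactionMeasure (batchLaw F n Q))
    (E' := fun n j => cellEvent π B m n (likelyCells F π B m B Q) ∩
      {x | (π (B * n)).recommend x.1 ((π (B * n)).history x.1 x.2 (B * n)) = j})
    (fun n x hx => Set.mem_iUnion.2 ⟨_, hx, rfl⟩) h
  have := NeZero.pos K
  exact ⟨j, _, div_pos hκ (by exact_mod_cast Fintype.card_pos), hj⟩

/-- The oracle that allocates and recommends like the algorithm with budget `B n`, in the limit
of large `n`. -/
def imitation (hπ : ∀ T, (π T).IsMeasurable) : BatchOracle K B where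
  alloc := fun b q => cellAlloc (likelyCells F π B m (b + 1) q (Fin.last b))
  recommend := fun Q => (exists_likely_recommendation F B m hπ Q).choose

end Imitation

end BestArm

namespace BestArm

/-! ### No algorithm beats the batch oracles -/

variable {K : ℕ}

lemma batchRounds_eq_of_lt {B n b : ℕ} (hn : 0 < n) (hb : b < B) (f : ℕ → Fin K) (i : Fin K) :
    batchRounds B n f b i = batchRounds (b + 1) n f b i := by
  ext s
  simp only [batchRounds, Finset.mem_filter, Finset.mem_range]
  constructor
  · rintro ⟨_, h1, h2⟩
    exact ⟨by rw [← h1, Nat.mul_comm]; exact Nat.lt_mul_div_succ s hn, h1, h2⟩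
  · rintro ⟨h0, h1, h2⟩
    exact ⟨h0.trans_le (Nat.mul_le_mul_right n hb), h1, h2⟩

/-- A sum over the drawn arms is bounded in terms of the rounded proportions of the draws. -/
lemma sum_range_le_of_drawnCell {B m n : ℕ} (hm : 0 < m) (hn : 0 < n) (f : ℕ → Fin K)
    {c : Fin B → Fin K → Fin (m + 1)} (hc : ∀ b : Fin B, drawnCell m n f b = c b)
    {d : ℕ → Fin K → ℝ} (hd : ∀ b i, 0 ≤ d b i) :
    ∑ s ∈ Finset.range (B * n), d (s / n) (f s) ≤
      n * ∑ b : Fin B, ∑ i, ((c b i : ℕ) + 1 : ℝ) / m * d b i := by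
  rw [← Finset.sum_fiberwise_of_maps_to (g := fun s => (s / n, f s))
    (t := Finset.range B ×ˢ (Finset.univ : Finset (Fin K)))]
  · rw [Finset.sum_product, Finset.sum_range, Finset.mul_sum]
    refine Finset.sum_le_sum fun b _ => ?_
    rw [Finset.mul_sum]
    refine Finset.sum_le_sum fun i _ => ?_
    have hset : (Finset.range (B * n)).filter (fun s => (s / n, f s) = ((b : ℕ), i)) =
        batchRounds B n f b i := by
      ext s; simp [batchRounds]
    rw [hset]
    have e : ∑ s ∈ batchRounds B n f b i, d (s / n) (f s) = (batchRounds B n f b i).card * d b i := by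
      rw [← nsmul_eq_mul, ← Finset.sum_const]
      refine Finset.sum_congr rfl fun s hs => ?_
      obtain ⟨_, h1, h2⟩ := Finset.mem_filter.1 hs
      rw [h1, h2]
    rw [e, batchRounds_eq_of_lt hn b.isLt, ← mul_assoc]
    refine mul_le_mul_of_nonneg_right ?_ (hd _ _)
    have := card_batchRounds_le hm hn f b i
    rwa [hc b] at this
  · intro s hs
    have : s / n < B := Nat.div_lt_of_lt_mul (by rw [Nat.mul_comm]; exact Finset.mem_range.1 hs)
    simp [this]

variable [NeZero K] {F : RewardFamily} {π : (T : ℕ) → Policy K T} {B m : ℕ}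

/-- One instance of the change of measure: if the cells `c` and the recommendation `j` keep a
positive probability under the means `Q` of the batches, then `j` is recommended under `P` with a
probability whose exponent is the information of `c`. -/
lemma errorExponent_le_of_likely (hπ : ∀ T, (π T).IsMeasurable) (hB : 0 < B) (hm : 0 < m)
    {Q : Fin B → Fin K → ℝ} (hQ : ∀ b i, Q b i ∈ F.means) {P : Fin K → ℝ}
    (hP : ∀ i, P i ∈ F.means) (hkl : ∀ b i, F.kl (Q b i) (P i) ≠ ⊤)
    {c : Fin B → Fin K → Fin (m + 1)} {j : Fin K} (hj : j ∉ bestArms P) {κ : ℝ} (hκ : 0 < κ)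
    (hlikely : ∀ᶠ n in (hyperfilter ℕ : Filter ℕ),
      ENNReal.ofReal κ ≤ interactionMeasure (batchLaw F n Q) (cellEvent π B m n c ∩
          {x | (π (B * n)).recommend x.1 ((π (B * n)).history x.1 x.2 (B * n)) = j}))
    {τ : ℝ} (hτ : 0 < τ) :
    errorExponent F P π ≤ ENNReal.ofReal ((∑ b : Fin B, ∑ i,
      ((c b i : ℕ) + 1 : ℝ) / m * ((F.kl (Q b i) (P i)).toReal + τ) + 2 * τ) / B) := by
  choose L hLm hL hLx using fun b i => exists_likelihoodRatio F (hQ b i) (hP i) (hkl b i)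
  obtain ⟨S, hS⟩ : ∃ S, S = ∑ b : Fin B, ∑ i,
      ((c b i : ℕ) + 1 : ℝ) / m * ((F.kl (Q b i) (P i)).toReal + τ) := ⟨_, rfl⟩
  rw [← hS]
  have hB' : (0 : ℝ) < B := by exact_mod_cast hB
  -- a common order for the moments of all likelihood ratios
  obtain ⟨x, hxall, hx⟩ : ∃ x : ℝ, (∀ b i, ∫⁻ y, L b i y ^ x ∂(F.law (Q b i)) ≤
      ENNReal.ofReal (Real.exp (x * ((F.kl (Q b i) (P i)).toReal + τ)))) ∧ 0 < x := by
    have h1 : ∀ᶠ x in 𝓝[>] (0 : ℝ), ∀ b i, ∫⁻ y, L b i y ^ x ∂(F.law (Q b i)) ≤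
        ENNReal.ofReal (Real.exp (x * ((F.kl (Q b i) (P i)).toReal + τ))) :=
      eventually_all.2 fun b => eventually_all.2 fun i => hLx b i τ hτ
    exact (h1.and self_mem_nhdsWithin).exists
  have hsmall : ∀ᶠ n : ℕ in atTop,
      Real.exp (-(x * (n * τ))) + Real.exp (-(n * τ)) < κ := by
    have hlim : ∀ y : ℝ, 0 < y → Tendsto (fun n : ℕ => Real.exp (-(n * y))) atTop (𝓝 0) :=
      fun y hy => Real.tendsto_exp_neg_atTop_nhds_zero.comp
        (tendsto_natCast_atTop_atTop.atTop_mul_const hy)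
    have h2 := (hlim (x * τ) (mul_pos hx hτ)).add (hlim τ hτ)
    rw [add_zero] at h2
    filter_upwards [h2.eventually (gt_mem_nhds hκ)] with n hn
    have e : x * (n * τ) = n * (x * τ) := by ring
    rw [e]; exact hn
  have hmain : ∀ᶠ n in (hyperfilter ℕ : Filter ℕ),
      ENNReal.ofReal (Real.exp (-((S + 2 * τ) / B * (B * n : ℕ)))) ≤
        (π (B * n)).errorProb F P := by
    filter_upwards [hlikely, Nat.hyperfilter_le_atTop (eventually_gt_atTop 0),
      Nat.hyperfilter_le_atTop hsmall] with n hn hn0 hns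
    obtain ⟨A, hA, hAe⟩ := exists_cellEvent_eq B m n (le_refl (B * n)) c (π := π)
    obtain ⟨G, hG⟩ : ∃ G : Set (unitInterval × (Fin (B * n) → Fin K × ℝ)),
      G = {w | w.2 ∈ A ∧ (π (B * n)).recommend w.1 w.2 = j} := ⟨_, rfl⟩
    have hGm : MeasurableSet G := by
      rw [hG]
      exact (measurable_snd hA).inter ((hπ (B * n)).2 (measurableSet_singleton j))
    have hset : cellEvent π B m n c ∩
          {x | (π (B * n)).recommend x.1 ((π (B * n)).history x.1 x.2 (B * n)) = j} =
        {z | (z.1, (π (B * n)).history z.1 z.2 (B * n)) ∈ G} := by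
      rw [hAe, hG]; rfl
    have hdiv : ∀ s < B * n, s / n < B := fun s hs =>
      Nat.div_lt_of_lt_mul (by rwa [Nat.mul_comm])
    have key := interactionMeasure_le_add (batchLaw F n Q) (fun z : ℕ × Fin K => F.law (P z.2))
      (hπ (B * n)) (ℓ := fun s i => if h : s / n < B then L ⟨s / n, h⟩ i else 1)
      (fun s i => by
        split_ifs
        exacts [hLm _ _, measurable_one]) (B * n)
      (fun s hs i => by simp only [batchLaw, hdiv s hs, dif_pos]; exact hL _ _) hx
      (d := fun s i => (if h : s / n < B then (F.kl (Q ⟨s / n, h⟩ i) (P i)).toReal else 0) + τ)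
      (fun s hs i => by simp only [batchLaw, hdiv s hs, dif_pos]; exact hxall _ _) hGm
      (a := n * S) (b := n * τ)
      (fun z hz => by
        have hz' : z ∈ cellEvent π B m n c := by
          have : z ∈ cellEvent π B m n c ∩
            {x | (π (B * n)).recommend x.1 ((π (B * n)).history x.1 x.2 (B * n)) = j} := by
            rw [hset]; exact hz
          exact this.1
        refine (sum_range_le_of_drawnCell hm hn0
          (fun s => (π (B * n)).arm z.1 z.2 s) (fun b => hz' b)
          (d := fun b i => (if h : b < B then (F.kl (Q ⟨b, h⟩ i) (P i)).toReal else 0) + τ)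
          fun b i => ?_).trans (le_of_eq ?_)
        · split_ifs
          · have : 0 ≤ (F.kl (Q ⟨b, by assumption⟩ i) (P i)).toReal := ENNReal.toReal_nonneg
            linarith
          · linarith
        · rw [hS]; simp)
    rw [← hset] at key
    have herr : interactionMeasure (fun z : ℕ × Fin K => F.law (P z.2)) (cellEvent π B m n c ∩
          {x | (π (B * n)).recommend x.1 ((π (B * n)).history x.1 x.2 (B * n)) = j}) ≤
        (π (B * n)).errorProb F P := by
      refine measure_mono fun z hz => ?_
      have hz2 : (π (B * n)).recommend z.1 ((π (B * n)).history z.1 z.2 (B * n)) = j := hz.2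
      change (π (B * n)).recommend z.1 ((π (B * n)).history z.1 z.2 (B * n)) ∉ bestArms P
      rwa [hz2]
    by_contra hlt
    push Not at hlt
    have hbound : ENNReal.ofReal κ ≤ ENNReal.ofReal (Real.exp (-(x * (n * τ))) + Real.exp (-(n * τ))) := by
      refine hn.trans (key.trans ?_)
      rw [ENNReal.ofReal_add (Real.exp_pos _).le (Real.exp_pos _).le]
      gcongr
      calc _ ≤ ENNReal.ofReal (Real.exp (n * S + n * τ)) *
            ENNReal.ofReal (Real.exp (-((S + 2 * τ) / B * (B * n : ℕ)))) := by
            gcongr; exact herr.trans hlt.le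
        _ = ENNReal.ofReal (Real.exp (-(n * τ))) := by
            rw [← ENNReal.ofReal_mul (Real.exp_pos _).le, ← Real.exp_add]
            congr 2
            push_cast
            field_simp
            ring
    have := (ENNReal.ofReal_le_ofReal_iff (by positivity)).1 hbound
    linarith
  refine errorExponent_le ?_
  have hfreq : ∃ᶠ n in (atTop : Filter ℕ),
      ENNReal.ofReal (Real.exp (-((S + 2 * τ) / B * (B * n : ℕ)))) ≤
        (π (B * n)).errorProb F P := hmain.frequently.filter_mono Nat.hyperfilter_le_atTop
  exact (tendsto_id.const_mul_atTop' hB).frequently hfreq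

lemma sum_likelyCells_le (hπ : ∀ T, (π T).IsMeasurable) (Q : Fin B → Fin K → ℝ) (b : Fin B) :
    ∑ i, (likelyCells F π B m B Q b i : ℕ) ≤ m := by
  obtain ⟨κ, hκ, h⟩ := isLikely_likelyCells F B m hπ Q
  obtain ⟨n, hn, hn0⟩ := (h.and (Nat.hyperfilter_le_atTop (eventually_gt_atTop 0))).exists
  have hne : (cellEvent π B m n (likelyCells F π B m B Q)).Nonempty := by
    rw [Set.nonempty_iff_ne_empty]
    intro he
    rw [he, measure_empty, nonpos_iff_eq_zero, ENNReal.ofReal_eq_zero] at hn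
    linarith
  obtain ⟨x, hx⟩ := hne
  rw [← hx b]
  exact sum_drawnCell_le m hn0 _ _

/-- The rate of an algorithm is at most the value of its imitation, up to the error of the
rounding of the proportions. -/
lemma worstRate_le_mul_value_imitation (hπ : ∀ T, (π T).IsMeasurable) (hB : 0 < B) (hm : 0 < m)
    {Θ : Set ℝ} (hΘ : Θ ⊆ F.means) {H : (Fin K → ℝ) → ℝ≥0∞} :
    worstRate F Θ H π ≤ ENNReal.ofReal (1 + K / m) * (imitation F B m hπ).value F Θ H := by
  have hc0 : ENNReal.ofReal (1 + K / m) ≠ 0 := by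
    rw [Ne, ENNReal.ofReal_eq_zero, not_le]; positivity
  rw [← ENNReal.div_le_iff' hc0 ENNReal.ofReal_ne_top]
  refine le_iInf₂ fun Q hQ => le_iInf₂ fun P hP => le_iInf fun hJ => ?_
  rw [ENNReal.div_le_iff' hc0 ENNReal.ofReal_ne_top]
  by_cases hHP : H P = ⊤
  · rw [weigh, if_pos hHP, ENNReal.mul_top hc0]; exact le_top
  have hP' : ∀ i, P i ∈ F.means := fun i => hΘ (hP i)
  refine (iInf₂_le P hP).trans ?_
  rw [weigh, weigh, if_neg hHP, if_neg hHP, mul_left_comm]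
  gcongr
  obtain ⟨c, hc⟩ : ∃ c, c = likelyCells F π B m B Q := ⟨_, rfl⟩
  have halloc : ∀ b : Fin B, ((imitation F B m hπ).alloc b
      fun a : Fin (b + 1) => Q (Fin.castLE b.isLt a)) = cellAlloc (c b) := fun b => by
    rw [hc, likelyCells_apply]; rfl
  simp only [halloc]
  by_cases hkl : ∀ b i, F.kl (Q b i) (P i) ≠ ⊤
  · obtain ⟨κ, hκ, hlikely⟩ := (exists_likely_recommendation F B m hπ Q).choose_spec
    have hlim : errorExponent F P π ≤ ENNReal.ofReal ((∑ b : Fin B, ∑ i,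
        ((c b i : ℕ) + 1 : ℝ) / m * (F.kl (Q b i) (P i)).toReal) / B) := by
      have ht : Tendsto (fun τ : ℝ => ENNReal.ofReal ((∑ b : Fin B, ∑ i,
          ((c b i : ℕ) + 1 : ℝ) / m * ((F.kl (Q b i) (P i)).toReal + τ) + 2 * τ) / B)) (𝓝[>] 0)
          (𝓝 (ENNReal.ofReal ((∑ b : Fin B, ∑ i,
          ((c b i : ℕ) + 1 : ℝ) / m * ((F.kl (Q b i) (P i)).toReal + 0) + 2 * 0) / B))) := by
        refine Tendsto.mono_left ?_ nhdsWithin_le_nhds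
        refine (ENNReal.continuous_ofReal.comp ?_).tendsto (0 : ℝ)
        fun_prop
      simp only [add_zero, mul_zero] at ht
      refine ge_of_tendsto ht (eventually_mem_nhdsWithin.mono fun τ hτ => ?_)
      subst hc
      exact errorExponent_le_of_likely hπ hB hm hQ hP' hkl hJ hκ hlikely hτ
    refine hlim.trans ?_
    have hsum : ∑ b : Fin B, ∑ i, ENNReal.ofReal ((cellAlloc (c b) : Fin K → ℝ) i) *
        F.kl (Q b i) (P i) = ENNReal.ofReal (∑ b : Fin B, ∑ i,
          (cellAlloc (c b) : Fin K → ℝ) i * (F.kl (Q b i) (P i)).toReal) := by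
      have h0 : ∀ b i, 0 ≤ (cellAlloc (c b) : Fin K → ℝ) i * (F.kl (Q b i) (P i)).toReal :=
        fun b i => mul_nonneg (cellAlloc_pos _ _).le ENNReal.toReal_nonneg
      rw [ENNReal.ofReal_sum_of_nonneg fun b _ => Finset.sum_nonneg fun i _ => h0 b i]
      refine Finset.sum_congr rfl fun b _ => ?_
      rw [ENNReal.ofReal_sum_of_nonneg fun i _ => h0 b i]
      refine Finset.sum_congr rfl fun i _ => ?_
      rw [ENNReal.ofReal_mul (cellAlloc_pos _ _).le, ENNReal.ofReal_toReal (hkl b i)]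
    rw [hsum, ← ENNReal.ofReal_natCast B,
      ← ENNReal.ofReal_div_of_pos (by exact_mod_cast hB), ← ENNReal.ofReal_mul (by positivity),
      mul_div_assoc']
    refine ENNReal.ofReal_le_ofReal (div_le_div_of_nonneg_right ?_ (by positivity))
    rw [Finset.mul_sum]
    refine Finset.sum_le_sum fun b _ => ?_
    rw [Finset.mul_sum]
    refine Finset.sum_le_sum fun i _ => ?_
    rw [← mul_assoc]
    exact mul_le_mul_of_nonneg_right
      (le_cellAlloc hm (c b) (hc ▸ sum_likelyCells_le hπ Q b) i) ENNReal.toReal_nonneg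
  · -- all weights are positive, so that an infinite divergence makes the value infinite
    push Not at hkl
    obtain ⟨b, i, hbi⟩ := hkl
    have htop : ∑ b : Fin B, ∑ i, ENNReal.ofReal ((cellAlloc (c b) : Fin K → ℝ) i) *
        F.kl (Q b i) (P i) = ⊤ := by
      refine ENNReal.sum_eq_top.2 ⟨b, Finset.mem_univ _, ENNReal.sum_eq_top.2
        ⟨i, Finset.mem_univ _, ?_⟩⟩
      rw [hbi, ENNReal.mul_top]
      simpa using cellAlloc_pos (c b) i
    rw [htop, ENNReal.top_div_of_ne_top (by simp), ENNReal.mul_top hc0]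
    exact le_top

/-- The rate of an algorithm is at most the rate of the `B`-batch oracle, for every `B`. -/
lemma worstRate_le_RgoBatch (hπ : ∀ T, (π T).IsMeasurable) (hB : 0 < B)
    {Θ : Set ℝ} (hΘ : Θ ⊆ F.means) {H : (Fin K → ℝ) → ℝ≥0∞} :
    worstRate F Θ H π ≤ RgoBatch F Θ H B := by
  have h : ∀ m : ℕ, worstRate F Θ H π ≤
      ENNReal.ofReal (1 + K / (m + 1 : ℕ)) * RgoBatch F Θ H B := fun m =>
    (worstRate_le_mul_value_imitation hπ hB (Nat.succ_pos m) hΘ).trans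
      (mul_le_mul_right (le_iSup (fun o : BatchOracle K B => o.value F Θ H) _) _)
  have hlim : Tendsto (fun m : ℕ => ENNReal.ofReal (1 + K / (m + 1 : ℕ)) * RgoBatch F Θ H B) atTop
      (𝓝 (ENNReal.ofReal (1 + 0) * RgoBatch F Θ H B)) := by
    refine ENNReal.Tendsto.mul_const (ENNReal.tendsto_ofReal (tendsto_const_nhds.add ?_))
      (Or.inl (by simp))
    exact (tendsto_const_div_atTop_nhds_zero_nat (K : ℝ)).comp (tendsto_add_atTop_nat 1)
  have := ge_of_tendsto' hlim h
  simpa using this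

end BestArm

end

/-! ### Optimality of delayed optimal tracking -/

theorem mainTheorem1 {K : ℕ} [NeZero K] (F : BestArm.RewardFamily) (Θ : Set ℝ)
    (hΘ : Θ ⊆ F.means) (H : (Fin K → ℝ) → ℝ≥0∞)
    (hH : ∀ P : Fin K → ℝ, (∀ i, P i ∈ Θ) → 0 < H P)
    (hR : BestArm.Rgo F Θ H < ⊤) :
    ∃ Rinf : ℝ≥0,
      Tendsto (fun B : ℕ => BestArm.RgoBatch F Θ H B) atTop (𝓝 (Rinf : ℝ≥0∞)) ∧
      (∀ η : ℝ, 0 < η → ∃ (B : ℕ) (ε : ℝ), 1 ≤ B ∧ 0 < ε ∧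
        (∃ o : BestArm.BatchOracle K B, o.IsOptimalUpTo F Θ H ε) ∧
        (∃ n : ℕ → (Fin K → ℝ) → Fin K → ℕ, BestArm.IsRounding n) ∧
        ∀ o : BestArm.BatchOracle K B, o.IsOptimalUpTo F Θ H ε →
          ∀ n : ℕ → (Fin K → ℝ) → Fin K → ℕ, BestArm.IsRounding n →
            (Rinf : ℝ≥0∞) - ENNReal.ofReal η ≤
              BestArm.worstRate F Θ H fun T => BestArm.dot o n T) ∧
      ∀ π : (T : ℕ) → BestArm.Policy K T, (∀ T, (π T).IsMeasurable) →
        BestArm.worstRate F Θ H π ≤ (Rinf : ℝ≥0∞) := by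
  obtain ⟨R, hRdef⟩ : ∃ R, R = ⨅ B : ℕ, BestArm.RgoBatch F Θ H (B + 1) := ⟨_, rfl⟩
  have h1 : BestArm.RgoBatch F Θ H 1 < ⊤ := (BestArm.RgoBatch_one_le F Θ H).trans_lt hR
  have hRtop : R ≠ ⊤ := hRdef ▸ ne_top_of_le_ne_top h1.ne (iInf_le _ 0)
  have hRle : ∀ B, 0 < B → R ≤ BestArm.RgoBatch F Θ H B := fun B hB => by
    rw [hRdef]
    refine (iInf_le _ (B - 1)).trans (le_of_eq ?_)
    rw [Nat.sub_add_cancel hB]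
  have hfin : ∀ B, 0 < B → BestArm.RgoBatch F Θ H B ≠ ⊤ := fun B hB =>
    ne_top_of_le_ne_top (ENNReal.mul_ne_top ENNReal.ofReal_ne_top h1.ne)
      (BestArm.RgoBatch_le_mul F Θ H hB one_pos)
  refine ⟨R.toNNReal, ?_, fun η hη => ?_, fun π hπ => ?_⟩
  · rw [ENNReal.coe_toNNReal hRtop, hRdef]
    exact BestArm.tendsto_RgoBatch F Θ H
  · rw [ENNReal.coe_toNNReal hRtop]
    -- the factor `B / (B + K - 1)` of the rate of DOT tends to `1`
    have hlim : Tendsto (fun B : ℕ => ENNReal.ofReal (B / (B + K - 1 : ℕ)) *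
        (R - ENNReal.ofReal (η / 2))) atTop (𝓝 (ENNReal.ofReal 1 * (R - ENNReal.ofReal (η / 2)))) := by
      refine ENNReal.Tendsto.mul_const (ENNReal.tendsto_ofReal ?_) (Or.inl (by simp))
      have h := tendsto_natCast_div_add_atTop ((K : ℝ) - 1)
      refine h.congr' ?_
      filter_upwards with B
      have : 1 ≤ B + K := by have := NeZero.pos K; omega
      rw [Nat.cast_sub this]
      push_cast
      ring_nf
    rw [ENNReal.ofReal_one, one_mul] at hlim
    have hev : ∀ᶠ B : ℕ in atTop, R - ENNReal.ofReal η ≤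
        ENNReal.ofReal (B / (B + K - 1 : ℕ)) * (R - ENNReal.ofReal (η / 2)) := by
      by_cases hz : R ≤ ENNReal.ofReal η
      · refine Eventually.of_forall fun B => ?_
        rw [tsub_eq_zero_of_le hz]; exact zero_le
      · push Not at hz
        refine (hlim.eventually (lt_mem_nhds ?_)).mono fun B hB => hB.le
        have hlt : ENNReal.ofReal (η / 2) < ENNReal.ofReal η :=
          (ENNReal.ofReal_lt_ofReal_iff hη).2 (by linarith)
        exact (ENNReal.cancel_of_ne
          (ne_top_of_le_ne_top hRtop (tsub_le_self (b := ENNReal.ofReal η)))).tsub_lt_tsub_left_of_le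
            hz.le hlt
    obtain ⟨B, hB, hBpos⟩ := (hev.and (eventually_gt_atTop 0)).exists
    refine ⟨B, η / 2, hBpos, by linarith, ?_, BestArm.exists_isRounding, fun o ho n hn => ?_⟩
    · by_cases hz : BestArm.RgoBatch F Θ H B ≤ ENNReal.ofReal (η / 2)
      · refine ⟨⟨fun _ _ => ⟨Pi.single 0 1, single_mem_stdSimplex ℝ 0⟩, fun _ => 0⟩, ?_⟩
        rw [BestArm.BatchOracle.IsOptimalUpTo, tsub_eq_zero_of_le hz]
        exact zero_le
      · push Not at hz
        have hlt : BestArm.RgoBatch F Θ H B - ENNReal.ofReal (η / 2) < BestArm.RgoBatch F Θ H B := by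
          refine ENNReal.sub_lt_self (hfin B hBpos) (ne_bot_of_gt hz) ?_
          rw [Ne, ENNReal.ofReal_eq_zero, not_le]; linarith
        obtain ⟨o, ho⟩ := lt_iSup_iff.1 hlt
        exact ⟨o, ho.le⟩
    · have hV : o.value F Θ H ≠ ⊤ := ne_top_of_le_ne_top (hfin B hBpos)
        (le_iSup (fun o : BestArm.BatchOracle K B => o.value F Θ H) o)
      refine hB.trans (le_trans ?_ (BestArm.mul_value_le_worstRate_dot o hBpos F hΘ H hH hn hV))
      gcongr
      exact (tsub_le_tsub_right (hRle B hBpos) _).trans ho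
  · rw [ENNReal.coe_toNNReal hRtop, hRdef]
    exact le_iInf fun B => BestArm.worstRate_le_RgoBatch hπ (Nat.succ_pos B) hΘ
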